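/- **Setting.** Let $\Omega\subseteq\mathbb R^2$ be open and let $(q,r)$ be a complex-valued $C^2$ solution on $\Omega$ (a "seed") of the coupled CLL-NLS system $$r_t-\mathrm i r_{xx}+\mathrm i r^2q+rq\,r_x=0,\qquad q_t+\mathrm i q_{xx}-\mathrm i q^2r+qr\,q_x=0 .$$ Its Lax pair is $\Phi_x=U\Phi$, $\Phi_t=V\Phi$ with spectral parameter $\lambda\in\mathbb C$, where $\sigma_3=\mathrm{diag}(1,-1)$, $Q=\begin{pmatrix}0&r\\q&0\end{pmatrix}$ and $$U=\mathrm i\sigma_3\lambda^2+Q\lambda-\tfrac12\mathrm i\sigma_3+\tfrac14\mathrm iQ^2\sigma_3,$$ $$V=-2\mathrm i\sigma_3\lambda^4-2Q\lambda^3+(2\mathrm i\sigma_3-\mathrm iQ^2\sigma_3)\lambda^2+(Q+\mathrm i\sigma_3Q_x-\tfrac12Q^3)\lambda-\tfrac12\mathrm i\sigma_3-\tfrac18\mathrm iQ^4\sigma_3+\tfrac14(QQ_x-Q_xQ).$$ Let $H$ be a nowhere vanishing $C^2$ function on $\Omega$ with $$H_x=\tfrac12\mathrm i(qr-2)H,\qquad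 H_t=-\tfrac14(4\mathrm i+\mathrm iq^2r^2-2rq_x+2qr_x)H,$$ and let $\sqrt H$ be a continuous branch on $\Omega$. Let $n\ge1$, $\lambda_1,\dots,\lambda_n\in\mathbb C$, and let $\Phi_k=(f_k,g_k)^T$ be a $C^2$ solution on $\Omega$ of the Lax pair with $\lambda=\lambda_k$ $(1\le k\le n)$. For $m\le n$ let $\Delta_m^1,\Delta_m^2$ be the $m\times m$ matrices whose $k$-th rows are $$(\lambda_k^{m-1}f_k,\ \lambda_k^{m-2}g_k,\ \lambda_k^{m-3}f_k,\ \dots),\qquad(\lambda_k^{m-1}g_k,\ \lambda_k^{m-2}f_k,\ \lambda_k^{m-3}g_k,\ \dots)$$ (alternating down to the power $\lambda_k^0$). Put $\eta_n^1=(\lambda_1^nf_1,\dots,\lambda_n^nf_n)^T$, $\eta_n^2=(\lambda_1^ng_1,\dots,\lambda_n^ng_n)^T$ and, with $n$ entries each, $\xi_n^1=(0,\lambda^{n-2},0,\lambda^{n-4},\dots)$, $\xi_n^2=(\lambda^{n-1},0,\lambda^{n-3},0,\dots)$. Let $$M_n=\begin{pmatrix}\begin{vmatrix}\lambda^n&\xi_n^1\\\eta_n^1&\Delta_n^2\end{vmatrix}&\begin{vmatrix}0&\xi_n^2\\\eta_n^1&\Delta_n^2\end{vmatrix}\\[2ex]\begin{vmatrix}0&\xi_n^2\\\eta_n^2&\Delta_n^1\end{vmatrix}&\begin{vmatrix}\lambda^n&\xi_n^1\\\eta_n^2&\Delta_n^1\end{vmatrix}\end{pmatrix}.$$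 Suppose that $|\Delta_n^1||\Delta_n^2|$ vanishes nowhere on $\Omega$ and let $\sqrt{|\Delta_n^1||\Delta_n^2|}$ be a continuous branch of its square root. Define $$T_n(\lambda;\lambda_1,\dots,\lambda_n)=\begin{cases}\dfrac1{\sqrt{|\Delta_n^1||\Delta_n^2|}}\,M_n,& n\text{ even},\\[2ex]\dfrac1{\sqrt{|\Delta_n^1||\Delta_n^2|}}\begin{pmatrix}\sqrt H&0\\0&1/\sqrt H\end{pmatrix}M_n,& n\text{ odd}.\end{cases}$$ **Theorem.** $T_n$ is the $n$-fold Darboux transformation of the coupled CLL-NLS system. That is, there are functions $(q_n,r_n)$ on $\Omega$ such that: 1. $(q_n,r_n)$ is a $C^2$ solution of the coupled CLL-NLS system, and with $U^{[n]},V^{[n]}$ obtained from $U,V$ by replacing $(q,r)$ by $(q_n,r_n)$, for all $\lambda\in\mathbb C$, $$(T_n)_x+T_nU=U^{[n]}T_n,\qquad (T_n)_t+T_nV=V^{[n]}T_n .$$ 2. $T_n(\lambda_k;\lambda_1,\dots,\lambda_n)\,\Phi_k=0$ for $k=1,\dots,n$. 3. Suppose in addition that for every $1\le m<n$ the function $|\Delta_m^1||\Delta_m^2|$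 vanishes nowhere on $\Omega$ and has a continuous square root there. Then $T_n$ is the composition of $n$ successive one-fold transformations: for suitable continuous branches of the square roots, $T_n=T_1^{[n-1]}(\lambda,\lambda_n)\cdots T_1^{[1]}(\lambda,\lambda_2)\,T_1^{[0]}(\lambda,\lambda_1)$ with $$T_1^{[k]}(\lambda,\lambda_{k+1})=\frac1{\sqrt{fg}}\begin{pmatrix}\sqrt{H_k}&0\\0&1/\sqrt{H_k}\end{pmatrix}\begin{pmatrix}\lambda g&-\lambda_{k+1}f\\-\lambda_{k+1}g&\lambda f\end{pmatrix},\qquad \begin{pmatrix}f\\g\end{pmatrix}=\bigl(T_1^{[k-1]}\cdots T_1^{[0]}\bigr)\big|_{\lambda=\lambda_{k+1}}\Phi_{k+1}.$$ Here $f,g$ vanish nowhere; $T_1^{[k]}$ satisfies the two equations of part 1 from potentials $(q_k,r_k)$ to $(q_{k+1},r_{k+1})$, where $(q_0,r_0)=(q,r)$ and the last pair is the $(q_n,r_n)$ above; $H_0=H$; and $H_{k+1}=f/g$, which solves the equations for $H$ with $(q,r)$ replaced by $(q_{k+1},r_{k+1})$. -/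

import Mathlib

namespace CLL

open Complex Matrix

/-- `u` is twice continuously differentiable, jointly in `(x, t)`, on `Ω`. -/
def IsC2On (Ω : Set (ℝ × ℝ)) (u : ℝ → ℝ → ℂ) : Prop :=
  ContDiffOn ℝ 2 (fun p : ℝ × ℝ => u p.1 p.2) Ω

/-- The partial derivative with respect to `x`. -/
noncomputable def dx (u : ℝ → ℝ → ℂ) (x t : ℝ) : ℂ := deriv (fun y => u y t) x

/-- The partial derivative with respect to `t`. -/
noncomputable def dt (u : ℝ → ℝ → ℂ) (x t : ℝ) : ℂ := deriv (fun τ => u x τ) t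

/-- `(q, r)` is a (classical) solution on `Ω` of the coupled CLL-NLS system
`r_t - i r_xx + i r² q + r q r_x = 0`, `q_t + i q_xx - i q² r + q r q_x = 0`. -/
structure IsSolution (Ω : Set (ℝ × ℝ)) (q r : ℝ → ℝ → ℂ) : Prop where
  c2_q : IsC2On Ω q
  c2_r : IsC2On Ω r
  eq_r : ∀ x t : ℝ, (x, t) ∈ Ω →
    dt r x t - I * dx (dx r) x t + I * r x t ^ 2 * q x t + r x t * q x t * dx r x t = 0
  eq_q : ∀ x t : ℝ, (x, t) ∈ Ω →
    dt q x t + I * dx (dx q) x t - I * q x t ^ 2 * r x t + q x t * r x t * dx q x t = 0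

/-- The Pauli matrix `σ₃`. -/
def σ₃ : Matrix (Fin 2) (Fin 2) ℂ := !![1, 0; 0, -1]

/-- The potential matrix `Q`. -/
def Qmat (q r : ℂ) : Matrix (Fin 2) (Fin 2) ℂ := !![0, r; q, 0]

/-- The matrix `U` of the `x`-part of the Lax pair, at a point where the potentials have the values
`q` and `r`, with spectral parameter `l`. -/
noncomputable def laxU (q r l : ℂ) : Matrix (Fin 2) (Fin 2) ℂ :=
  (I * l ^ 2) • σ₃ + l • Qmat q r - (1 / 2 * I) • σ₃ + (1 / 4 * I) • (Qmat q r ^ 2 * σ₃)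

/-- The matrix `V` of the `t`-part of the Lax pair, at a point where the potentials have the values
`q`, `r` and the `x`-derivatives `qx`, `rx`, with spectral parameter `l`. -/
noncomputable def laxV (q r qx rx l : ℂ) : Matrix (Fin 2) (Fin 2) ℂ :=
  (-2 * I * l ^ 4) • σ₃ - (2 * l ^ 3) • Qmat q r
    + (l ^ 2) • ((2 * I) • σ₃ - I • (Qmat q r ^ 2 * σ₃))
    + l • (Qmat q r + I • (σ₃ * Qmat qx rx) - (1 / 2 : ℂ) • Qmat q r ^ 3)
    - (1 / 2 * I) • σ₃ - (1 / 8 * I) • (Qmat q r ^ 4 * σ₃)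
    + (1 / 4 : ℂ) • (Qmat q r * Qmat qx rx - Qmat qx rx * Qmat q r)

/-- `φ = (f, g)ᵀ` is an eigenfunction of the Lax pair of `(q, r)` on `Ω` with spectral parameter
`l`: `φ_x = U φ` and `φ_t = V φ`. -/
structure IsEigenfunction (Ω : Set (ℝ × ℝ)) (q r : ℝ → ℝ → ℂ) (l : ℂ)
    (φ : ℝ → ℝ → Fin 2 → ℂ) : Prop where
  c2 : ∀ i, IsC2On Ω (fun x t => φ x t i)
  eq_x : ∀ x t : ℝ, (x, t) ∈ Ω → ∀ i,
    HasDerivAt (fun y => φ y t i) ((laxU (q x t) (r x t) l *ᵥ φ x t) i) x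
  eq_t : ∀ x t : ℝ, (x, t) ∈ Ω → ∀ i,
    HasDerivAt (fun τ => φ x τ i)
      ((laxV (q x t) (r x t) (dx q x t) (dx r x t) l *ᵥ φ x t) i) t

/-- `H` is a factor belonging to `(q, r)` on `Ω`: a nowhere vanishing solution of
`H_x = (i/2)(qr - 2) H`, `H_t = -(1/4)(4i + i q² r² - 2 r q_x + 2 q r_x) H`. -/
structure IsFactor (Ω : Set (ℝ × ℝ)) (q r H : ℝ → ℝ → ℂ) : Prop where
  c2 : IsC2On Ω H
  ne_zero : ∀ x t : ℝ, (x, t) ∈ Ω → H x t ≠ 0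
  eq_x : ∀ x t : ℝ, (x, t) ∈ Ω →
    HasDerivAt (fun y => H y t) (1 / 2 * I * (q x t * r x t - 2) * H x t) x
  eq_t : ∀ x t : ℝ, (x, t) ∈ Ω →
    HasDerivAt (fun τ => H x τ)
      (-(1 / 4) * (4 * I + I * q x t ^ 2 * r x t ^ 2 - 2 * r x t * dx q x t
        + 2 * q x t * dx r x t) * H x t) t

/-- `s` is a continuous branch of `√u` on `Ω`. -/
def IsSqrtOn (Ω : Set (ℝ × ℝ)) (s u : ℝ → ℝ → ℂ) : Prop :=
  ContinuousOn (fun p : ℝ × ℝ => s p.1 p.2) Ω ∧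
    ∀ x t : ℝ, (x, t) ∈ Ω → s x t ^ 2 = u x t

/-- The matrix function `T(l; x, t)` transforms the Lax pair of `(q, r)` into that of `(q', r')`:
`T_x + T U = U' T` and `T_t + T V = V' T` for every spectral parameter `l`. -/
def IsDarboux (Ω : Set (ℝ × ℝ)) (q r q' r' : ℝ → ℝ → ℂ)
    (T : ℂ → ℝ → ℝ → Matrix (Fin 2) (Fin 2) ℂ) : Prop :=
  ∀ x t : ℝ, (x, t) ∈ Ω → ∀ (l : ℂ) (i j : Fin 2),
    HasDerivAt (fun y => T l y t i j)
      ((laxU (q' x t) (r' x t) l * T l x t - T l x t * laxU (q x t) (r x t) l) i j) x ∧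
    HasDerivAt (fun τ => T l x τ i j)
      ((laxV (q' x t) (r' x t) (dx q' x t) (dx r' x t) l * T l x t
        - T l x t * laxV (q x t) (r x t) (dx q x t) (dx r x t) l) i j) t

/-- The one-fold transformation
`(fg)^(-1/2) diag(√H, 1/√H) ((l g, -l₁ f), (-l₁ g, l f))`, built from `φ = (f, g)ᵀ`, a value `h` of
`√H` and a value `s` of `√(fg)`. -/
noncomputable def oneFold (l₁ h s : ℂ) (φ : Fin 2 → ℂ) (l : ℂ) : Matrix (Fin 2) (Fin 2) ℂ :=
  s⁻¹ • (!![h, 0; 0, h⁻¹] * !![l * φ 1, -l₁ * φ 0; -l₁ * φ 1, l * φ 0])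

/-- `IsIterated Ω lam Φ q r H n T q' r' H'`: on `Ω`, the matrix `T` is the product
`T₁^[n-1](l; λₙ) ⋯ T₁^[1](l; λ₂) T₁(l; λ₁)` of `n` successive one-fold Darboux transformations
starting from `(q, r)` and `H`, and it leads to the potentials `(q', r')` and to the factor `H'`.
The step from `k` to `k + 1` uses the transformed eigenfunction `T_k(λ_{k+1}) Φ_{k+1} = (f, g)ᵀ` and
the factor belonging to the potentials reached so far; the factor that belongs to the new
potentials is normalized by `(g / f) H'' = 1`.
(Eigenfunctions are counted from `0` in the code.) -/
inductive IsIterated (Ω : Set (ℝ × ℝ)) (lam : ℕ → ℂ) (Φ : ℕ → ℝ → ℝ → Fin 2 → ℂ)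
    (q r H : ℝ → ℝ → ℂ) :
    ℕ → (ℂ → ℝ → ℝ → Matrix (Fin 2) (Fin 2) ℂ) →
      (ℝ → ℝ → ℂ) → (ℝ → ℝ → ℂ) → (ℝ → ℝ → ℂ) → Prop
  | zero : IsIterated Ω lam Φ q r H 0 (fun _ _ _ => 1) q r H
  | succ (k : ℕ) (T T' : ℂ → ℝ → ℝ → Matrix (Fin 2) (Fin 2) ℂ)
      (q' r' H' q'' r'' H'' h s : ℝ → ℝ → ℂ) (φ : ℝ → ℝ → Fin 2 → ℂ)
      (prev : IsIterated Ω lam Φ q r H k T q' r' H')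
      (φ_eq : ∀ x t : ℝ, (x, t) ∈ Ω → φ x t = T (lam k) x t *ᵥ Φ k x t)
      (f_ne : ∀ x t : ℝ, (x, t) ∈ Ω → φ x t 0 ≠ 0)
      (g_ne : ∀ x t : ℝ, (x, t) ∈ Ω → φ x t 1 ≠ 0)
      (h_sqrt : IsSqrtOn Ω h H')
      (s_sqrt : IsSqrtOn Ω s (fun x t => φ x t 0 * φ x t 1))
      (step : IsDarboux Ω q' r' q'' r''
        (fun l x t => oneFold (lam k) (h x t) (s x t) (φ x t) l))
      (T_eq : ∀ x t : ℝ, (x, t) ∈ Ω → ∀ l : ℂ,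
        T' l x t = oneFold (lam k) (h x t) (s x t) (φ x t) l * T l x t)
      (factor : IsFactor Ω q'' r'' H'')
      (normalized : ∀ x t : ℝ, (x, t) ∈ Ω → φ x t 1 / φ x t 0 * H'' x t = 1) :
      IsIterated Ω lam Φ q r H (k + 1) T' q'' r'' H''

/-- The matrix `Δₙ¹`: row `k` is `(λₖ^(n-1) fₖ, λₖ^(n-2) gₖ, λₖ^(n-3) fₖ, …)`, with
`φ k = (fₖ, gₖ)`. -/
def Δ₁ (n : ℕ) (lam : ℕ → ℂ) (φ : ℕ → Fin 2 → ℂ) : Matrix (Fin n) (Fin n) ℂ :=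
  Matrix.of fun k j =>
    lam k ^ (n - 1 - (j : ℕ)) * (if Even (j : ℕ) then φ k 0 else φ k 1)

/-- The matrix `Δₙ²`: row `k` is `(λₖ^(n-1) gₖ, λₖ^(n-2) fₖ, λₖ^(n-3) gₖ, …)`. -/
def Δ₂ (n : ℕ) (lam : ℕ → ℂ) (φ : ℕ → Fin 2 → ℂ) : Matrix (Fin n) (Fin n) ℂ :=
  Matrix.of fun k j =>
    lam k ^ (n - 1 - (j : ℕ)) * (if Even (j : ℕ) then φ k 1 else φ k 0)

/-- The row `ξₙ¹ = (0, l^(n-2), 0, l^(n-4), …)`. -/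
def ξ₁ (n : ℕ) (l : ℂ) : Fin n → ℂ :=
  fun j => if Even (j : ℕ) then 0 else l ^ (n - 1 - (j : ℕ))

/-- The row `ξₙ² = (l^(n-1), 0, l^(n-3), 0, …)`. -/
def ξ₂ (n : ℕ) (l : ℂ) : Fin n → ℂ :=
  fun j => if Even (j : ℕ) then l ^ (n - 1 - (j : ℕ)) else 0

/-- The column `ηₙ¹` with entries `λₖ^n fₖ`. -/
def η₁ (n : ℕ) (lam : ℕ → ℂ) (φ : ℕ → Fin 2 → ℂ) : Fin n → ℂ := fun k => lam k ^ n * φ k 0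

/-- The column `ηₙ²` with entries `λₖ^n gₖ`. -/
def η₂ (n : ℕ) (lam : ℕ → ℂ) (φ : ℕ → Fin 2 → ℂ) : Fin n → ℂ := fun k => lam k ^ n * φ k 1

/-- The `(n+1) × (n+1)` determinant with first row `(c, ξ)`, first column `(c, η)ᵀ` and lower right
block `D`. -/
def bordered {n : ℕ} (c : ℂ) (ξ η : Fin n → ℂ) (D : Matrix (Fin n) (Fin n) ℂ) : ℂ :=
  (Matrix.fromBlocks (Matrix.of fun (_ _ : Fin 1) => c) (Matrix.of fun (_ : Fin 1) j => ξ j)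
    (Matrix.of fun i (_ : Fin 1) => η i) D).det

/-- The matrix of the four determinants `(Tₙ)₁₁, (Tₙ)₁₂, (Tₙ)₂₁, (Tₙ)₂₂`. -/
def detMatrix (n : ℕ) (lam : ℕ → ℂ) (φ : ℕ → Fin 2 → ℂ) (l : ℂ) : Matrix (Fin 2) (Fin 2) ℂ :=
  !![bordered (l ^ n) (ξ₁ n l) (η₁ n lam φ) (Δ₂ n lam φ),
     bordered 0 (ξ₂ n l) (η₁ n lam φ) (Δ₂ n lam φ);
     bordered 0 (ξ₂ n l) (η₂ n lam φ) (Δ₁ n lam φ),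
     bordered (l ^ n) (ξ₁ n l) (η₂ n lam φ) (Δ₁ n lam φ)]

/-- The determinant formula for the `n`-fold transformation, with `s` a value of `√(|Δₙ¹| |Δₙ²|)`
and `h` a value of `√H`. -/
noncomputable def nFold (n : ℕ) (lam : ℕ → ℂ) (h s : ℂ) (φ : ℕ → Fin 2 → ℂ) (l : ℂ) :
    Matrix (Fin 2) (Fin 2) ℂ :=
  if Even n then s⁻¹ • detMatrix n lam φ l
  else s⁻¹ • (!![h, 0; 0, h⁻¹] * detMatrix n lam φ l)

/-- The product `|Δₙ¹| |Δₙ²|` as a function of `(x, t)`. -/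
def detProd (n : ℕ) (lam : ℕ → ℂ) (Φ : ℕ → ℝ → ℝ → Fin 2 → ℂ) (x t : ℝ) : ℂ :=
  (Δ₁ n lam (fun k => Φ k x t)).det * (Δ₂ n lam (fun k => Φ k x t)).det

end CLL

/-!
The `n`-fold Darboux transformation of the coupled CLL-NLS system.

*The kernel principle.* Expanding the bordered determinants along their first row exhibits `Tₙ` as
a matrix polynomial of degree `n` in the spectral parameter `l` (`nFold_eq`). The coefficient of
`l ^ (n - j)` is diagonal for even `j` and off-diagonal for odd `j`, and `Tₙ(λₖ) Φₖ = 0` for all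
`k`. A polynomial of degree less than `n` with such coefficients and the same kernel property
vanishes, because its rows solve homogeneous linear systems with the matrices `Δₙ¹` and `Δₙ²`
(`eq_zero_of_kernel`). Hence an identity between matrix polynomials which annihilate all the `Φₖ`
only has to be verified for the coefficients of order `l ^ n` and higher.

*The Lax equations.* Differentiating `Tₙ(λₖ) Φₖ = 0` shows that `T_x + T U - U' T` annihilates the
`Φₖ`, so the equation `T_x + T U = U' T` reduces to its three highest coefficients. The first one
holds trivially and the second one defines `q'` and `r'`; the third one, of order `l ^ n`,
determines the constant term of `U'`, which still has to be recognized. This is done by looking at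
the lowest nonzero coefficient of `T`, which by Cramer's rule is proportional to the leading one
with the rows exchanged (`exists_lowest`): the lowest coefficient of the equation gives the
logarithmic derivatives of the leading coefficients in terms of the constant terms of `U` and `U'`
(`leading_rate`); this is where the factor `H` enters. If one of the `λₖ` is zero, the constant
coefficient of `T` vanishes and the next one takes over its role. The equation in `t` is treated
in the same way; the constant term of `V'` is identified by means of the fact that traceless
`2 × 2` matrices have scalar squares (`constV_eq`). The results are `flow_x` and `flow_t`.

*The new solution.* `T` is invertible for all but finitely many `l`, so that the equality of its
mixed second derivatives transports the vanishing of the curvature `U_t - V_x + [U, V]` from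
`(q, r)` to `(q', r')`, and the curvature vanishes exactly for solutions (`isSolution_of_isDarboux`).
The new factor is `H` times the square of the second leading coefficient (`nFold_darboux`).

*Iteration.* By `det_mul_rowEval` the components of `Tₘ(λₘ₊₁) Φₘ₊₁` are, up to factors known
explicitly, the determinants of size `m + 1`. Thus the product of the one-fold transformation
built from this vector with `Tₘ` has the same leading coefficient and the same kernel vectors as
`Tₘ₊₁`, and the kernel principle identifies the two (`coeffT_succ`).
-/

namespace CLL

open Complex Matrix Topology

/-! ### Polynomials in the spectral parameter and the kernel principle -/

/-- A `2 × 2` matrix has the parity of `j` if it is diagonal for even `j` and off-diagonal for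
odd `j`. -/
def HasParity (j : ℕ) (A : Matrix (Fin 2) (Fin 2) ℂ) : Prop :=
  ∀ a b : Fin 2, ¬ Even (j + (a : ℕ) + (b : ℕ)) → A a b = 0

theorem HasParity.zero (j : ℕ) : HasParity j 0 := fun _ _ _ => rfl

theorem HasParity.sub {j : ℕ} {A B : Matrix (Fin 2) (Fin 2) ℂ} (hA : HasParity j A)
    (hB : HasParity j B) : HasParity j (A - B) := fun a b h => by
  simp [hA a b h, hB a b h]

theorem HasParity.add {j : ℕ} {A B : Matrix (Fin 2) (Fin 2) ℂ} (hA : HasParity j A)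
    (hB : HasParity j B) : HasParity j (A + B) := fun a b h => by
  simp [hA a b h, hB a b h]

theorem HasParity.sum {j : ℕ} {ι : Type*} (s : Finset ι) {A : ι → Matrix (Fin 2) (Fin 2) ℂ}
    (hA : ∀ i ∈ s, HasParity j (A i)) : HasParity j (∑ i ∈ s, A i) := fun a b h => by
  rw [Matrix.sum_apply]
  exact Finset.sum_eq_zero fun i hi => hA i hi a b h

theorem HasParity.mul {i j : ℕ} {A B : Matrix (Fin 2) (Fin 2) ℂ} (hA : HasParity i A)
    (hB : HasParity j B) : HasParity (i + j) (A * B) := fun a b h => by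
  rw [Matrix.mul_apply]
  refine Finset.sum_eq_zero fun c _ => ?_
  by_cases hc : Even (i + (a : ℕ) + (c : ℕ))
  · rw [hB c b, mul_zero]
    intro hc'
    apply h
    have := hc.add hc'
    grind
  · rw [hA a c hc, zero_mul]

theorem HasParity.congr {i j : ℕ} {A : Matrix (Fin 2) (Fin 2) ℂ} (hA : HasParity i A)
    (h : Even i ↔ Even j) : HasParity j A := fun a b hab => by
  apply hA a b
  grind

/-- The matrix polynomial of degree `n` in `l` with the coefficient `T j` at `l ^ (n - j)`. -/
def descPoly (n : ℕ) (T : ℕ → Matrix (Fin 2) (Fin 2) ℂ) (l : ℂ) : Matrix (Fin 2) (Fin 2) ℂ :=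
  ∑ j ∈ Finset.range (n + 1), l ^ (n - j) • T j

/-- The sequence `T` delayed by `i` places and padded with zeros. -/
def delay (i : ℕ) (T : ℕ → Matrix (Fin 2) (Fin 2) ℂ) (j : ℕ) : Matrix (Fin 2) (Fin 2) ℂ :=
  if i ≤ j then T (j - i) else 0

theorem descPoly_delay {n D i : ℕ} (hi : i ≤ D) {T : ℕ → Matrix (Fin 2) (Fin 2) ℂ}
    (hT : ∀ j, n < j → T j = 0) (l : ℂ) :
    descPoly (n + D) (delay i T) l = l ^ (D - i) • descPoly n T l := by
  obtain ⟨e, rfl⟩ := Nat.exists_eq_add_of_le hi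
  unfold descPoly
  rw [show n + (i + e) + 1 = i + (n + 1 + e) by ring, Finset.sum_range_add, Finset.sum_range_add,
    Finset.sum_eq_zero, zero_add, Finset.smul_sum, Finset.sum_eq_zero (s := Finset.range e),
    add_zero]
  · refine Finset.sum_congr rfl fun j hj => ?_
    have hj' : j ≤ n := by grind
    simp only [delay, Nat.le_add_right, if_true, Nat.add_sub_cancel_left]
    rw [smul_smul, ← pow_add]
    congr 2
    omega
  · intro j _
    simp only [delay]
    rw [if_pos (by omega), hT _ (by omega), smul_zero]
  · intro j hj
    simp only [delay]
    rw [if_neg (by grind), smul_zero]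

theorem descPoly_add (n : ℕ) (S T : ℕ → Matrix (Fin 2) (Fin 2) ℂ) (l : ℂ) :
    descPoly n (fun j => S j + T j) l = descPoly n S l + descPoly n T l := by
  simp [descPoly, Finset.sum_add_distrib]

theorem descPoly_sub (n : ℕ) (S T : ℕ → Matrix (Fin 2) (Fin 2) ℂ) (l : ℂ) :
    descPoly n (fun j => S j - T j) l = descPoly n S l - descPoly n T l := by
  simp [descPoly, Finset.sum_sub_distrib, smul_sub]

theorem descPoly_sum (n : ℕ) {ι : Type*} (s : Finset ι) (S : ι → ℕ → Matrix (Fin 2) (Fin 2) ℂ)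
    (l : ℂ) : descPoly n (fun j => ∑ i ∈ s, S i j) l = ∑ i ∈ s, descPoly n (S i) l := by
  simp only [descPoly, Finset.smul_sum]
  exact Finset.sum_comm

theorem descPoly_mul_right (n : ℕ) (T : ℕ → Matrix (Fin 2) (Fin 2) ℂ)
    (A : Matrix (Fin 2) (Fin 2) ℂ) (l : ℂ) :
    descPoly n (fun j => T j * A) l = descPoly n T l * A := by
  simp [descPoly, Finset.sum_mul]

theorem descPoly_mul_left (n : ℕ) (T : ℕ → Matrix (Fin 2) (Fin 2) ℂ)
    (A : Matrix (Fin 2) (Fin 2) ℂ) (l : ℂ) :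
    descPoly n (fun j => A * T j) l = A * descPoly n T l := by
  simp [descPoly, Finset.mul_sum]

/-- A matrix polynomial of degree less than `n` with coefficients of alternating parity which
annihilates all the `φ k` at `lam k` vanishes: its rows solve the homogeneous linear systems with
the matrices `Δ₂` and `Δ₁`. -/
theorem eq_zero_of_kernel {n : ℕ} {lam : ℕ → ℂ} {φ : ℕ → Fin 2 → ℂ}
    (h₁ : (Δ₁ n lam φ).det ≠ 0) (h₂ : (Δ₂ n lam φ).det ≠ 0)
    {R : ℕ → Matrix (Fin 2) (Fin 2) ℂ} (hR : ∀ j, HasParity (j + 1) (R j))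
    (hker : ∀ k < n, (∑ j ∈ Finset.range n, lam k ^ (n - 1 - j) • R j) *ᵥ φ k = 0) :
    ∀ j < n, R j = 0 := by
  have key : ∀ k : Fin n, ∀ a : Fin 2, ∑ j : Fin n, lam k ^ (n - 1 - (j : ℕ)) *
      (R j a 0 * φ k 0 + R j a 1 * φ k 1) = 0 := by
    intro k a
    have := congrFun (hker k k.2) a
    rw [Matrix.sum_mulVec, Finset.sum_apply, Finset.sum_range] at this
    simpa [Matrix.mulVec, dotProduct, Fin.sum_univ_two, mul_add, mul_assoc] using this
  have r₀ : (fun j : Fin n => if Even (j : ℕ) then R j 0 1 else R j 0 0) = 0 := by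
    apply Matrix.eq_zero_of_mulVec_eq_zero h₂
    ext k
    rw [Pi.zero_apply, ← key k 0]
    simp only [Matrix.mulVec, dotProduct, Δ₂, Matrix.of_apply]
    refine Finset.sum_congr rfl fun j _ => ?_
    by_cases hj : Even (j : ℕ)
    · rw [hR j 0 0 (by simp; grind)]
      simp only [hj, if_true]
      ring
    · rw [hR j 0 1 (by simp; grind)]
      simp only [hj, if_false]
      ring
  have r₁ : (fun j : Fin n => if Even (j : ℕ) then R j 1 0 else R j 1 1) = 0 := by
    apply Matrix.eq_zero_of_mulVec_eq_zero h₁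
    ext k
    rw [Pi.zero_apply, ← key k 1]
    simp only [Matrix.mulVec, dotProduct, Δ₁, Matrix.of_apply]
    refine Finset.sum_congr rfl fun j _ => ?_
    by_cases hj : Even (j : ℕ)
    · rw [hR j 1 1 (by simp; grind)]
      simp only [hj, if_true]
      ring
    · rw [hR j 1 0 (by simp; grind)]
      simp only [hj, if_false]
      ring
  intro j hj
  have e₀ := congrFun r₀ ⟨j, hj⟩
  have e₁ := congrFun r₁ ⟨j, hj⟩
  by_cases hj' : Even j
  · have h00 := hR j 0 0 (by simp; grind)
    have h11 := hR j 1 1 (by simp; grind)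
    simp only [hj', if_true, Pi.zero_apply] at e₀ e₁
    ext a b
    fin_cases a <;> fin_cases b <;> simpa
  · have h01 := hR j 0 1 (by simp; grind)
    have h10 := hR j 1 0 (by simp; grind)
    simp only [hj', if_false, Pi.zero_apply] at e₀ e₁
    ext a b
    fin_cases a <;> fin_cases b <;> simpa

/-- The vectors `φ k` with their two components exchanged. -/
def swap (φ : ℕ → Fin 2 → ℂ) (k : ℕ) : Fin 2 → ℂ := ![φ k 1, φ k 0]

@[simp] theorem swap_zero (φ : ℕ → Fin 2 → ℂ) (k : ℕ) : swap φ k 0 = φ k 1 := rfl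
@[simp] theorem swap_one (φ : ℕ → Fin 2 → ℂ) (k : ℕ) : swap φ k 1 = φ k 0 := rfl

theorem Δ₂_swap (n : ℕ) (lam : ℕ → ℂ) (φ : ℕ → Fin 2 → ℂ) : Δ₂ n lam (swap φ) = Δ₁ n lam φ := rfl

theorem Δ₁_swap (n : ℕ) (lam : ℕ → ℂ) (φ : ℕ → Fin 2 → ℂ) : Δ₁ n lam (swap φ) = Δ₂ n lam φ := rfl

/-- The coefficients of the first row of the transformation, normalized to the leading coefficient
`1`: the sequence `c` with `c 0 = 1` for which `∑ j ≤ n, lam k ^ (n - j) c j (f or g) = 0` holds for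
all `k < n`, with `f` for even `j` and `g` for odd `j`. -/
noncomputable def rowCoeff (n : ℕ) (lam : ℕ → ℂ) (φ : ℕ → Fin 2 → ℂ) : ℕ → ℂ
  | 0 => 1
  | j + 1 => if hj : j < n then -((Δ₂ n lam φ)⁻¹ *ᵥ η₁ n lam φ) ⟨j, hj⟩ else 0

theorem rowCoeff_of_lt {n j : ℕ} (hj : n < j) (lam : ℕ → ℂ) (φ : ℕ → Fin 2 → ℂ) :
    rowCoeff n lam φ j = 0 := by
  obtain ⟨j, rfl⟩ := Nat.exists_eq_succ_of_ne_zero (by omega : j ≠ 0)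
  simp [rowCoeff, show ¬ j < n by omega]

/-- The value of a row with coefficients `c` at `l` on the vector `v`. -/
def rowEval (n : ℕ) (c : ℕ → ℂ) (l : ℂ) (v : Fin 2 → ℂ) : ℂ :=
  ∑ j ∈ Finset.range (n + 1), l ^ (n - j) * c j * (if Even j then v 0 else v 1)

theorem rowEval_eq (n : ℕ) (c : ℕ → ℂ) (lam : ℕ → ℂ) (φ : ℕ → Fin 2 → ℂ) (k : Fin n) :
    rowEval n c (lam k) (φ k)
      = c 0 * η₁ n lam φ k + (Δ₂ n lam φ *ᵥ fun j => c (j + 1)) k := by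
  rw [rowEval, Finset.sum_range_succ', add_comm]
  congr 1
  · simp [η₁]; ring
  · rw [Finset.sum_range]
    simp only [Matrix.mulVec, dotProduct, Δ₂, Matrix.of_apply]
    refine Finset.sum_congr rfl fun j _ => ?_
    rw [show n - ((j : ℕ) + 1) = n - 1 - j by omega]
    by_cases hj : Even (j : ℕ)
    · rw [if_neg (by grind), if_pos hj]; ring
    · rw [if_pos (by grind), if_neg hj]; ring

theorem rowEval_rowCoeff {n : ℕ} {lam : ℕ → ℂ} {φ : ℕ → Fin 2 → ℂ}
    (h₂ : (Δ₂ n lam φ).det ≠ 0) {k : ℕ} (hk : k < n) :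
    rowEval n (rowCoeff n lam φ) (lam k) (φ k) = 0 := by
  have h := rowEval_eq n (rowCoeff n lam φ) lam φ ⟨k, hk⟩
  simp only at h
  rw [h]
  have : (fun j : Fin n => rowCoeff n lam φ (j + 1)) = -((Δ₂ n lam φ)⁻¹ *ᵥ η₁ n lam φ) := by
    ext j
    simp [rowCoeff]
  rw [this, Matrix.mulVec_neg, Matrix.mulVec_mulVec,
    Matrix.mul_nonsing_inv _ (isUnit_iff_ne_zero.2 h₂), Matrix.one_mulVec]
  simp [rowCoeff]

theorem rowCoeff_unique {n : ℕ} {lam : ℕ → ℂ} {φ : ℕ → Fin 2 → ℂ}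
    (h₂ : (Δ₂ n lam φ).det ≠ 0) {c : ℕ → ℂ} (h0 : c 0 = 1)
    (hc : ∀ k < n, rowEval n c (lam k) (φ k) = 0) : ∀ j ≤ n, c j = rowCoeff n lam φ j := by
  have : (fun j : Fin n => c (j + 1) - rowCoeff n lam φ (j + 1)) = 0 := by
    apply Matrix.eq_zero_of_mulVec_eq_zero h₂
    ext k
    have e₁ := hc k k.2
    have e₂ := rowEval_rowCoeff h₂ k.2
    rw [rowEval_eq] at e₁ e₂
    have : (fun j : Fin n => c (j + 1) - rowCoeff n lam φ (j + 1))
        = (fun j : Fin n => c (j + 1)) - fun j : Fin n => rowCoeff n lam φ (j + 1) := rfl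
    rw [this, Matrix.mulVec_sub]
    simp only [h0, rowCoeff] at e₁ e₂ ⊢
    simp only [Pi.sub_apply, Pi.zero_apply]
    linear_combination e₁ - e₂
  intro j hj
  rcases j with _ | j
  · simp [h0, rowCoeff]
  · exact sub_eq_zero.1 (congrFun this ⟨j, by omega⟩)

theorem bordered_eq {n : ℕ} (c : ℂ) (ξ η : Fin n → ℂ) {D : Matrix (Fin n) (Fin n) ℂ}
    (hD : D.det ≠ 0) : bordered c ξ η D = D.det * (c - ∑ j, ξ j * (D⁻¹ *ᵥ η) j) := by
  have : Invertible D := Matrix.invertibleOfIsUnitDet D (isUnit_iff_ne_zero.2 hD)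
  rw [bordered, Matrix.det_fromBlocks₂₂, Matrix.det_fin_one, Matrix.mul_assoc,
    Matrix.invOf_eq_nonsing_inv]
  rfl

theorem bordered_eta_one {n : ℕ} (c : ℂ) (ξ : Fin n → ℂ) {lam : ℕ → ℂ} {φ : ℕ → Fin 2 → ℂ}
    (h₂ : (Δ₂ n lam φ).det ≠ 0) :
    bordered c ξ (η₁ n lam φ) (Δ₂ n lam φ)
      = (Δ₂ n lam φ).det * (c + ∑ j : Fin n, ξ j * rowCoeff n lam φ (j + 1)) := by
  rw [bordered_eq _ _ _ h₂]
  simp [rowCoeff, sub_eq_add_neg, ← Finset.sum_neg_distrib]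

/-- The matrix with the parity of `j` whose rows carry the entries `u` and `v`. -/
def parityMatrix (j : ℕ) (u v : ℂ) : Matrix (Fin 2) (Fin 2) ℂ :=
  if Even j then !![u, 0; 0, v] else !![0, u; v, 0]

theorem hasParity_parityMatrix (j : ℕ) (u v : ℂ) : HasParity j (parityMatrix j u v) := by
  intro a b hab
  unfold parityMatrix
  by_cases hj : Even j
  · rw [if_pos hj]
    fin_cases a <;> fin_cases b <;> first | rfl | (simp at hab; grind)
  · rw [if_neg hj]
    fin_cases a <;> fin_cases b <;> first | rfl | (simp at hab; grind)

/-- The leading coefficient of the first row of the transformation: with `h = √H`,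
`s = √(|Δ₁| |Δ₂|)` it is `|Δ₂| / s` for even `n` and `h |Δ₂| / s` for odd `n`. -/
noncomputable def lead₁ (n : ℕ) (lam : ℕ → ℂ) (h s : ℂ) (φ : ℕ → Fin 2 → ℂ) : ℂ :=
  (if Even n then 1 else h) * s⁻¹ * (Δ₂ n lam φ).det

/-- The leading coefficient of the second row of the transformation: `|Δ₁| / s` for even `n` and
`|Δ₁| / (h s)` for odd `n`. -/
noncomputable def lead₂ (n : ℕ) (lam : ℕ → ℂ) (h s : ℂ) (φ : ℕ → Fin 2 → ℂ) : ℂ :=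
  (if Even n then 1 else h⁻¹) * s⁻¹ * (Δ₁ n lam φ).det

theorem lead₁_mul_lead₂ {n : ℕ} {lam : ℕ → ℂ} {h s : ℂ} {φ : ℕ → Fin 2 → ℂ} (hh : h ≠ 0)
    (h₁ : (Δ₁ n lam φ).det ≠ 0) (h₂ : (Δ₂ n lam φ).det ≠ 0)
    (hs : s ^ 2 = (Δ₁ n lam φ).det * (Δ₂ n lam φ).det) :
    lead₁ n lam h s φ * lead₂ n lam h s φ = 1 := by
  have hs0 : s ≠ 0 := by
    rintro rfl
    simp [h₁, h₂] at hs
  unfold lead₁ lead₂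
  split_ifs <;> field_simp <;> linear_combination -hs

/-- The coefficient of `l ^ (n - j)` in the `n`-fold transformation. -/
noncomputable def coeffT (n : ℕ) (lam : ℕ → ℂ) (h s : ℂ) (φ : ℕ → Fin 2 → ℂ) (j : ℕ) :
    Matrix (Fin 2) (Fin 2) ℂ :=
  parityMatrix j (lead₁ n lam h s φ * rowCoeff n lam φ j)
    (lead₂ n lam h s φ * rowCoeff n lam (swap φ) j)

theorem coeffT_of_lt {n j : ℕ} (hj : n < j) (lam : ℕ → ℂ) (h s : ℂ) (φ : ℕ → Fin 2 → ℂ) :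
    coeffT n lam h s φ j = 0 := by
  simp only [coeffT, rowCoeff_of_lt hj, mul_zero, parityMatrix]
  split_ifs <;> ext a b <;> fin_cases a <;> fin_cases b <;> rfl

theorem coeffT_mulVec_zero {n j : ℕ} (lam : ℕ → ℂ) (h s : ℂ) (φ : ℕ → Fin 2 → ℂ) (v : Fin 2 → ℂ) :
    (coeffT n lam h s φ j *ᵥ v) 0
      = lead₁ n lam h s φ * (rowCoeff n lam φ j * if Even j then v 0 else v 1) := by
  unfold coeffT parityMatrix
  split_ifs <;> simp [Matrix.mulVec, dotProduct, Fin.sum_univ_two] <;> ring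

theorem coeffT_mulVec_one {n j : ℕ} (lam : ℕ → ℂ) (h s : ℂ) (φ : ℕ → Fin 2 → ℂ) (v : Fin 2 → ℂ) :
    (coeffT n lam h s φ j *ᵥ v) 1
      = lead₂ n lam h s φ * (rowCoeff n lam (swap φ) j * if Even j then v 1 else v 0) := by
  unfold coeffT parityMatrix
  split_ifs <;> simp [Matrix.mulVec, dotProduct, Fin.sum_univ_two] <;> ring

theorem descPoly_coeffT_mulVec_zero (n : ℕ) (lam : ℕ → ℂ) (h s : ℂ) (φ : ℕ → Fin 2 → ℂ) (l : ℂ)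
    (v : Fin 2 → ℂ) : (descPoly n (coeffT n lam h s φ) l *ᵥ v) 0
      = lead₁ n lam h s φ * rowEval n (rowCoeff n lam φ) l v := by
  simp only [descPoly, Matrix.sum_mulVec, Finset.sum_apply, Matrix.smul_mulVec, Pi.smul_apply,
    coeffT_mulVec_zero, rowEval, Finset.mul_sum, smul_eq_mul]
  exact Finset.sum_congr rfl fun j _ => by ring

theorem descPoly_coeffT_mulVec_one (n : ℕ) (lam : ℕ → ℂ) (h s : ℂ) (φ : ℕ → Fin 2 → ℂ) (l : ℂ)
    (v : Fin 2 → ℂ) : (descPoly n (coeffT n lam h s φ) l *ᵥ v) 1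
      = lead₂ n lam h s φ * rowEval n (rowCoeff n lam (swap φ)) l ![v 1, v 0] := by
  simp only [descPoly, Matrix.sum_mulVec, Finset.sum_apply, Matrix.smul_mulVec, Pi.smul_apply,
    coeffT_mulVec_one, rowEval, Finset.mul_sum, smul_eq_mul]
  exact Finset.sum_congr rfl fun j _ => by simp; ring_nf

theorem descPoly_coeffT_mulVec_eq_zero {n : ℕ} {lam : ℕ → ℂ} {φ : ℕ → Fin 2 → ℂ}
    (h₁ : (Δ₁ n lam φ).det ≠ 0) (h₂ : (Δ₂ n lam φ).det ≠ 0) (h s : ℂ) {k : ℕ} (hk : k < n) :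
    descPoly n (coeffT n lam h s φ) (lam k) *ᵥ φ k = 0 := by
  ext a
  fin_cases a
  · simp only [Fin.zero_eta, descPoly_coeffT_mulVec_zero, rowEval_rowCoeff h₂ hk]
    simp
  · have := rowEval_rowCoeff (φ := swap φ) h₁ hk
    simp only [Fin.mk_one, descPoly_coeffT_mulVec_one]
    rw [swap] at this
    rw [this]
    simp

/-- Row expansion of the bordered determinants: the `n`-fold transformation as a polynomial in the
spectral parameter. -/
theorem nFold_eq {n : ℕ} {lam : ℕ → ℂ} {φ : ℕ → Fin 2 → ℂ}
    (h₁ : (Δ₁ n lam φ).det ≠ 0) (h₂ : (Δ₂ n lam φ).det ≠ 0) (h s l : ℂ) :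
    nFold n lam h s φ l = descPoly n (coeffT n lam h s φ) l := by
  have key : ∀ ψ : ℕ → Fin 2 → ℂ, (Δ₂ n lam ψ).det ≠ 0 →
      bordered (l ^ n) (ξ₁ n l) (η₁ n lam ψ) (Δ₂ n lam ψ)
        = (Δ₂ n lam ψ).det * rowEval n (rowCoeff n lam ψ) l ![1, 0] ∧
      bordered 0 (ξ₂ n l) (η₁ n lam ψ) (Δ₂ n lam ψ)
        = (Δ₂ n lam ψ).det * rowEval n (rowCoeff n lam ψ) l ![0, 1] := by
    intro ψ hψ
    rw [bordered_eta_one _ _ hψ, bordered_eta_one _ _ hψ]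
    simp only [rowEval]
    rw [Finset.sum_range_succ', Finset.sum_range_succ', Finset.sum_range, Finset.sum_range]
    constructor <;> congr 1
    · rw [add_comm]
      congr 1
      · refine Finset.sum_congr rfl fun j _ => ?_
        simp only [ξ₁]
        rw [show n - ((j : ℕ) + 1) = n - 1 - j by omega]
        by_cases hj : Even (j : ℕ)
        · rw [if_pos hj, if_neg (by grind)]; simp
        · rw [if_neg hj, if_pos (by grind)]; simp
      · simp [rowCoeff]
    · rw [add_comm]
      congr 1
      · refine Finset.sum_congr rfl fun j _ => ?_
        simp only [ξ₂]
        rw [show n - ((j : ℕ) + 1) = n - 1 - j by omega]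
        by_cases hj : Even (j : ℕ)
        · rw [if_pos hj, if_neg (by grind)]; simp
        · rw [if_neg hj, if_pos (by grind)]; simp
      · simp [rowCoeff]
  obtain ⟨k11, k12⟩ := key φ h₂
  obtain ⟨k22, k21⟩ := key (swap φ) h₁
  have e : detMatrix n lam φ l =
      !![(Δ₂ n lam φ).det * rowEval n (rowCoeff n lam φ) l ![1, 0],
        (Δ₂ n lam φ).det * rowEval n (rowCoeff n lam φ) l ![0, 1];
        (Δ₁ n lam φ).det * rowEval n (rowCoeff n lam (swap φ)) l ![0, 1],
        (Δ₁ n lam φ).det * rowEval n (rowCoeff n lam (swap φ)) l ![1, 0]] := by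
    rw [detMatrix, k11, k12]
    exact congrArg₂ (fun u v => !![_, _; u, v]) k21 k22
  have col : ∀ (A : Matrix (Fin 2) (Fin 2) ℂ) (a b : Fin 2), A a b = (A *ᵥ Pi.single b 1) a := by
    intro A a b
    simp
  have s0 : (Pi.single 0 1 : Fin 2 → ℂ) = ![1, 0] := by ext i; fin_cases i <;> simp
  have s1 : (Pi.single 1 1 : Fin 2 → ℂ) = ![0, 1] := by ext i; fin_cases i <;> simp
  ext a b
  rw [col (descPoly _ _ _)]
  unfold nFold
  rw [e]
  fin_cases a <;> fin_cases b <;>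
  simp only [Fin.zero_eta, Fin.mk_one, descPoly_coeffT_mulVec_zero, descPoly_coeffT_mulVec_one,
    s0, s1, lead₁, lead₂] <;> split_ifs <;>
    simp <;> ring

/-! ### The lowest coefficient -/

theorem rowCoeff_succ_mul_det {n : ℕ} {lam : ℕ → ℂ} {φ : ℕ → Fin 2 → ℂ}
    (h₂ : (Δ₂ n lam φ).det ≠ 0) (j : Fin n) :
    rowCoeff n lam φ (j + 1) * (Δ₂ n lam φ).det
      = -((Δ₂ n lam φ).updateCol j (η₁ n lam φ)).det := by
  have h : (Δ₂ n lam φ)⁻¹ *ᵥ η₁ n lam φ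
      = (Δ₂ n lam φ).det⁻¹ • cramer (Δ₂ n lam φ) (η₁ n lam φ) := by
    rw [Matrix.inv_def, Ring.inverse_eq_inv', Matrix.smul_mulVec, cramer_eq_adjugate_mulVec]
  simp only [rowCoeff, j.2, dif_pos, Fin.eta, h, Pi.smul_apply, cramer_apply, smul_eq_mul]
  field_simp

/-- The constant coefficient of a row. In the determinant of Cramer's rule for it, row `k` is
`lam k` times row `k` of `Δ₁`, up to a cyclic permutation of the columns. -/
theorem exists_rowCoeff_last {n : ℕ} {lam : ℕ → ℂ} (hlam : ∀ k < n, lam k ≠ 0) :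
    ∃ C : ℂ, C ≠ 0 ∧ ∀ φ : ℕ → Fin 2 → ℂ, (Δ₂ n lam φ).det ≠ 0 →
      rowCoeff n lam φ n * (Δ₂ n lam φ).det = C * (Δ₁ n lam φ).det := by
  rcases n with _ | m
  · exact ⟨1, one_ne_zero, fun φ _ => by simp [rowCoeff]⟩
  refine ⟨-((∏ k : Fin (m + 1), lam k) * ((Equiv.Perm.sign (finRotate (m + 1)) : ℤ) : ℂ)), ?_, ?_⟩
  · refine neg_ne_zero.2 (mul_ne_zero (Finset.prod_ne_zero_iff.2 fun k _ => hlam k k.2) ?_)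
    rw [sign_finRotate]
    simp
  · intro φ h₂
    have := rowCoeff_succ_mul_det h₂ (Fin.last m)
    rw [Fin.val_last] at this
    rw [this]
    have e : (Δ₂ (m + 1) lam φ).updateCol (Fin.last m) (η₁ (m + 1) lam φ)
        = Matrix.of fun i j : Fin (m + 1) =>
          lam i * (Δ₁ (m + 1) lam φ).submatrix id (finRotate (m + 1)) i j := by
      ext i j
      rw [Matrix.of_apply, Matrix.submatrix_apply]
      refine Fin.lastCases ?_ (fun j => ?_) j
      · rw [Matrix.updateCol_self, finRotate_last]
        simp [Δ₁, η₁, pow_succ]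
        ring
      · rw [Matrix.updateCol_ne (Fin.castSucc_lt_last j).ne, finRotate_apply,
          Fin.coeSucc_eq_succ]
        simp only [Δ₁, Δ₂, Matrix.of_apply, Fin.val_castSucc, Fin.val_succ, id]
        have hj := j.2
        rw [show m + 1 - 1 - (j : ℕ) = (m + 1 - 1 - (j + 1)) + 1 by omega, pow_succ]
        by_cases hj : Even (j : ℕ)
        · rw [if_pos hj, if_neg (by grind)]; ring
        · rw [if_neg hj, if_pos (by grind)]; ring
    rw [e, Matrix.det_mul_column, Matrix.det_permute']
    ring

/-- The sequence `u` with its term of index `k` removed. -/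
def skip {α : Type*} (k : ℕ) (u : ℕ → α) (j : ℕ) : α := u (if j < k then j else j + 1)

theorem skip_val {α : Type*} {m : ℕ} (k : Fin (m + 1)) (u : ℕ → α) (j : Fin m) :
    skip k u j = u (k.succAbove j) := by
  simp only [skip, Fin.succAbove, Fin.lt_def, Fin.val_castSucc]
  split_ifs <;> simp

/-- If `lam k` is zero, then row `k` of `Δ₂` has a single nonzero entry, and the expansion along it
leads to the matrix without `lam k`. -/
theorem exists_det_of_zero {m : ℕ} {lam : ℕ → ℂ} (k : Fin (m + 1)) (hk : lam k = 0) :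
    ∃ ε : ℂ, ε ≠ 0 ∧ ∀ φ : ℕ → Fin 2 → ℂ, (Δ₂ (m + 1) lam φ).det
      = ε * (∏ j : Fin m, skip k lam j) * (if Even m then φ k 1 else φ k 0)
        * (Δ₂ m (skip k lam) (skip k φ)).det := by
  refine ⟨(-1) ^ ((k : ℕ) + m), by simp, fun φ => ?_⟩
  rw [Matrix.det_succ_row _ k, Finset.sum_eq_single (Fin.last m)]
  · have e : (Δ₂ (m + 1) lam φ).submatrix k.succAbove (Fin.last m).succAbove
        = Matrix.of fun i j : Fin m => skip k lam i * Δ₂ m (skip k lam) (skip k φ) i j := by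
      ext i j
      rw [Matrix.submatrix_apply, Matrix.of_apply, Fin.succAbove_last]
      simp only [Δ₂, Matrix.of_apply, skip_val, Fin.val_castSucc]
      have hj := j.2
      rw [show m + 1 - 1 - (j : ℕ) = (m - 1 - j) + 1 by omega, pow_succ]
      ring
    rw [e, Matrix.det_mul_column]
    simp [Δ₂]
    ring_nf
  · intro j _ hj
    have hj' : (j : ℕ) ≠ m := fun h => hj (Fin.ext h)
    have : m + 1 - 1 - (j : ℕ) ≠ 0 := by have := j.2; omega
    simp [Δ₂, hk, zero_pow (show m - (j : ℕ) ≠ 0 by omega)]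
  · simp

/-- If `lam k` is zero, then the row of degree `m + 1` is the spectral parameter times the row of
degree `m` built without `lam k`. -/
theorem rowCoeff_of_zero {m : ℕ} {lam : ℕ → ℂ} (k : Fin (m + 1)) (hk : lam k = 0)
    (hlam : ∀ j < m, skip k lam j ≠ 0) {φ : ℕ → Fin 2 → ℂ}
    (h₂ : (Δ₂ (m + 1) lam φ).det ≠ 0) (h₂' : (Δ₂ m (skip k lam) (skip k φ)).det ≠ 0) :
    ∀ j ≤ m + 1, rowCoeff m (skip k lam) (skip k φ) j = rowCoeff (m + 1) lam φ j := by
  refine rowCoeff_unique h₂ (by simp [rowCoeff]) fun i hi => ?_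
  have last : rowCoeff m (skip k lam) (skip k φ) (m + 1) = 0 := rowCoeff_of_lt (by omega) _ _
  have step : ∀ (l : ℂ) (v : Fin 2 → ℂ),
      rowEval (m + 1) (rowCoeff m (skip k lam) (skip k φ)) l v
        = l * rowEval m (rowCoeff m (skip k lam) (skip k φ)) l v := by
    intro l v
    rw [rowEval, Finset.sum_range_succ, last, mul_zero, zero_mul, add_zero, rowEval,
      Finset.mul_sum]
    refine Finset.sum_congr rfl fun j hj => ?_
    rw [show m + 1 - j = (m - j) + 1 by grind, pow_succ]
    ring
  rw [step]
  obtain rfl | ⟨j, hj⟩ := Fin.eq_self_or_eq_succAbove k ⟨i, hi⟩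
  · rw [← hk]
    simp [hk]
  · have := rowEval_rowCoeff h₂' j.2
    rw [skip_val, skip_val, ← hj] at this
    rw [this, mul_zero]

/-- The lowest coefficient of a row that does not vanish, if one of the parameters is zero. -/
theorem exists_rowCoeff_of_zero {m : ℕ} {lam : ℕ → ℂ} {φ₀ : ℕ → Fin 2 → ℂ}
    (h₀ : (Δ₂ (m + 1) lam φ₀).det ≠ 0) (k : Fin (m + 1)) (hk : lam k = 0) :
    ∃ C : ℂ, C ≠ 0 ∧ ∀ φ : ℕ → Fin 2 → ℂ, (Δ₂ (m + 1) lam φ).det ≠ 0 →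
      rowCoeff (m + 1) lam φ m * (Δ₂ (m + 1) lam φ).det * (if Even m then φ k 0 else φ k 1)
        = C * (Δ₁ (m + 1) lam φ).det * (if Even m then φ k 1 else φ k 0) ∧
      rowCoeff (m + 1) lam φ (m + 1) = 0 := by
  obtain ⟨ε, hε, hdet⟩ := exists_det_of_zero k hk
  have hlam : ∀ j < m, skip k lam j ≠ 0 := by
    intro j hj h
    apply h₀
    rw [hdet, Finset.prod_eq_zero (Finset.mem_univ (⟨j, hj⟩ : Fin m)) h]
    simp
  obtain ⟨C, hC, hlast⟩ := exists_rowCoeff_last hlam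
  refine ⟨C, hC, fun φ h₂ => ?_⟩
  have h₂' : (Δ₂ m (skip k lam) (skip k φ)).det ≠ 0 := by
    intro h
    rw [hdet, h, mul_zero] at h₂
    exact h₂ rfl
  have e := rowCoeff_of_zero k hk hlam h₂ h₂'
  constructor
  · have hd₁ := hdet (swap φ)
    rw [Δ₂_swap] at hd₁
    have hl := hlast _ h₂'
    have hs : skip k (swap φ) = swap (skip k φ) := rfl
    rw [hs, Δ₂_swap] at hd₁
    rw [← e m (by omega), hdet, hd₁]
    simp only [swap_one, swap_zero]
    linear_combination (ε * (∏ j : Fin m, skip k lam j) * (if Even m then φ k 1 else φ k 0)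
      * (if Even m then φ k 0 else φ k 1)) * hl
  · rw [← e (m + 1) le_rfl, rowCoeff_of_lt (by omega)]

/-- The value of a row on one more vector is a quotient of determinants: replacing the first column
of `Δ₁` by the linear combination of its columns with the coefficients of the row produces zeros
outside of the last row. -/
theorem det_mul_rowEval {m : ℕ} {lam : ℕ → ℂ} {φ : ℕ → Fin 2 → ℂ} (h₂ : (Δ₂ m lam φ).det ≠ 0) :
    (Δ₂ m lam φ).det * rowEval m (rowCoeff m lam φ) (lam m) (φ m)
      = (-1) ^ m * (Δ₁ (m + 1) lam φ).det := by
  have h := Matrix.det_updateCol_sum (Δ₁ (m + 1) lam φ) 0 (fun j => rowCoeff m lam φ j)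
  have hcol : (fun i : Fin (m + 1) =>
      ∑ j : Fin (m + 1), rowCoeff m lam φ j • Δ₁ (m + 1) lam φ i j)
      = fun i : Fin (m + 1) => rowEval m (rowCoeff m lam φ) (lam i) (φ i) := by
    ext i
    rw [rowEval, Finset.sum_range]
    refine Finset.sum_congr rfl fun j _ => ?_
    simp [Δ₁]
    ring_nf
  rw [hcol, Matrix.det_succ_column_zero, Finset.sum_eq_single (Fin.last m)] at h
  · simp only [Fin.val_last, Matrix.updateCol_self, Fin.val_zero, rowCoeff, one_smul] at h
    have hsub : ((Δ₁ (m + 1) lam φ).updateCol 0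
        (fun i : Fin (m + 1) => rowEval m (rowCoeff m lam φ) (lam i) (φ i))).submatrix
        (Fin.last m).succAbove Fin.succ = Δ₂ m lam φ := by
      ext i j
      rw [Matrix.submatrix_apply, Matrix.updateCol_ne (Fin.succ_ne_zero j), Fin.succAbove_last]
      simp only [Δ₁, Δ₂, Matrix.of_apply, Fin.val_castSucc, Fin.val_succ]
      rw [show m + 1 - 1 - ((j : ℕ) + 1) = m - 1 - j by omega]
      by_cases hj : Even (j : ℕ)
      · rw [if_pos hj, if_neg (by grind)]
      · rw [if_neg hj, if_pos (by grind)]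
    rw [hsub] at h
    rw [← h]
    have : ((-1 : ℂ) ^ m) * (-1) ^ m = 1 := by rw [← mul_pow]; simp
    linear_combination (-(Δ₂ m lam φ).det * rowEval m (rowCoeff m lam φ) (lam m) (φ m)) * this
  · intro i _ hi
    have hi' : (i : ℕ) < m := by
      have : (i : ℕ) ≠ m := fun h => hi (Fin.ext h)
      have := i.2
      omega
    rw [Matrix.updateCol_self, rowEval_rowCoeff h₂ hi']
    simp
  · simp

/-! ### Calculus of twice continuously differentiable functions -/

section Calculus

variable {Ω : Set (ℝ × ℝ)} {u v : ℝ → ℝ → ℂ}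

theorem isC2On_const (c : ℂ) : IsC2On Ω (fun _ _ => c) := contDiffOn_const

theorem IsC2On.add (hu : IsC2On Ω u) (hv : IsC2On Ω v) : IsC2On Ω (fun x t => u x t + v x t) :=
  ContDiffOn.add hu hv

theorem IsC2On.sub (hu : IsC2On Ω u) (hv : IsC2On Ω v) : IsC2On Ω (fun x t => u x t - v x t) :=
  ContDiffOn.sub hu hv

theorem IsC2On.neg (hu : IsC2On Ω u) : IsC2On Ω (fun x t => -u x t) :=
  ContDiffOn.neg hu

theorem IsC2On.mul (hu : IsC2On Ω u) (hv : IsC2On Ω v) : IsC2On Ω (fun x t => u x t * v x t) :=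
  ContDiffOn.mul hu hv

theorem IsC2On.const_mul (c : ℂ) (hu : IsC2On Ω u) : IsC2On Ω (fun x t => c * u x t) :=
  (isC2On_const c).mul hu

theorem IsC2On.pow (hu : IsC2On Ω u) (m : ℕ) : IsC2On Ω (fun x t => u x t ^ m) :=
  ContDiffOn.pow hu m

theorem IsC2On.inv (hu : IsC2On Ω u) (h : ∀ x t, (x, t) ∈ Ω → u x t ≠ 0) :
    IsC2On Ω (fun x t => (u x t)⁻¹) :=
  ContDiffOn.inv hu fun p hp => h p.1 p.2 hp

theorem IsC2On.sum {ι : Type*} (S : Finset ι) {w : ι → ℝ → ℝ → ℂ}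
    (hw : ∀ i ∈ S, IsC2On Ω (w i)) : IsC2On Ω (fun x t => ∑ i ∈ S, w i x t) :=
  ContDiffOn.sum (f := fun i (p : ℝ × ℝ) => w i p.1 p.2) hw

theorem IsC2On.prod {ι : Type*} (S : Finset ι) {w : ι → ℝ → ℝ → ℂ}
    (hw : ∀ i ∈ S, IsC2On Ω (w i)) : IsC2On Ω (fun x t => ∏ i ∈ S, w i x t) :=
  contDiffOn_prod (f := fun i (p : ℝ × ℝ) => w i p.1 p.2) hw

theorem IsC2On.det {m : ℕ} {M : ℝ → ℝ → Matrix (Fin m) (Fin m) ℂ}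
    (hM : ∀ i j, IsC2On Ω (fun x t => M x t i j)) : IsC2On Ω (fun x t => (M x t).det) := by
  simp only [Matrix.det_apply']
  exact IsC2On.sum _ fun σ _ => IsC2On.const_mul _ (IsC2On.prod _ fun i _ => hM _ _)

theorem IsC2On.congr (hu : IsC2On Ω u) (h : ∀ x t, (x, t) ∈ Ω → v x t = u x t) : IsC2On Ω v :=
  ContDiffOn.congr hu fun p hp => h p.1 p.2 hp

/-- A continuous branch of the square root of a nowhere vanishing `C²` function is `C²`: close to a
point it is the principal branch up to a constant factor. -/
theorem IsSqrtOn.isC2On {s : ℝ → ℝ → ℂ} (hΩ : IsOpen Ω) (hs : IsSqrtOn Ω s u) (hu : IsC2On Ω u)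
    (h0 : ∀ x t, (x, t) ∈ Ω → u x t ≠ 0) : IsC2On Ω s := by
  intro p hp
  have hsq := hs.2 p.1 p.2 hp
  have hs0 : s p.1 p.2 ≠ 0 := fun h => h0 p.1 p.2 hp (by rw [← hsq, h]; simp)
  have hcont : ContinuousAt (fun y : ℝ × ℝ => s y.1 y.2 / s p.1 p.2) p :=
    (hs.1.continuousAt (hΩ.mem_nhds hp)).div_const _
  have hre : ∀ᶠ y in 𝓝 p, 0 < (s y.1 y.2 / s p.1 p.2).re := by
    apply (Complex.continuous_re.continuousAt.comp hcont).eventually (lt_mem_nhds _)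
    simp [hs0]
  have hev : (fun y : ℝ × ℝ => s y.1 y.2) =ᶠ[𝓝 p]
      fun y => s p.1 p.2 * (u y.1 y.2 / u p.1 p.2) ^ (2⁻¹ : ℂ) := by
    filter_upwards [hre, hΩ.mem_nhds hp] with y hy hyΩ
    rw [← hs.2 y.1 y.2 hyΩ, ← hsq, ← div_pow, Complex.sq_cpow_two_inv hy]
    field_simp
  refine ContDiffAt.contDiffWithinAt (ContDiffAt.congr_of_eventuallyEq ?_ hev)
  have hu' : ContDiffAt ℝ 2 (fun y : ℝ × ℝ => u y.1 y.2 / u p.1 p.2) p :=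
    (hu.contDiffAt (hΩ.mem_nhds hp)).div_const _
  have hslit : u p.1 p.2 / u p.1 p.2 ∈ Complex.slitPlane := by
    rw [div_self (h0 p.1 p.2 hp)]
    exact Complex.one_mem_slitPlane
  have hpow : ContDiffAt ℝ 2 (fun z : ℂ => z ^ (2⁻¹ : ℂ)) (u p.1 p.2 / u p.1 p.2) := by
    have hlog : ContDiffAt ℂ 2 (fun z : ℂ => Complex.exp (Complex.log z * 2⁻¹))
        (u p.1 p.2 / u p.1 p.2) :=
      ((Complex.contDiffAt_log hslit).mul contDiffAt_const).cexp
    refine (hlog.restrict_scalars ℝ).congr_of_eventuallyEq ?_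
    have hne : u p.1 p.2 / u p.1 p.2 ≠ 0 := Complex.slitPlane_ne_zero hslit
    filter_upwards [isOpen_ne.mem_nhds hne] with z hz
    rw [Complex.cpow_def_of_ne_zero hz]
  exact contDiffAt_const.mul (ContDiffAt.comp (g := fun z : ℂ => z ^ (2⁻¹ : ℂ)) p hpow hu')

variable {x t : ℝ}

theorem eventually_mem_x (hΩ : IsOpen Ω) (hp : (x, t) ∈ Ω) : ∀ᶠ y in 𝓝 x, (y, t) ∈ Ω :=
  (Continuous.prodMk_left t).continuousAt.eventually (hΩ.mem_nhds hp)

theorem eventually_mem_t (hΩ : IsOpen Ω) (hp : (x, t) ∈ Ω) : ∀ᶠ τ in 𝓝 t, (x, τ) ∈ Ω :=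
  (Continuous.prodMk_right x).continuousAt.eventually (hΩ.mem_nhds hp)

theorem hasDerivAt_partial_x {F : ℝ × ℝ → ℂ} (hF : DifferentiableAt ℝ F (x, t)) :
    HasDerivAt (fun y => F (y, t)) (fderiv ℝ F (x, t) (1, 0)) x :=
  HasFDerivAt.comp_hasDerivAt (f := fun y : ℝ => (y, t)) x hF.hasFDerivAt
    ((hasDerivAt_id x).prodMk (hasDerivAt_const x t))

theorem hasDerivAt_partial_t {F : ℝ × ℝ → ℂ} (hF : DifferentiableAt ℝ F (x, t)) :
    HasDerivAt (fun τ => F (x, τ)) (fderiv ℝ F (x, t) (0, 1)) t :=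
  HasFDerivAt.comp_hasDerivAt (f := fun τ : ℝ => (x, τ)) t hF.hasFDerivAt
    ((hasDerivAt_const t x).prodMk (hasDerivAt_id t))

theorem IsC2On.contDiffAt (hΩ : IsOpen Ω) (hu : IsC2On Ω u) (hp : (x, t) ∈ Ω) :
    ContDiffAt ℝ 2 (fun p : ℝ × ℝ => u p.1 p.2) (x, t) :=
  ContDiffOn.contDiffAt hu (hΩ.mem_nhds hp)

theorem IsC2On.hasDerivAt_x (hΩ : IsOpen Ω) (hu : IsC2On Ω u) (hp : (x, t) ∈ Ω) :
    HasDerivAt (fun y => u y t) (dx u x t) x :=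
  (hasDerivAt_partial_x ((hu.contDiffAt hΩ hp).differentiableAt two_ne_zero)
    ).differentiableAt.hasDerivAt

theorem IsC2On.hasDerivAt_t (hΩ : IsOpen Ω) (hu : IsC2On Ω u) (hp : (x, t) ∈ Ω) :
    HasDerivAt (fun τ => u x τ) (dt u x t) t :=
  (hasDerivAt_partial_t ((hu.contDiffAt hΩ hp).differentiableAt two_ne_zero)
    ).differentiableAt.hasDerivAt

theorem IsC2On.dx_eq (hΩ : IsOpen Ω) (hu : IsC2On Ω u) (hp : (x, t) ∈ Ω) :
    dx u x t = fderiv ℝ (fun p : ℝ × ℝ => u p.1 p.2) (x, t) (1, 0) :=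
  (hasDerivAt_partial_x ((hu.contDiffAt hΩ hp).differentiableAt two_ne_zero)).deriv

theorem IsC2On.dt_eq (hΩ : IsOpen Ω) (hu : IsC2On Ω u) (hp : (x, t) ∈ Ω) :
    dt u x t = fderiv ℝ (fun p : ℝ × ℝ => u p.1 p.2) (x, t) (0, 1) :=
  (hasDerivAt_partial_t ((hu.contDiffAt hΩ hp).differentiableAt two_ne_zero)).deriv

theorem IsC2On.differentiableAt_fderiv (hΩ : IsOpen Ω) (hu : IsC2On Ω u) (hp : (x, t) ∈ Ω)
    (e : ℝ × ℝ) :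
    DifferentiableAt ℝ (fun p => fderiv ℝ (fun p : ℝ × ℝ => u p.1 p.2) p e) (x, t) :=
  ((((hu.contDiffAt hΩ hp).fderiv_right (m := 1) (by norm_num)).differentiableAt
    one_ne_zero).clm_apply (differentiableAt_const e))

theorem IsC2On.hasDerivAt_dx_x (hΩ : IsOpen Ω) (hu : IsC2On Ω u) (hp : (x, t) ∈ Ω) :
    HasDerivAt (fun y => dx u y t) (dx (dx u) x t) x := by
  have h := hasDerivAt_partial_x (hu.differentiableAt_fderiv hΩ hp (1, 0))
  have h' := h.congr_of_eventuallyEq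
    ((eventually_mem_x hΩ hp).mono fun y hy => hu.dx_eq hΩ hy)
  exact h'.differentiableAt.hasDerivAt

theorem IsC2On.hasDerivAt_dx_t (hΩ : IsOpen Ω) (hu : IsC2On Ω u) (hp : (x, t) ∈ Ω) :
    HasDerivAt (fun τ => dx u x τ)
      (fderiv ℝ (fun p => fderiv ℝ (fun p : ℝ × ℝ => u p.1 p.2) p (1, 0)) (x, t) (0, 1)) t :=
  (hasDerivAt_partial_t (hu.differentiableAt_fderiv hΩ hp (1, 0))).congr_of_eventuallyEq
    ((eventually_mem_t hΩ hp).mono fun _ hτ => hu.dx_eq hΩ hτ)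

theorem IsC2On.hasDerivAt_dt_x (hΩ : IsOpen Ω) (hu : IsC2On Ω u) (hp : (x, t) ∈ Ω) :
    HasDerivAt (fun y => dt u y t)
      (fderiv ℝ (fun p => fderiv ℝ (fun p : ℝ × ℝ => u p.1 p.2) p (0, 1)) (x, t) (1, 0)) x :=
  (hasDerivAt_partial_x (hu.differentiableAt_fderiv hΩ hp (0, 1))).congr_of_eventuallyEq
    ((eventually_mem_x hΩ hp).mono fun _ hy => hu.dt_eq hΩ hy)

theorem IsC2On.dt_dx (hΩ : IsOpen Ω) (hu : IsC2On Ω u) (hp : (x, t) ∈ Ω) :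
    dt (dx u) x t = dx (dt u) x t := by
  have hd := ((hu.contDiffAt hΩ hp).fderiv_right (m := 1) (by norm_num)).differentiableAt
    one_ne_zero
  have hsymm := (hu.contDiffAt hΩ hp).isSymmSndFDerivAt (by simp)
  have e1 : dt (dx u) x t = _ := (hu.hasDerivAt_dx_t hΩ hp).deriv
  have e2 : dx (dt u) x t = _ := (hu.hasDerivAt_dt_x hΩ hp).deriv
  rw [e1, e2, fderiv_clm_apply hd (differentiableAt_const _),
    fderiv_clm_apply hd (differentiableAt_const _)]
  simpa using hsymm (0, 1) (1, 0)

end Calculus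

section Coefficients

variable {Ω : Set (ℝ × ℝ)} {n : ℕ} {lam : ℕ → ℂ} {Φ : ℕ → ℝ → ℝ → Fin 2 → ℂ}

theorem isC2On_Δ₂ (hΦ : ∀ k < n, ∀ i, IsC2On Ω (fun x t => Φ k x t i)) (i j : Fin n) :
    IsC2On Ω (fun x t => Δ₂ n lam (fun k => Φ k x t) i j) := by
  simp only [Δ₂, Matrix.of_apply]
  split_ifs
  exacts [IsC2On.const_mul _ (hΦ i i.2 1), IsC2On.const_mul _ (hΦ i i.2 0)]

theorem isC2On_det_Δ₂ (hΦ : ∀ k < n, ∀ i, IsC2On Ω (fun x t => Φ k x t i)) :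
    IsC2On Ω (fun x t => (Δ₂ n lam (fun k => Φ k x t)).det) :=
  IsC2On.det (isC2On_Δ₂ hΦ)

/-- The eigenfunctions with their two components exchanged. -/
def swapFun (Φ : ℕ → ℝ → ℝ → Fin 2 → ℂ) (k : ℕ) (x t : ℝ) : Fin 2 → ℂ := ![Φ k x t 1, Φ k x t 0]

theorem isC2On_swapFun (hΦ : ∀ k < n, ∀ i, IsC2On Ω (fun x t => Φ k x t i)) :
    ∀ k < n, ∀ i, IsC2On Ω (fun x t => swapFun Φ k x t i) := by
  intro k hk i
  fin_cases i
  exacts [hΦ k hk 1, hΦ k hk 0]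

theorem isC2On_det_Δ₁ (hΦ : ∀ k < n, ∀ i, IsC2On Ω (fun x t => Φ k x t i)) :
    IsC2On Ω (fun x t => (Δ₁ n lam (fun k => Φ k x t)).det) :=
  isC2On_det_Δ₂ (isC2On_swapFun hΦ)

theorem isC2On_rowCoeff (hΦ : ∀ k < n, ∀ i, IsC2On Ω (fun x t => Φ k x t i))
    (h₂ : ∀ x t, (x, t) ∈ Ω → (Δ₂ n lam (fun k => Φ k x t)).det ≠ 0) (j : ℕ) :
    IsC2On Ω (fun x t => rowCoeff n lam (fun k => Φ k x t) j) := by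
  rcases j with _ | j
  · exact isC2On_const 1
  by_cases hj : j < n
  · have hM : IsC2On Ω (fun x t => ((Δ₂ n lam (fun k => Φ k x t)).updateCol ⟨j, hj⟩
        (η₁ n lam (fun k => Φ k x t))).det) := by
      refine IsC2On.det fun a b => ?_
      by_cases hb : b = ⟨j, hj⟩
      · subst hb
        simp only [Matrix.updateCol_self, η₁]
        exact IsC2On.const_mul _ (hΦ a a.2 0)
      · simp only [Matrix.updateCol_ne hb]
        exact isC2On_Δ₂ hΦ a b
    refine (hM.neg.mul ((isC2On_det_Δ₂ (lam := lam) hΦ).inv h₂)).congr fun x t hp => ?_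
    rw [← rowCoeff_succ_mul_det (h₂ x t hp) ⟨j, hj⟩, mul_inv_cancel_right₀ (h₂ x t hp)]
  · simp only [rowCoeff_of_lt (show n < j + 1 by omega)]
    exact isC2On_const 0

end Coefficients

/-! ### The defect of a transformation -/

/-- The coefficients of `T' + T W - W' T`, where `T` and its derivative `T'` are polynomials of
degree `n` and `W`, `W'` are polynomials of degree `D` in the spectral parameter, counted from the
highest power `l ^ (n + D)`. -/
def defect (D : ℕ) (T T' W W' : ℕ → Matrix (Fin 2) (Fin 2) ℂ) (j : ℕ) : Matrix (Fin 2) (Fin 2) ℂ :=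
  delay D T' j + ∑ i ∈ Finset.range (D + 1), (delay i T j * W i - W' i * delay i T j)

theorem descPoly_defect {n D : ℕ} {T T' : ℕ → Matrix (Fin 2) (Fin 2) ℂ}
    (W W' : ℕ → Matrix (Fin 2) (Fin 2) ℂ)
    (hT : ∀ j, n < j → T j = 0) (hT' : ∀ j, n < j → T' j = 0) (l : ℂ) :
    descPoly (n + D) (defect D T T' W W') l
      = descPoly n T' l + descPoly n T l * descPoly D W l - descPoly D W' l * descPoly n T l := by
  have e : defect D T T' W W' = fun j => delay D T' j +
      ∑ i ∈ Finset.range (D + 1), (delay i T j * W i - W' i * delay i T j) := rfl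
  rw [e, descPoly_add, descPoly_sum, descPoly_delay le_rfl hT', Nat.sub_self, pow_zero, one_smul,
    add_sub_assoc]
  congr 1
  rw [show descPoly D W l = ∑ i ∈ Finset.range (D + 1), l ^ (D - i) • W i from rfl,
    show descPoly D W' l = ∑ i ∈ Finset.range (D + 1), l ^ (D - i) • W' i from rfl,
    Finset.mul_sum, Finset.sum_mul, ← Finset.sum_sub_distrib]
  refine Finset.sum_congr rfl fun i hi => ?_
  rw [descPoly_sub, descPoly_mul_right, descPoly_mul_left, descPoly_delay (by grind) hT]
  simp

theorem hasParity_delay {i j : ℕ} {T : ℕ → Matrix (Fin 2) (Fin 2) ℂ}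
    (hT : ∀ j, HasParity j (T j)) : HasParity (j + i) (delay i T j) := by
  unfold delay
  split_ifs with h
  · exact (hT _).congr (by grind)
  · exact HasParity.zero _

theorem hasParity_defect {D : ℕ} (hD : Even D) {T T' W W' : ℕ → Matrix (Fin 2) (Fin 2) ℂ}
    (hT : ∀ j, HasParity j (T j)) (hT' : ∀ j, HasParity j (T' j))
    (hW : ∀ j, HasParity j (W j)) (hW' : ∀ j, HasParity j (W' j)) (j : ℕ) :
    HasParity j (defect D T T' W W' j) := by
  refine HasParity.add ((hasParity_delay hT').congr (by grind)) (HasParity.sum _ fun i _ => ?_)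
  exact HasParity.sub (((hasParity_delay hT).mul (hW i)).congr (by grind))
    (((hW' i).mul (hasParity_delay hT)).congr (by grind))

theorem hasDerivAt_descPoly {n : ℕ} {T : ℝ → ℕ → Matrix (Fin 2) (Fin 2) ℂ}
    {T' : ℕ → Matrix (Fin 2) (Fin 2) ℂ} {y₀ : ℝ}
    (hTd : ∀ j a b, HasDerivAt (fun y => T y j a b) (T' j a b) y₀) (l : ℂ) (a b : Fin 2) :
    HasDerivAt (fun y => descPoly n (T y) l a b) (descPoly n T' l a b) y₀ := by
  simp only [descPoly, Matrix.sum_apply, Matrix.smul_apply, smul_eq_mul]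
  exact HasDerivAt.fun_sum fun j _ => (hTd j a b).const_mul _

theorem hasDerivAt_mulVec {A : ℝ → Matrix (Fin 2) (Fin 2) ℂ} {A' : Matrix (Fin 2) (Fin 2) ℂ}
    {φ : ℝ → Fin 2 → ℂ} {φ' : Fin 2 → ℂ} {y₀ : ℝ}
    (hA : ∀ a b, HasDerivAt (fun y => A y a b) (A' a b) y₀)
    (hφ : ∀ a, HasDerivAt (fun y => φ y a) (φ' a) y₀) (a : Fin 2) :
    HasDerivAt (fun y => (A y *ᵥ φ y) a) ((A' *ᵥ φ y₀ + A y₀ *ᵥ φ') a) y₀ := by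
  simp only [Matrix.mulVec, dotProduct, Fin.sum_univ_two, Pi.add_apply]
  refine (((hA a 0).mul (hφ 0)).add ((hA a 1).mul (hφ 1))).congr_deriv ?_
  ring

/-- If `T` annihilates the eigenfunctions of the flow `W`, then `T' + T W - W' T` does the same.
Hence it vanishes as soon as its degree is less than `n`. -/
theorem defect_eq_zero {n D : ℕ} (hD : Even D) {lam : ℕ → ℂ} {φ : ℝ → ℕ → Fin 2 → ℂ}
    {T : ℝ → ℕ → Matrix (Fin 2) (Fin 2) ℂ} {T' W W' : ℕ → Matrix (Fin 2) (Fin 2) ℂ} {y₀ : ℝ}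
    (h₁ : (Δ₁ n lam (φ y₀)).det ≠ 0) (h₂ : (Δ₂ n lam (φ y₀)).det ≠ 0)
    (hT : ∀ j, n < j → T y₀ j = 0) (hT' : ∀ j, n < j → T' j = 0)
    (pT : ∀ j, HasParity j (T y₀ j)) (pT' : ∀ j, HasParity j (T' j))
    (pW : ∀ j, HasParity j (W j)) (pW' : ∀ j, HasParity j (W' j))
    (hker : ∀ᶠ y in 𝓝 y₀, ∀ k < n, descPoly n (T y) (lam k) *ᵥ φ y k = 0)
    (hTd : ∀ j a b, HasDerivAt (fun y => T y j a b) (T' j a b) y₀)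
    (hφ : ∀ k < n, ∀ a,
      HasDerivAt (fun y => φ y k a) ((descPoly D W (lam k) *ᵥ φ y₀ k) a) y₀)
    (htop : ∀ j ≤ D, defect D (T y₀) T' W W' j = 0) :
    ∀ j ≤ n + D, defect D (T y₀) T' W W' j = 0 := by
  have hk : ∀ k < n, descPoly (n + D) (defect D (T y₀) T' W W') (lam k) *ᵥ φ y₀ k = 0 := by
    intro k hk
    have h0 : descPoly n (T y₀) (lam k) *ᵥ φ y₀ k = 0 := hker.self_of_nhds k hk
    have hd : descPoly n T' (lam k) *ᵥ φ y₀ k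
        + descPoly n (T y₀) (lam k) *ᵥ (descPoly D W (lam k) *ᵥ φ y₀ k) = 0 := by
      ext a
      refine (hasDerivAt_mulVec (hasDerivAt_descPoly hTd (lam k)) (hφ k hk) a).unique ?_
      refine (hasDerivAt_const y₀ (0 : ℂ)).congr_of_eventuallyEq ?_
      filter_upwards [hker] with y hy
      rw [hy k hk]
      rfl
    rw [descPoly_defect W W' hT hT', Matrix.sub_mulVec, Matrix.add_mulVec, ← Matrix.mulVec_mulVec,
      ← Matrix.mulVec_mulVec, hd, h0, Matrix.mulVec_zero, sub_zero]
  have hz := eq_zero_of_kernel h₁ h₂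
    (R := fun j => defect D (T y₀) T' W W' (D + 1 + j))
    (fun j => (hasParity_defect hD pT pT' pW pW' _).congr (by grind)) (fun k hkn => by
      rw [← hk k hkn, descPoly, show n + D + 1 = D + 1 + n by ring, Finset.sum_range_add,
        Finset.sum_eq_zero (s := Finset.range (D + 1)), zero_add]
      · congr 1
        refine Finset.sum_congr rfl fun j hj => ?_
        congr 2
        omega
      · intro j hj
        rw [htop j (by grind), smul_zero])
  intro j hj
  by_cases hjD : j ≤ D
  · exact htop j hjD
  · have := hz (j - (D + 1)) (by omega)
    rwa [show D + 1 + (j - (D + 1)) = j by omega] at this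

/-- The coefficient of a polynomial that is the last nonzero one. -/
theorem defect_last {D p : ℕ} {T T' W W' : ℕ → Matrix (Fin 2) (Fin 2) ℂ}
    (hT : ∀ j, p < j → T j = 0) :
    defect D T T' W W' (p + D) = T' p + T p * W D - W' D * T p := by
  rw [defect, Finset.sum_range_succ, Finset.sum_eq_zero]
  · simp [delay]
    abel
  · intro i hi
    have hi' : i < D := by grind
    have : delay i T (p + D) = 0 := by
      rw [delay, if_pos (by omega), hT _ (by omega)]
    simp [this]

/-- The coefficients of `U`, with the diagonal entries `u₁`, `u₂` of the constant term kept free. -/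
def coeffU (q r u₁ u₂ : ℂ) : ℕ → Matrix (Fin 2) (Fin 2) ℂ
  | 0 => parityMatrix 0 I (-I)
  | 1 => parityMatrix 1 r q
  | 2 => parityMatrix 2 u₁ u₂
  | _ + 3 => 0

/-- The coefficients of `V`, with the diagonal entries `v₁`, `v₂` of the constant term kept free. -/
noncomputable def coeffV (q r qx rx v₁ v₂ : ℂ) : ℕ → Matrix (Fin 2) (Fin 2) ℂ
  | 0 => parityMatrix 0 (-2 * I) (2 * I)
  | 1 => parityMatrix 1 (-2 * r) (-2 * q)
  | 2 => parityMatrix 2 (2 * I - I * q * r) (-(2 * I - I * q * r))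
  | 3 => parityMatrix 3 (r + I * rx - 1 / 2 * r ^ 2 * q) (q - I * qx - 1 / 2 * q ^ 2 * r)
  | 4 => parityMatrix 4 v₁ v₂
  | _ + 5 => 0

theorem hasParity_coeffU (q r u₁ u₂ : ℂ) : ∀ j, HasParity j (coeffU q r u₁ u₂ j)
  | 0 | 1 | 2 => hasParity_parityMatrix _ _ _
  | _ + 3 => HasParity.zero _

theorem hasParity_coeffV (q r qx rx v₁ v₂ : ℂ) : ∀ j, HasParity j (coeffV q r qx rx v₁ v₂ j)
  | 0 | 1 | 2 | 3 | 4 => hasParity_parityMatrix _ _ _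
  | _ + 5 => HasParity.zero _

/-- The first diagonal entry of the constant term of `U`. -/
noncomputable def constU (q r : ℂ) : ℂ := -(1 / 2) * I + 1 / 4 * I * (q * r)

/-- The first diagonal entry of the constant term of `V`. -/
noncomputable def constV (q r qx rx : ℂ) : ℂ :=
  -(1 / 2) * I - 1 / 8 * I * (q * r) ^ 2 + 1 / 4 * (r * qx - q * rx)

theorem laxU_eq (q r l : ℂ) :
    laxU q r l = descPoly 2 (coeffU q r (constU q r) (-constU q r)) l := by
  ext a b
  simp only [descPoly, Finset.sum_range_succ, Finset.sum_range_zero, coeffU, laxU, σ₃, Qmat,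
    parityMatrix, constU]
  fin_cases a <;> fin_cases b <;>
    simp [pow_two, show ¬ Even 1 by decide] <;> ring

theorem laxV_eq (q r qx rx l : ℂ) :
    laxV q r qx rx l
      = descPoly 4 (coeffV q r qx rx (constV q r qx rx) (-constV q r qx rx)) l := by
  ext a b
  simp only [descPoly, Finset.sum_range_succ, Finset.sum_range_zero, coeffV, laxV, σ₃, Qmat,
    parityMatrix, constV]
  fin_cases a <;> fin_cases b <;>
    simp [pow_succ, show ¬ Even 1 by decide,
      show ¬ Even 3 by decide, show Even 4 by decide] <;> ring

theorem defect_coeffU (m k m' k' : ℕ → ℂ) (q r q' r' u₁ u₂ w₁ w₂ : ℂ) :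
    let E := defect 2 (fun j => parityMatrix j (m j) (k j))
      (fun j => parityMatrix j (m' j) (k' j)) (coeffU q r u₁ u₂) (coeffU q' r' w₁ w₂)
    E 0 = parityMatrix 0 0 0 ∧
    E 1 = parityMatrix 1 (m 0 * r - 2 * I * m 1 - r' * k 0) (k 0 * q + 2 * I * k 1 - q' * m 0) ∧
    E 2 = parityMatrix 2 (m' 0 + m 0 * u₁ + m 1 * q - r' * k 1 - w₁ * m 0)
      (k' 0 + k 0 * u₂ + k 1 * r - q' * m 1 - w₂ * k 0) ∧
    E 3 = parityMatrix 3 (m' 1 + m 1 * u₂ + m 2 * r - 2 * I * m 3 - r' * k 2 - w₁ * m 1)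
      (k' 1 + k 1 * u₁ + k 2 * q + 2 * I * k 3 - q' * m 2 - w₂ * k 1) := by
  intro E
  refine ⟨?_, ?_, ?_, ?_⟩ <;> ext a b <;>
    simp only [E, defect, delay, Finset.sum_range_succ, Finset.sum_range_zero, coeffU,
      parityMatrix] <;>
    fin_cases a <;> fin_cases b <;>
    simp [show ¬ Even 1 by decide, show ¬ Even 3 by decide] <;> ring

theorem defect_coeffV (m k m' k' : ℕ → ℂ) (q r qx rx q' r' qx' rx' v₁ v₂ w₁ w₂ : ℂ) :
    let E := defect 4 (fun j => parityMatrix j (m j) (k j))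
      (fun j => parityMatrix j (m' j) (k' j)) (coeffV q r qx rx v₁ v₂)
      (coeffV q' r' qx' rx' w₁ w₂)
    E 0 = parityMatrix 0 0 0 ∧
    E 1 = parityMatrix 1 (-2 * (m 0 * r - 2 * I * m 1 - r' * k 0))
      (-2 * (k 0 * q + 2 * I * k 1 - q' * m 0)) ∧
    E 2 = parityMatrix 2
      (I * (q' * r' - q * r) * m 0 - 2 * (m 1 * q - r' * k 1))
      (I * (q * r - q' * r') * k 0 - 2 * (k 1 * r - q' * m 1)) ∧
    E 3 = parityMatrix 3
      (m 0 * (r + I * rx - 1 / 2 * r ^ 2 * q) - m 1 * (4 * I - I * (q * r + q' * r'))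
        - 2 * m 2 * r + 4 * I * m 3 + 2 * r' * k 2 - (r' + I * rx' - 1 / 2 * r' ^ 2 * q') * k 0)
      (k 0 * (q - I * qx - 1 / 2 * q ^ 2 * r) + k 1 * (4 * I - I * (q * r + q' * r'))
        - 2 * k 2 * q - 4 * I * k 3 + 2 * q' * m 2 - (q' - I * qx' - 1 / 2 * q' ^ 2 * r') * m 0) ∧
    E 4 = parityMatrix 4
      (m' 0 + m 0 * v₁ + m 1 * (q - I * qx - 1 / 2 * q ^ 2 * r) + m 2 * I * (q' * r' - q * r)
        - 2 * m 3 * q + 2 * r' * k 3 - (r' + I * rx' - 1 / 2 * r' ^ 2 * q') * k 1 - w₁ * m 0)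
      (k' 0 + k 0 * v₂ + k 1 * (r + I * rx - 1 / 2 * r ^ 2 * q) - k 2 * I * (q' * r' - q * r)
        - 2 * k 3 * r + 2 * q' * m 3 - (q' - I * qx' - 1 / 2 * q' ^ 2 * r') * m 1 - w₂ * k 0) := by
  intro E
  refine ⟨?_, ?_, ?_, ?_, ?_⟩ <;> ext a b <;>
    simp only [E, defect, delay, Finset.sum_range_succ, Finset.sum_range_zero, coeffV,
      parityMatrix] <;>
    fin_cases a <;> fin_cases b <;>
    simp [show ¬ Even 1 by decide, show ¬ Even 3 by decide, show Even 4 by decide] <;> ring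

theorem parityMatrix_zero (j : ℕ) : parityMatrix j 0 0 = 0 := by
  unfold parityMatrix
  split_ifs <;> ext a b <;> fin_cases a <;> fin_cases b <;> rfl

theorem parityMatrix_eq_zero_iff {j : ℕ} {u v : ℂ} : parityMatrix j u v = 0 ↔ u = 0 ∧ v = 0 := by
  refine ⟨fun h => ?_, fun h => by rw [h.1, h.2, parityMatrix_zero]⟩
  unfold parityMatrix at h
  split_ifs at h
  · exact ⟨congrFun (congrFun h 0) 0, congrFun (congrFun h 1) 1⟩
  · exact ⟨congrFun (congrFun h 0) 1, congrFun (congrFun h 1) 0⟩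

theorem hasDerivAt_parityMatrix {m k : ℝ → ℂ} {m' k' : ℂ} {y₀ : ℝ} (hm : HasDerivAt m m' y₀)
    (hk : HasDerivAt k k' y₀) (j : ℕ) (a b : Fin 2) :
    HasDerivAt (fun y => parityMatrix j (m y) (k y) a b) (parityMatrix j m' k' a b) y₀ := by
  unfold parityMatrix
  split_ifs <;> fin_cases a <;> fin_cases b <;>
    first | exact hm | exact hk | exact hasDerivAt_const _ _

/-- The lowest nonzero coefficients of the two rows are multiples of the leading coefficients of
the opposite rows. As the lowest coefficient of the equation `T' + T W - W' T = 0` contains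
only the constant terms of `W` and `W'`, it determines the logarithmic derivatives of the leading
coefficients. -/
theorem leading_rate {D p : ℕ} (hD : Even D) {m k : ℝ → ℕ → ℂ} {m' k' : ℕ → ℂ} {y₀ : ℝ}
    {W W' : ℕ → Matrix (Fin 2) (Fin 2) ℂ} {w w₁ w₂ C : ℂ} {K : ℝ → ℂ}
    (hW : W D = parityMatrix D w (-w)) (hW' : W' D = parityMatrix D w₁ w₂)
    (hm : ∀ j, HasDerivAt (fun y => m y j) (m' j) y₀)
    (hk : ∀ j, HasDerivAt (fun y => k y j) (k' j) y₀)
    (hm0 : ∀ j, p < j → m y₀ j = 0) (hk0 : ∀ j, p < j → k y₀ j = 0)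
    (hC : C ≠ 0) (hK : HasDerivAt K (if Even p then 0 else 2 * w * K y₀) y₀) (hK0 : K y₀ ≠ 0)
    (hmp : ∀ᶠ y in 𝓝 y₀, m y p = C * K y * k y 0)
    (hkp : ∀ᶠ y in 𝓝 y₀, k y p = C * (K y)⁻¹ * m y 0)
    (hE : defect D (fun j => parityMatrix j (m y₀ j) (k y₀ j))
      (fun j => parityMatrix j (m' j) (k' j)) W W' (p + D) = 0) :
    k' 0 = (w₁ - w) * k y₀ 0 ∧ m' 0 = (w₂ + w) * m y₀ 0 := by
  rw [defect_last (fun j hj => by rw [hm0 j hj, hk0 j hj, parityMatrix_zero]), hW, hW'] at hE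
  have dm := (hm p).unique
    (((hK.const_mul C).mul (hk 0)).congr_of_eventuallyEq hmp)
  have dk := (hk p).unique
    ((((hK.inv hK0).const_mul C).mul (hm 0)).congr_of_eventuallyEq hkp)
  have em := hmp.self_of_nhds
  have ek := hkp.self_of_nhds
  simp only [Pi.inv_apply] at dk
  by_cases hp : Even p
  · have e0 := congrFun (congrFun hE 0) 0
    have e1 := congrFun (congrFun hE 1) 1
    simp [parityMatrix, hp, hD] at e0 e1 dm dk
    rw [dm, em] at e0
    rw [dk, ek] at e1
    constructor
    · apply mul_left_cancel₀ (mul_ne_zero hC hK0)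
      linear_combination e0
    · apply mul_left_cancel₀ (mul_ne_zero hC (inv_ne_zero hK0))
      linear_combination e1
  · have e0 := congrFun (congrFun hE 0) 1
    have e1 := congrFun (congrFun hE 1) 0
    simp [parityMatrix, hp, hD] at e0 e1 dm dk
    rw [dm, em] at e0
    rw [dk, ek] at e1
    constructor
    · apply mul_left_cancel₀ (mul_ne_zero hC hK0)
      linear_combination e0
    · field_simp at e1
      apply mul_left_cancel₀ hC
      linear_combination e1

/-! ### Evolution of the coefficients -/

/-- The lowest nonzero coefficients of the two rows of the transformation, in terms of the leading
coefficients. The index `p` is `n` if all parameters are nonzero, and `n - 1` otherwise. The factor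
`K` of proportionality consists of `H = h ^ 2` and, if some `lam k` is zero, of the quotient of the
components of `φ k`; the last part states how `K` evolves under a flow in which `H` has the
logarithmic derivative `2 w`. -/
theorem exists_lowest {n : ℕ} {lam : ℕ → ℂ} {φ₀ : ℕ → Fin 2 → ℂ}
    (h₀ : (Δ₂ n lam φ₀).det ≠ 0) :
    ∃ p ≤ n, ∃ C : ℂ, C ≠ 0 ∧ ∃ K : ℂ → (ℕ → Fin 2 → ℂ) → ℂ,
      (∀ (h s : ℂ) (φ : ℕ → Fin 2 → ℂ), h ≠ 0 → (Δ₁ n lam φ).det ≠ 0 → (Δ₂ n lam φ).det ≠ 0 →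
        K (h ^ 2) φ ≠ 0 ∧
        lead₁ n lam h s φ * rowCoeff n lam φ p = C * K (h ^ 2) φ * lead₂ n lam h s φ ∧
        lead₂ n lam h s φ * rowCoeff n lam (swap φ) p
          = C * (K (h ^ 2) φ)⁻¹ * lead₁ n lam h s φ ∧
        ∀ j, p < j → rowCoeff n lam φ j = 0 ∧ rowCoeff n lam (swap φ) j = 0) ∧
      ∀ (H : ℝ → ℂ) (φ : ℝ → ℕ → Fin 2 → ℂ) (y₀ : ℝ) (w : ℂ),
        (Δ₁ n lam (φ y₀)).det ≠ 0 → (Δ₂ n lam (φ y₀)).det ≠ 0 →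
        HasDerivAt H (2 * w * H y₀) y₀ →
        (∀ k < n, lam k = 0 → HasDerivAt (fun y => φ y k 0) (w * φ y₀ k 0) y₀ ∧
          HasDerivAt (fun y => φ y k 1) (-w * φ y₀ k 1) y₀) →
        HasDerivAt (fun y => K (H y) (φ y))
          (if Even p then 0 else 2 * w * K (H y₀) (φ y₀)) y₀ := by
  by_cases hlam : ∀ k < n, lam k ≠ 0
  · obtain ⟨C, hC, hlast⟩ := exists_rowCoeff_last hlam
    refine ⟨n, le_rfl, C, hC, fun H _ => if Even n then 1 else H, ?_, ?_⟩
    · intro h s φ hh h₁ h₂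
      have e₁ := hlast φ h₂
      have e₂ := hlast (swap φ) h₁
      rw [Δ₁_swap, Δ₂_swap] at e₂
      refine ⟨by split_ifs <;> simp [hh], ?_, ?_,
        fun j hj => ⟨rowCoeff_of_lt hj _ _, rowCoeff_of_lt hj _ _⟩⟩
      · unfold lead₁ lead₂
        split_ifs
        · linear_combination s⁻¹ * e₁
        · field_simp
          linear_combination s⁻¹ * e₁
      · unfold lead₁ lead₂
        split_ifs
        · linear_combination s⁻¹ * e₂
        · field_simp
          linear_combination s⁻¹ * e₂
    · intro H φ y₀ w _ _ hH _
      split_ifs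
      · exact hasDerivAt_const _ _
      · exact hH
  · push Not at hlam
    obtain ⟨k, hkn, hk⟩ := hlam
    obtain ⟨m, rfl⟩ : ∃ m, n = m + 1 := ⟨n - 1, by omega⟩
    obtain ⟨C, hC, hlow⟩ := exists_rowCoeff_of_zero h₀ ⟨k, hkn⟩ hk
    obtain ⟨ε, -, hdet⟩ := exists_det_of_zero ⟨k, hkn⟩ hk
    have hne : ∀ φ : ℕ → Fin 2 → ℂ, (Δ₁ (m + 1) lam φ).det ≠ 0 → (Δ₂ (m + 1) lam φ).det ≠ 0 →
        φ k 0 ≠ 0 ∧ φ k 1 ≠ 0 := by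
      intro φ h₁ h₂
      have h₁' := h₁
      rw [← Δ₂_swap, hdet] at h₁'
      rw [hdet] at h₂
      by_cases hm : Even m
      · simp only [hm, if_true, swap_one] at h₁' h₂
        exact ⟨fun h => h₁' (by simp [h]), fun h => h₂ (by simp [h])⟩
      · simp only [hm, if_false, swap_zero] at h₁' h₂
        exact ⟨fun h => h₂ (by simp [h]), fun h => h₁' (by simp [h])⟩
    refine ⟨m, by omega, C, hC,
      fun H φ => if Even m then H * (φ k 1 / φ k 0) else φ k 0 / φ k 1, ?_, ?_⟩
    · intro h s φ hh h₁ h₂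
      obtain ⟨e₁, z₁⟩ := hlow φ h₂
      obtain ⟨e₂, z₂⟩ := hlow (swap φ) h₁
      rw [Δ₁_swap, Δ₂_swap] at e₂
      obtain ⟨n0, n1⟩ := hne φ h₁ h₂
      refine ⟨by split_ifs <;> simp [hh, n0, n1], ?_, ?_, fun j hj => ?_⟩
      · unfold lead₁ lead₂
        by_cases hm : Even m
        · simp only [hm, if_true, if_neg (show ¬ Even (m + 1) by grind)] at e₁ ⊢
          field_simp
          linear_combination s⁻¹ * e₁
        · simp only [hm, if_false, if_pos (show Even (m + 1) by grind)] at e₁ ⊢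
          field_simp
          linear_combination s⁻¹ * e₁
      · unfold lead₁ lead₂
        by_cases hm : Even m
        · simp only [hm, if_true, if_neg (show ¬ Even (m + 1) by grind), swap_one,
            swap_zero] at e₂ ⊢
          field_simp
          linear_combination s⁻¹ * e₂
        · simp only [hm, if_false, if_pos (show Even (m + 1) by grind), swap_one,
            swap_zero] at e₂ ⊢
          field_simp
          linear_combination s⁻¹ * e₂
      · obtain rfl | hj' := eq_or_lt_of_le (Nat.succ_le_of_lt hj)
        · exact ⟨z₁, z₂⟩
        · exact ⟨rowCoeff_of_lt hj' _ _, rowCoeff_of_lt hj' _ _⟩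
    · intro H φ y₀ w h₁ h₂ hH hφ
      obtain ⟨n0, n1⟩ := hne (φ y₀) h₁ h₂
      obtain ⟨d0, d1⟩ := hφ k hkn hk
      split_ifs
      · refine (hH.mul (d1.div d0 n0)).congr_deriv ?_
        simp only [Pi.div_apply]
        field_simp
        ring
      · refine (d0.div d1 n1).congr_deriv ?_
        field_simp
        ring

theorem descPoly_zero (n : ℕ) (T : ℕ → Matrix (Fin 2) (Fin 2) ℂ) : descPoly n T 0 = T n := by
  rw [descPoly, Finset.sum_range_succ, Finset.sum_eq_zero]
  · simp
  · intro j hj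
    rw [zero_pow (by grind), zero_smul]

/-- A flow with a traceless `W`. Once the coefficients of highest order of `T' + T W - W' T` vanish,
all of them do, and the constant term of `W'` is traceless and related to the leading coefficients
of `T`. -/
theorem flow_of_top {n D : ℕ} (hD : Even D) {lam : ℕ → ℂ} {φ : ℝ → ℕ → Fin 2 → ℂ} {h s : ℝ → ℂ}
    {y₀ : ℝ} {m' k' : ℕ → ℂ} {W W' : ℕ → Matrix (Fin 2) (Fin 2) ℂ} {w w₁ w₂ : ℂ}
    (hdet : ∀ᶠ y in 𝓝 y₀, (Δ₁ n lam (φ y)).det ≠ 0 ∧ (Δ₂ n lam (φ y)).det ≠ 0)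
    (hh : ∀ᶠ y in 𝓝 y₀, h y ≠ 0)
    (hs : ∀ᶠ y in 𝓝 y₀, s y ^ 2 = (Δ₁ n lam (φ y)).det * (Δ₂ n lam (φ y)).det)
    (pW : ∀ j, HasParity j (W j)) (pW' : ∀ j, HasParity j (W' j))
    (hW : W D = parityMatrix D w (-w)) (hW' : W' D = parityMatrix D w₁ w₂)
    (hH : HasDerivAt (fun y => h y ^ 2) (2 * w * h y₀ ^ 2) y₀)
    (hφ : ∀ k < n, ∀ a,
      HasDerivAt (fun y => φ y k a) ((descPoly D W (lam k) *ᵥ φ y₀ k) a) y₀)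
    (hm : ∀ j, HasDerivAt (fun y => lead₁ n lam (h y) (s y) (φ y) * rowCoeff n lam (φ y) j)
      (m' j) y₀)
    (hk : ∀ j, HasDerivAt
      (fun y => lead₂ n lam (h y) (s y) (φ y) * rowCoeff n lam (swap (φ y)) j) (k' j) y₀)
    (htop : ∀ j ≤ D, defect D (coeffT n lam (h y₀) (s y₀) (φ y₀))
      (fun j => parityMatrix j (m' j) (k' j)) W W' j = 0) :
    (∀ j ≤ n + D, defect D (coeffT n lam (h y₀) (s y₀) (φ y₀))
      (fun j => parityMatrix j (m' j) (k' j)) W W' j = 0) ∧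
    m' 0 = (w - w₁) * lead₁ n lam (h y₀) (s y₀) (φ y₀) ∧
    k' 0 = (w₁ - w) * lead₂ n lam (h y₀) (s y₀) (φ y₀) ∧ w₂ = -w₁ := by
  obtain ⟨h₁, h₂⟩ := hdet.self_of_nhds
  have hm0 : ∀ j, n < j → m' j = 0 := fun j hj => (hm j).unique (by
    simp only [rowCoeff_of_lt hj, mul_zero]
    exact hasDerivAt_const _ _)
  have hk0 : ∀ j, n < j → k' j = 0 := fun j hj => (hk j).unique (by
    simp only [rowCoeff_of_lt hj, mul_zero]
    exact hasDerivAt_const _ _)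
  have hall := defect_eq_zero hD (T := fun y => coeffT n lam (h y) (s y) (φ y)) h₁ h₂
    (fun j hj => coeffT_of_lt hj _ _ _ _)
    (fun j hj => by rw [hm0 j hj, hk0 j hj, parityMatrix_zero])
    (fun j => hasParity_parityMatrix _ _ _) (fun j => hasParity_parityMatrix _ _ _) pW pW'
    (by
      filter_upwards [hdet] with y hy k hk
      exact descPoly_coeffT_mulVec_eq_zero hy.1 hy.2 _ _ hk)
    (fun j => hasDerivAt_parityMatrix (hm j) (hk j) j) hφ htop
  obtain ⟨p, hp, C, hC, K, hK, hKd⟩ := exists_lowest h₂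
  have hφ0 : ∀ k < n, lam k = 0 → HasDerivAt (fun y => φ y k 0) (w * φ y₀ k 0) y₀ ∧
      HasDerivAt (fun y => φ y k 1) (-w * φ y₀ k 1) y₀ := by
    intro k hkn hk0
    have d0 := hφ k hkn 0
    have d1 := hφ k hkn 1
    rw [hk0, descPoly_zero, hW, parityMatrix, if_pos hD] at d0 d1
    simpa [Matrix.mulVec, dotProduct, Fin.sum_univ_two] using And.intro d0 d1
  have z := (hK (h y₀) (s y₀) (φ y₀) hh.self_of_nhds h₁ h₂).2.2.2
  obtain ⟨rk, rm⟩ := leading_rate hD (W := W) (W' := W')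
    (m := fun y j => lead₁ n lam (h y) (s y) (φ y) * rowCoeff n lam (φ y) j)
    (k := fun y j => lead₂ n lam (h y) (s y) (φ y) * rowCoeff n lam (swap (φ y)) j)
    (K := fun y => K (h y ^ 2) (φ y)) hW hW' hm hk
    (fun j hj => by rw [(z j hj).1, mul_zero]) (fun j hj => by rw [(z j hj).2, mul_zero]) hC
    (hKd _ φ y₀ w h₁ h₂ hH hφ0) (hK (h y₀) (s y₀) (φ y₀) hh.self_of_nhds h₁ h₂).1
    (by
      filter_upwards [hdet, hh] with y hy hhy
      rw [(hK (h y) (s y) (φ y) hhy hy.1 hy.2).2.1]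
      simp [rowCoeff])
    (by
      filter_upwards [hdet, hh] with y hy hhy
      rw [(hK (h y) (s y) (φ y) hhy hy.1 hy.2).2.2.1]
      simp [rowCoeff])
    (hall (p + D) (by omega))
  have one := (hm 0).mul (hk 0)
  have e := one.unique ((hasDerivAt_const y₀ (1 : ℂ)).congr_of_eventuallyEq (by
    filter_upwards [hdet, hh, hs] with y hy hhy hsy
    simp only [Pi.mul_apply, rowCoeff, mul_one]
    exact lead₁_mul_lead₂ hhy hy.1 hy.2 hsy))
  have e1 := lead₁_mul_lead₂ hh.self_of_nhds h₁ h₂ hs.self_of_nhds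
  simp only [rowCoeff, mul_one] at e rk rm
  have w12 : w₂ = -w₁ := by
    rw [rm, rk] at e
    linear_combination e - (w₁ + w₂) * e1
  exact ⟨hall, by rw [rm, w12]; ring, rk, w12⟩

/-- The transformed product of the potentials. -/
theorem diag_eq {q r q' r' m₀ k₀ m₁ k₁ : ℂ} (mk : m₀ * k₀ = 1)
    (hr : r' = m₀ ^ 2 * r - 2 * I * m₀ * m₁) (hq : q' = k₀ ^ 2 * q + 2 * I * k₀ * k₁) :
    (m₁ * q - r' * k₁) * k₀ = I / 2 * (q' * r' - q * r) := by
  rw [hr, hq]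
  linear_combination (-(k₀ * m₁ * q) - I / 2 * (m₀ * k₀ + 1) * q * r) * mk
    + (m₀ * k₀ * (k₀ * m₁ * q - m₀ * k₁ * r) + 2 * I * m₀ * k₀ * m₁ * k₁) * I_sq

/-- The coefficient of order `l ^ (n + 1)` of the equation in `t`, first row: it follows from the
coefficient of order `l ^ (n - 1)` of the equation in `x` and the derivative of `r'`. -/
theorem subleading_eq₁ {q r rx q' r' rx' m₀ k₀ m₁ m₂ m₃ k₂ mx₀ mx₁ : ℂ}
    (mk : m₀ * k₀ = 1) (hr : r' = m₀ ^ 2 * r - 2 * I * m₀ * m₁)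
    (hrx : rx' = 2 * m₀ * mx₀ * r + m₀ ^ 2 * rx - 2 * I * (mx₀ * m₁ + m₀ * mx₁))
    (hmx : mx₀ = (constU q r - constU q' r') * m₀)
    (hx : mx₁ + m₁ * -constU q r + m₂ * r - 2 * I * m₃ - r' * k₂ - constU q' r' * m₁ = 0) :
    m₀ * (r + I * rx - 1 / 2 * r ^ 2 * q) - m₁ * (4 * I - I * (q * r + q' * r'))
      - 2 * m₂ * r + 4 * I * m₃ + 2 * r' * k₂
      - (r' + I * rx' - 1 / 2 * r' ^ 2 * q') * k₀ = 0 := by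
  have hrk : r' * k₀ = m₀ * r - 2 * I * m₁ := by
    rw [hr]
    linear_combination (m₀ * r - 2 * I * m₁) * mk
  have hrxk : rx' * k₀ = 2 * (constU q r - constU q' r') * m₀ * r + m₀ * rx
      - 2 * I * ((constU q r - constU q' r') * m₁ + mx₁) := by
    rw [hrx, hmx]
    linear_combination (2 * (constU q r - constU q' r') * m₀ * r + m₀ * rx
      - 2 * I * ((constU q r - constU q' r') * m₁ + mx₁)) * mk
  unfold constU at hrxk hx
  linear_combination -2 * hx - (1 - 1 / 2 * r' * q') * hrk - I * hrxk
    + (-(1 / 2) * (q * r - q' * r') * m₀ * r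
      + 2 * (1 / 4 * I * (q * r - q' * r') * m₁ + mx₁)) * I_sq

/-- The second row of the coefficient treated in `subleading_eq₁`. -/
theorem subleading_eq₂ {q r qx q' r' qx' m₀ k₀ k₁ k₂ k₃ m₂ kx₀ kx₁ : ℂ}
    (mk : m₀ * k₀ = 1) (hq : q' = k₀ ^ 2 * q + 2 * I * k₀ * k₁)
    (hqx : qx' = 2 * k₀ * kx₀ * q + k₀ ^ 2 * qx + 2 * I * (kx₀ * k₁ + k₀ * kx₁))
    (hkx : kx₀ = (constU q' r' - constU q r) * k₀)
    (hx : kx₁ + k₁ * constU q r + k₂ * q + 2 * I * k₃ - q' * m₂ - -constU q' r' * k₁ = 0) :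
    k₀ * (q - I * qx - 1 / 2 * q ^ 2 * r) + k₁ * (4 * I - I * (q * r + q' * r'))
      - 2 * k₂ * q - 4 * I * k₃ + 2 * q' * m₂
      - (q' - I * qx' - 1 / 2 * q' ^ 2 * r') * m₀ = 0 := by
  have hqk : q' * m₀ = k₀ * q + 2 * I * k₁ := by
    rw [hq]
    linear_combination (k₀ * q + 2 * I * k₁) * mk
  have hqxk : qx' * m₀ = 2 * (constU q' r' - constU q r) * k₀ * q + k₀ * qx
      + 2 * I * ((constU q' r' - constU q r) * k₁ + kx₁) := by
    rw [hqx, hkx]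
    linear_combination (2 * (constU q' r' - constU q r) * k₀ * q + k₀ * qx
      + 2 * I * ((constU q' r' - constU q r) * k₁ + kx₁)) * mk
  unfold constU at hqxk hx
  linear_combination -2 * hx - (1 - 1 / 2 * q' * r') * hqk + I * hqxk
    + (1 / 2 * (q' * r' - q * r) * k₀ * q
      + 2 * (1 / 4 * I * (q' * r' - q * r) * k₁ + kx₁)) * I_sq

/-- The constant term of the transformed `V`. The squares of `V` and of the transformed matrix `W'`
are scalar, and the coefficient of order `l ^ (n + 4)` in `(W' ^ 2 - V ^ 2) T = T' V + W' T'` gives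
the claim; it is a combination of the coefficients of order `l ^ n`, ..., `l ^ (n + 3)` in the
equation `T' + T V - W' T = 0`. -/
theorem constV_eq {q r qx rx q' r' qx' rx' m₀ k₀ m₁ k₁ m₂ k₂ m₃ k₃ m' w : ℂ} (hm₀ : m₀ ≠ 0)
    (e1a : m₀ * r - 2 * I * m₁ - r' * k₀ = 0)
    (e1b : k₀ * q + 2 * I * k₁ - q' * m₀ = 0)
    (e2a : I * (q' * r' - q * r) * m₀ - 2 * (m₁ * q - r' * k₁) = 0)
    (e3a : m₀ * (r + I * rx - 1 / 2 * r ^ 2 * q) - m₁ * (4 * I - I * (q * r + q' * r'))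
      - 2 * m₂ * r + 4 * I * m₃ + 2 * r' * k₂
      - (r' + I * rx' - 1 / 2 * r' ^ 2 * q') * k₀ = 0)
    (e3b : k₀ * (q - I * qx - 1 / 2 * q ^ 2 * r) + k₁ * (4 * I - I * (q * r + q' * r'))
      - 2 * k₂ * q - 4 * I * k₃ + 2 * q' * m₂
      - (q' - I * qx' - 1 / 2 * q' ^ 2 * r') * m₀ = 0)
    (e4a : m' + m₀ * constV q r qx rx + m₁ * (q - I * qx - 1 / 2 * q ^ 2 * r)
      + m₂ * I * (q' * r' - q * r) - 2 * m₃ * q + 2 * r' * k₃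
      - (r' + I * rx' - 1 / 2 * r' ^ 2 * q') * k₁ - w * m₀ = 0)
    (hm' : m' = (constV q r qx rx - w) * m₀) : w = constV q' r' qx' rx' := by
  have sq : ((2 * I - I * q * r) ^ 2 - 2 * r * (q - I * qx - 1 / 2 * q ^ 2 * r)
        - 2 * q * (r + I * rx - 1 / 2 * r ^ 2 * q) - 4 * I * constV q r qx rx
      - ((2 * I - I * q' * r') ^ 2 - 2 * r' * (q' - I * qx' - 1 / 2 * q' ^ 2 * r')
        - 2 * q' * (r' + I * rx' - 1 / 2 * r' ^ 2 * q') - 4 * I * w)) * m₀ = 4 * I * m' := by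
    linear_combination (-4 * I) * e4a - 2 * r' * e3b - 2 * q * e3a
      + (4 * I - I * q * r - I * q' * r') * e2a
      - 2 * (r' + I * rx' - 1 / 2 * r' ^ 2 * q') * e1b
      - 2 * (q - I * qx - 1 / 2 * q ^ 2 * r) * e1a
      - 4 * (q * r - q' * r') * m₂ * I_sq
  rw [hm', ← mul_assoc] at sq
  have sq' := mul_right_cancel₀ hm₀ sq
  unfold constV at sq' ⊢
  linear_combination (-I / 8) * sq'
    + ((w - (-(1 / 2) * I - 1 / 8 * I * (q * r) ^ 2 + 1 / 4 * (r * qx - q * rx)))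
      + (I / 8 * (2 - q * r) ^ 2 + 1 / 4 * (r * qx - q * rx))
      - (I / 8 * (2 - q' * r') ^ 2 + 1 / 4 * (r' * qx' - q' * rx'))) * I_sq

/-- The flow in `x`: the coefficients of the `n`-fold transformation satisfy `T' + T U = U' T`, with
`U'` built from the transformed potentials `q'`, `r'`. -/
theorem flow_x {n : ℕ} {lam : ℕ → ℂ} {φ : ℝ → ℕ → Fin 2 → ℂ} {h s : ℝ → ℂ}
    {y₀ : ℝ} {m' k' : ℕ → ℂ} {q r q' r' : ℂ}
    (hdet : ∀ᶠ y in 𝓝 y₀, (Δ₁ n lam (φ y)).det ≠ 0 ∧ (Δ₂ n lam (φ y)).det ≠ 0)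
    (hh : ∀ᶠ y in 𝓝 y₀, h y ≠ 0)
    (hs : ∀ᶠ y in 𝓝 y₀, s y ^ 2 = (Δ₁ n lam (φ y)).det * (Δ₂ n lam (φ y)).det)
    (hH : HasDerivAt (fun y => h y ^ 2) (2 * constU q r * h y₀ ^ 2) y₀)
    (hφ : ∀ k < n, ∀ a,
      HasDerivAt (fun y => φ y k a) ((laxU q r (lam k) *ᵥ φ y₀ k) a) y₀)
    (hm : ∀ j, HasDerivAt (fun y => lead₁ n lam (h y) (s y) (φ y) * rowCoeff n lam (φ y) j)
      (m' j) y₀)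
    (hk : ∀ j, HasDerivAt
      (fun y => lead₂ n lam (h y) (s y) (φ y) * rowCoeff n lam (swap (φ y)) j) (k' j) y₀)
    (hr' : r' = lead₁ n lam (h y₀) (s y₀) (φ y₀) ^ 2 * (r - 2 * I * rowCoeff n lam (φ y₀) 1))
    (hq' : q' = lead₂ n lam (h y₀) (s y₀) (φ y₀) ^ 2
      * (q + 2 * I * rowCoeff n lam (swap (φ y₀)) 1)) :
    (∀ j ≤ n + 2, defect 2 (coeffT n lam (h y₀) (s y₀) (φ y₀))
      (fun j => parityMatrix j (m' j) (k' j)) (coeffU q r (constU q r) (-constU q r))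
      (coeffU q' r' (constU q' r') (-constU q' r')) j = 0) ∧
    m' 0 = (constU q r - constU q' r') * lead₁ n lam (h y₀) (s y₀) (φ y₀) ∧
    k' 0 = (constU q' r' - constU q r) * lead₂ n lam (h y₀) (s y₀) (φ y₀) := by
  set m : ℕ → ℂ := fun j => lead₁ n lam (h y₀) (s y₀) (φ y₀) * rowCoeff n lam (φ y₀) j with hmdef
  set k : ℕ → ℂ := fun j => lead₂ n lam (h y₀) (s y₀) (φ y₀) * rowCoeff n lam (swap (φ y₀)) j
    with hkdef
  have mk : m 0 * k 0 = 1 := by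
    simp only [hmdef, hkdef, rowCoeff, mul_one]
    exact lead₁_mul_lead₂ hh.self_of_nhds hdet.self_of_nhds.1 hdet.self_of_nhds.2 hs.self_of_nhds
  have m00 : m 0 = lead₁ n lam (h y₀) (s y₀) (φ y₀) := by simp [hmdef, rowCoeff]
  have k00 : k 0 = lead₂ n lam (h y₀) (s y₀) (φ y₀) := by simp [hkdef, rowCoeff]
  have hr : r' = m 0 ^ 2 * r - 2 * I * m 0 * m 1 := by
    rw [hr', m00]; simp only [hmdef]; ring
  have hq : q' = k 0 ^ 2 * q + 2 * I * k 0 * k 1 := by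
    rw [hq', k00]; simp only [hkdef]; ring
  -- The constant term of `W'` is first chosen so that the coefficient of order `l ^ n` vanishes.
  set w₁ : ℂ := (m' 0 + m 0 * constU q r + m 1 * q - r' * k 1) * k 0 with hw₁
  set w₂ : ℂ := (k' 0 + k 0 * (-constU q r) + k 1 * r - q' * m 1) * m 0 with hw₂
  obtain ⟨E0, E1, E2, -⟩ := defect_coeffU m k m' k' q r q' r' (constU q r) (-constU q r) w₁ w₂
  have htop : ∀ j ≤ 2, defect 2 (coeffT n lam (h y₀) (s y₀) (φ y₀))
      (fun j => parityMatrix j (m' j) (k' j)) (coeffU q r (constU q r) (-constU q r))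
      (coeffU q' r' w₁ w₂) j = 0 := by
    intro j hj
    interval_cases j
    · exact E0.trans (parityMatrix_zero 0)
    · refine E1.trans (parityMatrix_eq_zero_iff.2 ⟨?_, ?_⟩)
      · rw [hr]
        linear_combination (2 * I * m 1 - m 0 * r) * mk
      · rw [hq]
        linear_combination (-2 * I * k 1 - k 0 * q) * mk
    · refine E2.trans (parityMatrix_eq_zero_iff.2 ⟨?_, ?_⟩)
      · rw [hw₁]
        linear_combination (-(m' 0 + m 0 * constU q r + m 1 * q - r' * k 1)) * mk
      · rw [hw₂]
        linear_combination (-(k' 0 + k 0 * (-constU q r) + k 1 * r - q' * m 1)) * mk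
  obtain ⟨hall, rm, rk, w12⟩ := flow_of_top (by decide) hdet hh hs (hasParity_coeffU _ _ _ _)
    (hasParity_coeffU _ _ _ _) rfl rfl hH (by simpa only [← laxU_eq] using hφ) hm hk htop
  have key : w₁ = constU q' r' := by
    rw [← m00] at rm
    have h2 : 2 * w₁ = 2 * constU q r + (m 1 * q - r' * k 1) * k 0 := by
      have := hw₁
      rw [rm] at this
      linear_combination this + (2 * constU q r - w₁) * mk
    rw [diag_eq mk hr hq] at h2
    unfold constU at h2 ⊢
    linear_combination h2 / 2
  rw [w12, key] at hall
  exact ⟨hall, by rw [← key]; exact rm, by rw [← key]; exact rk⟩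

/-- The flow in `t`: the coefficients of the `n`-fold transformation satisfy `T' + T V = V' T`. The
coefficients `mx`, `kx` of the derivative in `x`, known from `flow_x`, enter through the derivatives
of the transformed potentials. -/
theorem flow_t {n : ℕ} (hn : 1 ≤ n) {lam : ℕ → ℂ} {φ : ℝ → ℕ → Fin 2 → ℂ} {h s : ℝ → ℂ}
    {y₀ : ℝ} {m' k' mx kx : ℕ → ℂ} {q r qx rx q' r' qx' rx' : ℂ}
    (hdet : ∀ᶠ y in 𝓝 y₀, (Δ₁ n lam (φ y)).det ≠ 0 ∧ (Δ₂ n lam (φ y)).det ≠ 0)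
    (hh : ∀ᶠ y in 𝓝 y₀, h y ≠ 0)
    (hs : ∀ᶠ y in 𝓝 y₀, s y ^ 2 = (Δ₁ n lam (φ y)).det * (Δ₂ n lam (φ y)).det)
    (hH : HasDerivAt (fun y => h y ^ 2) (2 * constV q r qx rx * h y₀ ^ 2) y₀)
    (hφ : ∀ k < n, ∀ a,
      HasDerivAt (fun y => φ y k a) ((laxV q r qx rx (lam k) *ᵥ φ y₀ k) a) y₀)
    (hm : ∀ j, HasDerivAt (fun y => lead₁ n lam (h y) (s y) (φ y) * rowCoeff n lam (φ y) j)
      (m' j) y₀)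
    (hk : ∀ j, HasDerivAt
      (fun y => lead₂ n lam (h y) (s y) (φ y) * rowCoeff n lam (swap (φ y)) j) (k' j) y₀)
    (hr' : r' = lead₁ n lam (h y₀) (s y₀) (φ y₀) ^ 2 * (r - 2 * I * rowCoeff n lam (φ y₀) 1))
    (hq' : q' = lead₂ n lam (h y₀) (s y₀) (φ y₀) ^ 2
      * (q + 2 * I * rowCoeff n lam (swap (φ y₀)) 1))
    (hx : ∀ j ≤ n + 2, defect 2 (coeffT n lam (h y₀) (s y₀) (φ y₀))
      (fun j => parityMatrix j (mx j) (kx j)) (coeffU q r (constU q r) (-constU q r))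
      (coeffU q' r' (constU q' r') (-constU q' r')) j = 0)
    (hmx : mx 0 = (constU q r - constU q' r') * lead₁ n lam (h y₀) (s y₀) (φ y₀))
    (hkx : kx 0 = (constU q' r' - constU q r) * lead₂ n lam (h y₀) (s y₀) (φ y₀))
    (hrx' : rx' = 2 * lead₁ n lam (h y₀) (s y₀) (φ y₀) * mx 0 * r
      + lead₁ n lam (h y₀) (s y₀) (φ y₀) ^ 2 * rx
      - 2 * I * (mx 0 * (lead₁ n lam (h y₀) (s y₀) (φ y₀) * rowCoeff n lam (φ y₀) 1)
        + lead₁ n lam (h y₀) (s y₀) (φ y₀) * mx 1))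
    (hqx' : qx' = 2 * lead₂ n lam (h y₀) (s y₀) (φ y₀) * kx 0 * q
      + lead₂ n lam (h y₀) (s y₀) (φ y₀) ^ 2 * qx
      + 2 * I * (kx 0 * (lead₂ n lam (h y₀) (s y₀) (φ y₀) * rowCoeff n lam (swap (φ y₀)) 1)
        + lead₂ n lam (h y₀) (s y₀) (φ y₀) * kx 1)) :
    (∀ j ≤ n + 4, defect 4 (coeffT n lam (h y₀) (s y₀) (φ y₀))
      (fun j => parityMatrix j (m' j) (k' j))
      (coeffV q r qx rx (constV q r qx rx) (-constV q r qx rx))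
      (coeffV q' r' qx' rx' (constV q' r' qx' rx') (-constV q' r' qx' rx')) j = 0) ∧
    m' 0 = (constV q r qx rx - constV q' r' qx' rx') * lead₁ n lam (h y₀) (s y₀) (φ y₀) ∧
    k' 0 = (constV q' r' qx' rx' - constV q r qx rx) * lead₂ n lam (h y₀) (s y₀) (φ y₀) := by
  set m : ℕ → ℂ := fun j => lead₁ n lam (h y₀) (s y₀) (φ y₀) * rowCoeff n lam (φ y₀) j with hmdef
  set k : ℕ → ℂ := fun j => lead₂ n lam (h y₀) (s y₀) (φ y₀) * rowCoeff n lam (swap (φ y₀)) j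
    with hkdef
  have mk : m 0 * k 0 = 1 := by
    simp only [hmdef, hkdef, rowCoeff, mul_one]
    exact lead₁_mul_lead₂ hh.self_of_nhds hdet.self_of_nhds.1 hdet.self_of_nhds.2 hs.self_of_nhds
  have m00 : m 0 = lead₁ n lam (h y₀) (s y₀) (φ y₀) := by simp [hmdef, rowCoeff]
  have k00 : k 0 = lead₂ n lam (h y₀) (s y₀) (φ y₀) := by simp [hkdef, rowCoeff]
  have hr : r' = m 0 ^ 2 * r - 2 * I * m 0 * m 1 := by
    rw [hr', m00]; simp only [hmdef]; ring
  have hq : q' = k 0 ^ 2 * q + 2 * I * k 0 * k 1 := by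
    rw [hq', k00]; simp only [hkdef]; ring
  have hrx : rx' = 2 * m 0 * mx 0 * r + m 0 ^ 2 * rx - 2 * I * (mx 0 * m 1 + m 0 * mx 1) := by
    rw [hrx', m00]
  have hqx : qx' = 2 * k 0 * kx 0 * q + k 0 ^ 2 * qx + 2 * I * (kx 0 * k 1 + k 0 * kx 1) := by
    rw [hqx', k00]
  rw [← m00] at hmx ⊢
  rw [← k00] at hkx ⊢
  clear hrx' hqx' hr' hq'
  obtain ⟨-, -, X2, X3⟩ := defect_coeffU m k mx kx q r q' r' (constU q r) (-constU q r)
    (constU q' r') (-constU q' r')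
  obtain ⟨-, x2b⟩ := parityMatrix_eq_zero_iff.1 (X2.symm.trans (hx 2 (by omega)))
  obtain ⟨x3a, x3b⟩ := parityMatrix_eq_zero_iff.1 (X3.symm.trans (hx 3 (by omega)))
  set w₁ : ℂ := (m' 0 + m 0 * constV q r qx rx + m 1 * (q - I * qx - 1 / 2 * q ^ 2 * r)
    + m 2 * I * (q' * r' - q * r) - 2 * m 3 * q + 2 * r' * k 3
    - (r' + I * rx' - 1 / 2 * r' ^ 2 * q') * k 1) * k 0 with hw₁
  set w₂ : ℂ := (k' 0 + k 0 * (-constV q r qx rx) + k 1 * (r + I * rx - 1 / 2 * r ^ 2 * q)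
    - k 2 * I * (q' * r' - q * r) - 2 * k 3 * r + 2 * q' * m 3
    - (q' - I * qx' - 1 / 2 * q' ^ 2 * r') * m 1) * m 0 with hw₂
  obtain ⟨E0, E1, E2, E3, E4⟩ := defect_coeffV m k m' k' q r qx rx q' r' qx' rx'
    (constV q r qx rx) (-constV q r qx rx) w₁ w₂
  have e1a : m 0 * r - 2 * I * m 1 - r' * k 0 = 0 := by
    rw [hr]
    linear_combination (2 * I * m 1 - m 0 * r) * mk
  have e1b : k 0 * q + 2 * I * k 1 - q' * m 0 = 0 := by
    rw [hq]
    linear_combination (-2 * I * k 1 - k 0 * q) * mk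
  have e2a : I * (q' * r' - q * r) * m 0 - 2 * (m 1 * q - r' * k 1) = 0 := by
    have := diag_eq mk hr hq
    linear_combination -2 * m 0 * this + 2 * (m 1 * q - r' * k 1) * mk
  have e2b : I * (q * r - q' * r') * k 0 - 2 * (k 1 * r - q' * m 1) = 0 := by
    unfold constU at hkx x2b
    linear_combination -2 * x2b + 2 * hkx
  have e3a := subleading_eq₁ mk hr hrx hmx x3a
  have e3b := subleading_eq₂ mk hq hqx hkx x3b
  have e4a : m' 0 + m 0 * constV q r qx rx + m 1 * (q - I * qx - 1 / 2 * q ^ 2 * r)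
      + m 2 * I * (q' * r' - q * r) - 2 * m 3 * q + 2 * r' * k 3
      - (r' + I * rx' - 1 / 2 * r' ^ 2 * q') * k 1 - w₁ * m 0 = 0 := by
    rw [hw₁]
    linear_combination (-(m' 0 + m 0 * constV q r qx rx + m 1 * (q - I * qx - 1 / 2 * q ^ 2 * r)
      + m 2 * I * (q' * r' - q * r) - 2 * m 3 * q + 2 * r' * k 3
      - (r' + I * rx' - 1 / 2 * r' ^ 2 * q') * k 1)) * mk
  have htop : ∀ j ≤ 4, defect 4 (coeffT n lam (h y₀) (s y₀) (φ y₀))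
      (fun j => parityMatrix j (m' j) (k' j))
      (coeffV q r qx rx (constV q r qx rx) (-constV q r qx rx))
      (coeffV q' r' qx' rx' w₁ w₂) j = 0 := by
    intro j hj
    interval_cases j
    · exact E0.trans (parityMatrix_zero 0)
    · refine E1.trans (parityMatrix_eq_zero_iff.2 ⟨by rw [e1a, mul_zero], by rw [e1b, mul_zero]⟩)
    · exact E2.trans (parityMatrix_eq_zero_iff.2 ⟨e2a, e2b⟩)
    · exact E3.trans (parityMatrix_eq_zero_iff.2 ⟨e3a, e3b⟩)
    · refine E4.trans (parityMatrix_eq_zero_iff.2 ⟨e4a, ?_⟩)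
      rw [hw₂]
      linear_combination (-(k' 0 + k 0 * (-constV q r qx rx)
        + k 1 * (r + I * rx - 1 / 2 * r ^ 2 * q) - k 2 * I * (q' * r' - q * r) - 2 * k 3 * r
        + 2 * q' * m 3 - (q' - I * qx' - 1 / 2 * q' ^ 2 * r') * m 1)) * mk
  obtain ⟨hall, rm, rk, w12⟩ := flow_of_top (by decide) hdet hh hs (hasParity_coeffV _ _ _ _ _ _)
    (hasParity_coeffV _ _ _ _ _ _) rfl rfl hH (by simpa only [← laxV_eq] using hφ) hm hk htop
  rw [← m00] at rm
  rw [← k00] at rk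
  have key : w₁ = constV q' r' qx' rx' :=
    constV_eq (left_ne_zero_of_mul_eq_one mk) e1a e1b e2a e3a e3b e4a rm
  rw [w12, key] at hall
  exact ⟨hall, by rw [← key]; exact rm, by rw [← key]; exact rk⟩

/-! ### Zero curvature -/

/-- Entrywise derivative of a matrix-valued function of a real variable. -/
def HasEntryDerivAt (A : ℝ → Matrix (Fin 2) (Fin 2) ℂ) (A' : Matrix (Fin 2) (Fin 2) ℂ) (y : ℝ) :
    Prop := ∀ a b, HasDerivAt (fun z => A z a b) (A' a b) y

theorem HasEntryDerivAt.mul {A B : ℝ → Matrix (Fin 2) (Fin 2) ℂ}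
    {A' B' : Matrix (Fin 2) (Fin 2) ℂ} {y : ℝ} (hA : HasEntryDerivAt A A' y)
    (hB : HasEntryDerivAt B B' y) :
    HasEntryDerivAt (fun z => A z * B z) (A' * B y + A y * B') y := by
  intro a b
  simp only [Matrix.mul_apply, Matrix.add_apply, Fin.sum_univ_two]
  refine (((hA a 0).mul (hB 0 b)).add ((hA a 1).mul (hB 1 b))).congr_deriv ?_
  ring

theorem HasEntryDerivAt.sub {A B : ℝ → Matrix (Fin 2) (Fin 2) ℂ}
    {A' B' : Matrix (Fin 2) (Fin 2) ℂ} {y : ℝ} (hA : HasEntryDerivAt A A' y)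
    (hB : HasEntryDerivAt B B' y) : HasEntryDerivAt (fun z => A z - B z) (A' - B') y :=
  fun a b => (hA a b).sub (hB a b)

/-- Symmetry of the mixed second derivatives of a matrix-valued function. -/
theorem mixed_eq {Ω : Set (ℝ × ℝ)} (hΩ : IsOpen Ω) {x t : ℝ} (hp : (x, t) ∈ Ω)
    {T X Y : ℝ → ℝ → Matrix (Fin 2) (Fin 2) ℂ} {A B : Matrix (Fin 2) (Fin 2) ℂ}
    (hT : ∀ i j, IsC2On Ω (fun x t => T x t i j))
    (hX : ∀ y τ, (y, τ) ∈ Ω → HasEntryDerivAt (fun z => T z τ) (X y τ) y)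
    (hY : ∀ y τ, (y, τ) ∈ Ω → HasEntryDerivAt (fun z => T y z) (Y y τ) τ)
    (hA : HasEntryDerivAt (fun τ => X x τ) A t) (hB : HasEntryDerivAt (fun y => Y y t) B x) :
    A = B := by
  ext i j
  have e1 : dt (dx fun x t => T x t i j) x t = A i j :=
    ((hA i j).congr_of_eventuallyEq
      ((eventually_mem_t hΩ hp).mono fun τ hτ => (hX x τ hτ i j).deriv)).deriv
  have e2 : dx (dt fun x t => T x t i j) x t = B i j :=
    ((hB i j).congr_of_eventuallyEq
      ((eventually_mem_x hΩ hp).mono fun y hy => (hY y t hy i j).deriv)).deriv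
  rw [← e1, ← e2]
  exact (hT i j).dt_dx hΩ hp

/-- The derivative of `U` along a curve on which `q`, `r` have the derivatives `dq`, `dr`. -/
noncomputable def dlaxU (q r dq dr l : ℂ) : Matrix (Fin 2) (Fin 2) ℂ :=
  !![1 / 4 * I * (dq * r + q * dr), l * dr; l * dq, -(1 / 4 * I * (dq * r + q * dr))]

/-- The derivative of `V` along a curve on which `q`, `r`, `q_x`, `r_x` have the derivatives `dq`,
`dr`, `dqx`, `drx`. -/
noncomputable def dlaxV (q r qx rx dq dr dqx drx l : ℂ) : Matrix (Fin 2) (Fin 2) ℂ :=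
  let v := -(l ^ 2 * I * (dq * r + q * dr)) - 1 / 4 * I * (q * r) * (dq * r + q * dr)
    + 1 / 4 * (dr * qx + r * dqx - dq * rx - q * drx)
  !![v, -2 * l ^ 3 * dr + l * (dr + I * drx - 1 / 2 * (2 * r * dr * q + r ^ 2 * dq));
    -2 * l ^ 3 * dq + l * (dq - I * dqx - 1 / 2 * (2 * q * dq * r + q ^ 2 * dr)), -v]

theorem laxU_entries (q r l : ℂ) :
    laxU q r l = !![I * l ^ 2 + constU q r, l * r; l * q, -(I * l ^ 2 + constU q r)] := by
  rw [laxU_eq]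
  ext a b
  simp only [descPoly, Finset.sum_range_succ, Finset.sum_range_zero, coeffU, parityMatrix]
  fin_cases a <;> fin_cases b <;> simp [show ¬ Even 1 by decide] <;> ring

theorem laxV_entries (q r qx rx l : ℂ) :
    laxV q r qx rx l =
      !![-2 * I * l ^ 4 + l ^ 2 * (2 * I - I * q * r) + constV q r qx rx,
        -2 * l ^ 3 * r + l * (r + I * rx - 1 / 2 * r ^ 2 * q);
        -2 * l ^ 3 * q + l * (q - I * qx - 1 / 2 * q ^ 2 * r),
        -(-2 * I * l ^ 4 + l ^ 2 * (2 * I - I * q * r) + constV q r qx rx)] := by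
  rw [laxV_eq]
  ext a b
  simp only [descPoly, Finset.sum_range_succ, Finset.sum_range_zero, coeffV, parityMatrix]
  fin_cases a <;> fin_cases b <;> simp [show ¬ Even 1 by decide, show ¬ Even 3 by decide,
    show Even 4 by decide] <;> ring

theorem hasEntryDerivAt_laxU {q r : ℝ → ℂ} {dq dr : ℂ} {y : ℝ} (hq : HasDerivAt q dq y)
    (hr : HasDerivAt r dr y) (l : ℂ) :
    HasEntryDerivAt (fun z => laxU (q z) (r z) l) (dlaxU (q y) (r y) dq dr l) y := by
  have h0 : HasDerivAt (fun z => I * l ^ 2 + constU (q z) (r z))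
      (1 / 4 * I * (dq * r y + q y * dr)) y :=
    (((hq.mul hr).const_mul (1 / 4 * I)).const_add (-(1 / 2) * I)).const_add (I * l ^ 2)
  intro a b
  simp only [laxU_entries, dlaxU]
  fin_cases a <;> fin_cases b
  · exact h0
  · exact hr.const_mul l
  · exact hq.const_mul l
  · exact h0.neg

theorem hasEntryDerivAt_laxV {q r qx rx : ℝ → ℂ} {dq dr dqx drx : ℂ} {y : ℝ}
    (hq : HasDerivAt q dq y) (hr : HasDerivAt r dr y) (hqx : HasDerivAt qx dqx y)
    (hrx : HasDerivAt rx drx y) (l : ℂ) :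
    HasEntryDerivAt (fun z => laxV (q z) (r z) (qx z) (rx z) l)
      (dlaxV (q y) (r y) (qx y) (rx y) dq dr dqx drx l) y := by
  have h0 : HasDerivAt (fun z => -2 * I * l ^ 4 + l ^ 2 * (2 * I - I * q z * r z)
      + constV (q z) (r z) (qx z) (rx z))
      (-(l ^ 2 * I * (dq * r y + q y * dr)) - 1 / 4 * I * (q y * r y) * (dq * r y + q y * dr)
        + 1 / 4 * (dr * qx y + r y * dqx - dq * rx y - q y * drx)) y := by
    have e1 := ((((hq.const_mul I).mul hr).const_sub (2 * I)).const_mul (l ^ 2)).const_add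
      (-2 * I * l ^ 4)
    have e2 := ((((hq.mul hr).pow 2).const_mul (1 / 8 * I)).const_sub (-(1 / 2) * I)).add
      (((hr.mul hqx).sub (hq.mul hrx)).const_mul (1 / 4))
    refine (e1.add e2).congr_deriv ?_
    simp
    ring
  have hq2 : HasDerivAt (fun z => q z ^ 2) (2 * q y * dq) y := (hq.pow 2).congr_deriv (by simp)
  have hr2 : HasDerivAt (fun z => r z ^ 2) (2 * r y * dr) y := (hr.pow 2).congr_deriv (by simp)
  intro a b
  simp only [laxV_entries, dlaxV]
  fin_cases a <;> fin_cases b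
  · exact h0
  · refine ((hr.const_mul (-2 * l ^ 3)).add (((hr.add (hrx.const_mul I)).sub
      ((hr2.const_mul (1 / 2)).mul hq)).const_mul l)).congr_deriv ?_
    simp only [Fin.zero_eta, Fin.mk_one, of_apply, cons_val]
    ring
  · refine ((hq.const_mul (-2 * l ^ 3)).add (((hq.sub (hqx.const_mul I)).sub
      ((hq2.const_mul (1 / 2)).mul hr)).const_mul l)).congr_deriv ?_
    simp only [Fin.zero_eta, Fin.mk_one, of_apply, cons_val]
    ring
  · exact h0.neg

/-- The curvature `U_t - V_x + [U, V]` is built from the left-hand sides of the two equations of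
the system. -/
theorem curvature_eq (q r qx rx qt rt qxx rxx l : ℂ) :
    let ρ := rt - I * rxx + I * r ^ 2 * q + r * q * rx
    let κ := qt + I * qxx - I * q ^ 2 * r + q * r * qx
    dlaxU q r qt rt l - dlaxV q r qx rx qx rx qxx rxx l
      + laxU q r l * laxV q r qx rx l - laxV q r qx rx l * laxU q r l
      = !![1 / 4 * I * (q * ρ + r * κ), l * ρ; l * κ, -(1 / 4 * I * (q * ρ + r * κ))] := by
  intro ρ κ
  rw [laxU_entries, laxV_entries]
  have I2 := I_sq
  ext a b
  fin_cases a <;> fin_cases b <;>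
    simp [dlaxU, dlaxV, constU, constV, ρ, κ] <;>
    ring_nf <;> simp only [I2] <;> ring

/-- If a transformation which is invertible for some nonzero spectral parameter transforms the Lax
pair of a solution into the Lax pair of `(q', r')`, then the curvature of the latter vanishes by the
symmetry of second derivatives, so that `(q', r')` is a solution. -/
theorem isSolution_of_isDarboux {Ω : Set (ℝ × ℝ)} (hΩ : IsOpen Ω) {q r q' r' : ℝ → ℝ → ℂ}
    (hqr : IsSolution Ω q r) (hq' : IsC2On Ω q') (hr' : IsC2On Ω r')
    {T : ℂ → ℝ → ℝ → Matrix (Fin 2) (Fin 2) ℂ}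
    (hT : ∀ l i j, IsC2On Ω (fun x t => T l x t i j)) (hD : IsDarboux Ω q r q' r' T)
    (hinv : ∀ x t, (x, t) ∈ Ω → ∃ l ≠ 0, (T l x t).det ≠ 0) : IsSolution Ω q' r' := by
  have key : ∀ x t, (x, t) ∈ Ω →
      dt r' x t - I * dx (dx r') x t + I * r' x t ^ 2 * q' x t + r' x t * q' x t * dx r' x t = 0 ∧
      dt q' x t + I * dx (dx q') x t - I * q' x t ^ 2 * r' x t
        + q' x t * r' x t * dx q' x t = 0 := by
    intro x t hp
    obtain ⟨l, hl, hdet⟩ := hinv x t hp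
    -- `A1` and `A2` give the two mixed second derivatives of `T`.
    have dTx : HasEntryDerivAt (fun y => T l y t) _ x := fun i j => (hD x t hp l i j).1
    have dTt : HasEntryDerivAt (fun τ => T l x τ) _ t := fun i j => (hD x t hp l i j).2
    have A1 := ((hasEntryDerivAt_laxU (hq'.hasDerivAt_t hΩ hp) (hr'.hasDerivAt_t hΩ hp) l).mul
      dTt).sub (dTt.mul (hasEntryDerivAt_laxU (hqr.c2_q.hasDerivAt_t hΩ hp)
        (hqr.c2_r.hasDerivAt_t hΩ hp) l))
    have A2 := ((hasEntryDerivAt_laxV (hq'.hasDerivAt_x hΩ hp) (hr'.hasDerivAt_x hΩ hp)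
      (hq'.hasDerivAt_dx_x hΩ hp) (hr'.hasDerivAt_dx_x hΩ hp) l).mul
      dTx).sub (dTx.mul (hasEntryDerivAt_laxV (hqr.c2_q.hasDerivAt_x hΩ hp)
        (hqr.c2_r.hasDerivAt_x hΩ hp) (hqr.c2_q.hasDerivAt_dx_x hΩ hp)
        (hqr.c2_r.hasDerivAt_dx_x hΩ hp) l))
    have comm := mixed_eq hΩ hp (hT l) (fun y τ hy i j => (hD y τ hy l i j).1)
      (fun y τ hy i j => (hD y τ hy l i j).2) A1 A2
    have c0 := curvature_eq (q x t) (r x t) (dx q x t) (dx r x t) (dt q x t) (dt r x t)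
      (dx (dx q) x t) (dx (dx r) x t) l
    have c1 := curvature_eq (q' x t) (r' x t) (dx q' x t) (dx r' x t) (dt q' x t) (dt r' x t)
      (dx (dx q') x t) (dx (dx r') x t) l
    simp only [hqr.eq_r x t hp, hqr.eq_q x t hp] at c0
    simp only at c1
    have c0' : dlaxU (q x t) (r x t) (dt q x t) (dt r x t) l
        - dlaxV (q x t) (r x t) (dx q x t) (dx r x t) (dx q x t) (dx r x t) (dx (dx q) x t)
          (dx (dx r) x t) l
        + laxU (q x t) (r x t) l * laxV (q x t) (r x t) (dx q x t) (dx r x t) l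
        - laxV (q x t) (r x t) (dx q x t) (dx r x t) l * laxU (q x t) (r x t) l = 0 := by
      rw [c0]
      ext a b
      fin_cases a <;> fin_cases b <;> simp
    have z : (dlaxU (q' x t) (r' x t) (dt q' x t) (dt r' x t) l
        - dlaxV (q' x t) (r' x t) (dx q' x t) (dx r' x t) (dx q' x t) (dx r' x t) (dx (dx q') x t)
          (dx (dx r') x t) l
        + laxU (q' x t) (r' x t) l * laxV (q' x t) (r' x t) (dx q' x t) (dx r' x t) l
        - laxV (q' x t) (r' x t) (dx q' x t) (dx r' x t) l * laxU (q' x t) (r' x t) l)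
          * T l x t = 0 := by
      have hz := congrArg (T l x t * ·) c0'
      simp only [mul_zero] at hz
      rw [← hz]
      have comm' := sub_eq_zero.2 comm
      rw [← sub_eq_zero, ← comm']
      noncomm_ring
    rw [c1] at z
    have z0 := (Matrix.isUnit_iff_isUnit_det _).2 (isUnit_iff_ne_zero.2 hdet)
      |>.mul_left_eq_zero.1 z
    have z01 := congrFun (congrFun z0 0) 1
    have z10 := congrFun (congrFun z0 1) 0
    simp [hl] at z01 z10
    exact ⟨z01, z10⟩
  exact ⟨hq', hr', fun x t hp => (key x t hp).1, fun x t hp => (key x t hp).2⟩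

/-- A matrix polynomial with invertible leading coefficient is invertible at some nonzero point: put
`l = μ⁻¹` with small `μ`. -/
theorem exists_descPoly_det_ne_zero {n : ℕ} {T : ℕ → Matrix (Fin 2) (Fin 2) ℂ}
    (hT : (T 0).det ≠ 0) : ∃ l ≠ 0, (descPoly n T l).det ≠ 0 := by
  have hc : Continuous fun μ : ℂ => (∑ j ∈ Finset.range (n + 1), μ ^ j • T j).det := by
    fun_prop
  have h0 : (∑ j ∈ Finset.range (n + 1), (0 : ℂ) ^ j • T j).det ≠ 0 := by
    rw [Finset.sum_range_succ']
    simpa using hT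
  have hev : ∀ᶠ μ in 𝓝[≠] (0 : ℂ), (∑ j ∈ Finset.range (n + 1), μ ^ j • T j).det ≠ 0 :=
    (hc.continuousAt.eventually_ne h0).filter_mono nhdsWithin_le_nhds
  obtain ⟨μ, hμ, hμ0⟩ := (hev.and self_mem_nhdsWithin).exists
  have hμ0' : μ ≠ 0 := hμ0
  refine ⟨μ⁻¹, inv_ne_zero hμ0', ?_⟩
  have : descPoly n T μ⁻¹ = (μ⁻¹) ^ n • ∑ j ∈ Finset.range (n + 1), μ ^ j • T j := by
    rw [descPoly, Finset.smul_sum]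
    refine Finset.sum_congr rfl fun j hj => ?_
    have hj' : j ≤ n := by grind
    rw [smul_smul]
    congr 1
    obtain ⟨e, rfl⟩ := Nat.exists_eq_add_of_le hj'
    rw [Nat.add_sub_cancel_left, pow_add, mul_right_comm, ← mul_pow, inv_mul_cancel₀ hμ0']
    simp
  rw [this, Matrix.det_smul]
  exact mul_ne_zero (by simp [hμ0']) hμ

/-! ### The transformed solution -/

/-- The transformed potential `q`, in terms of the leading and the subleading coefficient of the
second row of the transformation. -/
noncomputable def newQ (n : ℕ) (lam : ℕ → ℂ) (h s : ℂ) (φ : ℕ → Fin 2 → ℂ) (q : ℂ) : ℂ :=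
  lead₂ n lam h s φ ^ 2 * (q + 2 * I * rowCoeff n lam (swap φ) 1)

/-- The transformed potential `r`, in terms of the leading and the subleading coefficient of the
first row of the transformation. -/
noncomputable def newR (n : ℕ) (lam : ℕ → ℂ) (h s : ℂ) (φ : ℕ → Fin 2 → ℂ) (r : ℂ) : ℂ :=
  lead₁ n lam h s φ ^ 2 * (r - 2 * I * rowCoeff n lam φ 1)

theorem constU_factor (q r H : ℂ) : 1 / 2 * I * (q * r - 2) * H = 2 * constU q r * H := by
  unfold constU; ring

theorem constV_factor (q r qx rx H : ℂ) :
    -(1 / 4) * (4 * I + I * q ^ 2 * r ^ 2 - 2 * r * qx + 2 * q * rx) * H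
      = 2 * constV q r qx rx * H := by
  unfold constV; ring

theorem IsSqrtOn.ne_zero {Ω : Set (ℝ × ℝ)} {s u : ℝ → ℝ → ℂ} (hs : IsSqrtOn Ω s u)
    (hu : ∀ x t, (x, t) ∈ Ω → u x t ≠ 0) {x t : ℝ} (hp : (x, t) ∈ Ω) : s x t ≠ 0 := fun h =>
  hu x t hp (by rw [← hs.2 x t hp, h]; simp)

theorem hasDerivAt_sq {a : ℝ → ℂ} {a' : ℂ} {y : ℝ} (ha : HasDerivAt a a' y) :
    HasDerivAt (fun z => a z ^ 2) (2 * a y * a') y := (ha.pow 2).congr_deriv (by simp)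

theorem hasDerivAt_potential {a b u : ℝ → ℂ} {a' b' u' : ℂ} {y : ℝ} (ha : HasDerivAt a a' y)
    (hb : HasDerivAt b b' y) (hu : HasDerivAt u u' y) (c : ℂ) :
    HasDerivAt (fun z => a z ^ 2 * u z + c * (a z * b z))
      (2 * a y * a' * u y + a y ^ 2 * u' + c * (a' * b y + a y * b')) y :=
  ((hasDerivAt_sq ha).mul hu).add ((ha.mul hb).const_mul c)

section

variable {Ω : Set (ℝ × ℝ)} {q r H h : ℝ → ℝ → ℂ} {n : ℕ} {lam : ℕ → ℂ}
  {Φ : ℕ → ℝ → ℝ → Fin 2 → ℂ} {s : ℝ → ℝ → ℂ}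

theorem isC2On_lead₁ (hΦ : ∀ k < n, ∀ i, IsC2On Ω (fun x t => Φ k x t i)) (hh : IsC2On Ω h)
    (hs : IsC2On Ω s) (hs0 : ∀ x t, (x, t) ∈ Ω → s x t ≠ 0) :
    IsC2On Ω (fun x t => lead₁ n lam (h x t) (s x t) (fun k => Φ k x t)) := by
  unfold lead₁
  split_ifs
  · exact (((isC2On_const 1).mul (hs.inv hs0)).mul (isC2On_det_Δ₂ hΦ))
  · exact ((hh.mul (hs.inv hs0)).mul (isC2On_det_Δ₂ hΦ))

theorem isC2On_lead₂ (hΦ : ∀ k < n, ∀ i, IsC2On Ω (fun x t => Φ k x t i)) (hh : IsC2On Ω h)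
    (hh0 : ∀ x t, (x, t) ∈ Ω → h x t ≠ 0)
    (hs : IsC2On Ω s) (hs0 : ∀ x t, (x, t) ∈ Ω → s x t ≠ 0) :
    IsC2On Ω (fun x t => lead₂ n lam (h x t) (s x t) (fun k => Φ k x t)) := by
  unfold lead₂
  split_ifs
  · exact (((isC2On_const 1).mul (hs.inv hs0)).mul (isC2On_det_Δ₁ hΦ))
  · exact (((hh.inv hh0).mul (hs.inv hs0)).mul (isC2On_det_Δ₁ hΦ))

/-- The `n`-fold transformation leads to a new solution, transforms the Lax pairs into each other,
and the factor belonging to the new solution is `H` times the square of the leading coefficient of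
its second row. -/
theorem nFold_darboux (hΩ : IsOpen Ω) (hqr : IsSolution Ω q r) (hH : IsFactor Ω q r H)
    (hh : IsSqrtOn Ω h H) (hn : 1 ≤ n) (hΦ : ∀ k < n, IsEigenfunction Ω q r (lam k) (Φ k))
    (hΔ : ∀ x t : ℝ, (x, t) ∈ Ω → detProd n lam Φ x t ≠ 0)
    (hs : IsSqrtOn Ω s (detProd n lam Φ)) :
    IsSolution Ω (fun x t => newQ n lam (h x t) (s x t) (fun k => Φ k x t) (q x t))
        (fun x t => newR n lam (h x t) (s x t) (fun k => Φ k x t) (r x t)) ∧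
      IsDarboux Ω q r (fun x t => newQ n lam (h x t) (s x t) (fun k => Φ k x t) (q x t))
        (fun x t => newR n lam (h x t) (s x t) (fun k => Φ k x t) (r x t))
        (fun l x t => nFold n lam (h x t) (s x t) (fun k => Φ k x t) l) ∧
      IsFactor Ω (fun x t => newQ n lam (h x t) (s x t) (fun k => Φ k x t) (q x t))
        (fun x t => newR n lam (h x t) (s x t) (fun k => Φ k x t) (r x t))
        (fun x t => H x t * lead₂ n lam (h x t) (s x t) (fun k => Φ k x t) ^ 2) := by
  have hΦ2 : ∀ k < n, ∀ i, IsC2On Ω (fun x t => Φ k x t i) := fun k hk => (hΦ k hk).c2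
  have hdet : ∀ x t, (x, t) ∈ Ω → (Δ₁ n lam (fun k => Φ k x t)).det ≠ 0 ∧
      (Δ₂ n lam (fun k => Φ k x t)).det ≠ 0 := fun x t hp =>
    ⟨left_ne_zero_of_mul (hΔ x t hp), right_ne_zero_of_mul (hΔ x t hp)⟩
  have hh2 := hh.isC2On hΩ hH.c2 hH.ne_zero
  have hh0 : ∀ x t, (x, t) ∈ Ω → h x t ≠ 0 := fun x t hp => hh.ne_zero hH.ne_zero hp
  have hs2 : IsC2On Ω s := hs.isC2On hΩ ((isC2On_det_Δ₁ hΦ2).mul (isC2On_det_Δ₂ hΦ2)) hΔ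
  have hs0 : ∀ x t, (x, t) ∈ Ω → s x t ≠ 0 := fun x t hp => hs.ne_zero hΔ hp
  have hl₁ := isC2On_lead₁ (lam := lam) hΦ2 hh2 hs2 hs0
  have hl₂ := isC2On_lead₂ (lam := lam) hΦ2 hh2 hh0 hs2 hs0
  have hrow := isC2On_rowCoeff (lam := lam) hΦ2 fun x t hp => (hdet x t hp).2
  have hrow' : ∀ j, IsC2On Ω (fun x t => rowCoeff n lam (swap fun k => Φ k x t) j) :=
    isC2On_rowCoeff (Φ := swapFun Φ) (isC2On_swapFun hΦ2) fun x t hp => (hdet x t hp).1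
  have hR : IsC2On Ω (fun x t => newR n lam (h x t) (s x t) (fun k => Φ k x t) (r x t)) :=
    (hl₁.pow 2).mul (hqr.c2_r.sub ((isC2On_const (2 * I)).mul (hrow 1)))
  have hQ : IsC2On Ω (fun x t => newQ n lam (h x t) (s x t) (fun k => Φ k x t) (q x t)) :=
    (hl₂.pow 2).mul (hqr.c2_q.add ((isC2On_const (2 * I)).mul (hrow' 1)))
  set q' := fun x t => newQ n lam (h x t) (s x t) (fun k => Φ k x t) (q x t) with hq'
  set r' := fun x t => newR n lam (h x t) (s x t) (fun k => Φ k x t) (r x t) with hr'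
  set m : ℕ → ℝ → ℝ → ℂ := fun j x t =>
    lead₁ n lam (h x t) (s x t) (fun k => Φ k x t) * rowCoeff n lam (fun k => Φ k x t) j with hmdef
  set k : ℕ → ℝ → ℝ → ℂ := fun j x t =>
    lead₂ n lam (h x t) (s x t) (fun k => Φ k x t) * rowCoeff n lam (swap fun k => Φ k x t) j
    with hkdef
  have hm : ∀ j, IsC2On Ω (m j) := fun j => hl₁.mul (hrow j)
  have hk : ∀ j, IsC2On Ω (k j) := fun j => hl₂.mul (hrow' j)
  have m0 : ∀ x t, m 0 x t = lead₁ n lam (h x t) (s x t) (fun k => Φ k x t) := fun x t => by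
    simp [hmdef, rowCoeff]
  have k0 : ∀ x t, k 0 x t = lead₂ n lam (h x t) (s x t) (fun k => Φ k x t) := fun x t => by
    simp [hkdef, rowCoeff]
  have er : r' = fun x t => m 0 x t ^ 2 * r x t + -(2 * I) * (m 0 x t * m 1 x t) := by
    ext x t
    rw [m0]
    simp only [hr', newR, hmdef]
    ring
  have eq : q' = fun x t => k 0 x t ^ 2 * q x t + 2 * I * (k 0 x t * k 1 x t) := by
    ext x t
    rw [k0]
    simp only [hq', newQ, hkdef]
    ring
  have hHx : ∀ x t, (x, t) ∈ Ω →
      HasDerivAt (fun y => H y t) (2 * constU (q x t) (r x t) * H x t) x := fun x t hp => by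
    rw [← constU_factor]; exact hH.eq_x x t hp
  have hHt : ∀ x t, (x, t) ∈ Ω →
      HasDerivAt (fun τ => H x τ) (2 * constV (q x t) (r x t) (dx q x t) (dx r x t) * H x t) t :=
    fun x t hp => by
      rw [← constV_factor]; exact hH.eq_t x t hp
  have X : ∀ x t, (x, t) ∈ Ω → _ := fun x t hp =>
    flow_x (φ := fun y k => Φ k y t) (h := fun y => h y t) (s := fun y => s y t) (y₀ := x)
      (m' := fun j => dx (m j) x t) (k' := fun j => dx (k j) x t) (q' := q' x t) (r' := r' x t)
      ((eventually_mem_x hΩ hp).mono fun y hy => hdet y t hy)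
      ((eventually_mem_x hΩ hp).mono fun y hy => hh0 y t hy)
      ((eventually_mem_x hΩ hp).mono fun y hy => hs.2 y t hy)
      (by
        rw [hh.2 x t hp]
        exact (hHx x t hp).congr_of_eventuallyEq
          ((eventually_mem_x hΩ hp).mono fun y hy => hh.2 y t hy))
      (fun i hi => (hΦ i hi).eq_x x t hp)
      (fun j => (hm j).hasDerivAt_x hΩ hp) (fun j => (hk j).hasDerivAt_x hΩ hp) rfl rfl
  have T : ∀ x t, (x, t) ∈ Ω → _ := fun x t hp =>
    flow_t hn (φ := fun τ k => Φ k x τ) (h := fun τ => h x τ) (s := fun τ => s x τ) (y₀ := t)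
      (m' := fun j => dt (m j) x t) (k' := fun j => dt (k j) x t)
      (mx := fun j => dx (m j) x t) (kx := fun j => dx (k j) x t)
      (q' := q' x t) (r' := r' x t) (qx' := dx q' x t) (rx' := dx r' x t)
      ((eventually_mem_t hΩ hp).mono fun τ hτ => hdet x τ hτ)
      ((eventually_mem_t hΩ hp).mono fun τ hτ => hh0 x τ hτ)
      ((eventually_mem_t hΩ hp).mono fun τ hτ => hs.2 x τ hτ)
      (by
        rw [hh.2 x t hp]
        exact (hHt x t hp).congr_of_eventuallyEq
          ((eventually_mem_t hΩ hp).mono fun τ hτ => hh.2 x τ hτ))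
      (fun i hi => (hΦ i hi).eq_t x t hp)
      (fun j => (hm j).hasDerivAt_t hΩ hp) (fun j => (hk j).hasDerivAt_t hΩ hp) rfl rfl
      (X x t hp).1 (X x t hp).2.1 (X x t hp).2.2
      (by
        rw [er]
        refine HasDerivAt.deriv ?_
        refine (hasDerivAt_potential ((hm 0).hasDerivAt_x hΩ hp) ((hm 1).hasDerivAt_x hΩ hp)
          (hqr.c2_r.hasDerivAt_x hΩ hp) (-(2 * I))).congr_deriv ?_
        rw [m0, neg_mul, ← sub_eq_add_neg])
      (by
        rw [eq]
        refine HasDerivAt.deriv ?_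
        refine (hasDerivAt_potential ((hk 0).hasDerivAt_x hΩ hp) ((hk 1).hasDerivAt_x hΩ hp)
          (hqr.c2_q.hasDerivAt_x hΩ hp) (2 * I)).congr_deriv ?_
        rw [k0])
  have hD : IsDarboux Ω q r q' r'
      (fun l x t => nFold n lam (h x t) (s x t) (fun k => Φ k x t) l) := by
    have vanish : ∀ (N : ℕ) (E : ℕ → Matrix (Fin 2) (Fin 2) ℂ) (l : ℂ),
        (∀ j ≤ N, E j = 0) → descPoly N E l = 0 := fun N E l hE =>
      Finset.sum_eq_zero fun j hj => by rw [hE j (by grind), smul_zero]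
    have z : ∀ x t, ∀ j, n < j → m j x t = 0 ∧ k j x t = 0 := fun x t j hj => by
      simp [hmdef, hkdef, rowCoeff_of_lt hj]
    intro x t hp l i j
    constructor
    · refine ((hasDerivAt_descPoly (n := n) (fun j => hasDerivAt_parityMatrix
        ((hm j).hasDerivAt_x hΩ hp) ((hk j).hasDerivAt_x hΩ hp) j) l i j).congr_of_eventuallyEq
        ((eventually_mem_x hΩ hp).mono fun y hy => ?_)).congr_deriv ?_
      · exact congrFun (congrFun (nFold_eq (hdet y t hy).1 (hdet y t hy).2 _ _ l) i) j
      · have e := descPoly_defect (n := n) (D := 2)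
          (T := coeffT n lam (h x t) (s x t) (fun k => Φ k x t))
          (T' := fun j => parityMatrix j (dx (m j) x t) (dx (k j) x t))
          (coeffU (q x t) (r x t) (constU (q x t) (r x t)) (-constU (q x t) (r x t)))
          (coeffU (q' x t) (r' x t) (constU (q' x t) (r' x t)) (-constU (q' x t) (r' x t)))
          (fun j hj => coeffT_of_lt hj _ _ _ _) (fun j hj => by
            simp [dx, z _ _ j hj, parityMatrix_zero]) l
        rw [vanish _ _ _ (X x t hp).1, ← laxU_eq, ← laxU_eq] at e
        beta_reduce
        rw [nFold_eq (hdet x t hp).1 (hdet x t hp).2]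
        exact congrArg (fun M : Matrix (Fin 2) (Fin 2) ℂ => M i j)
          (eq_sub_of_add_eq (sub_eq_zero.1 e.symm))
    · refine ((hasDerivAt_descPoly (n := n) (fun j => hasDerivAt_parityMatrix
        ((hm j).hasDerivAt_t hΩ hp) ((hk j).hasDerivAt_t hΩ hp) j) l i j).congr_of_eventuallyEq
        ((eventually_mem_t hΩ hp).mono fun τ hτ => ?_)).congr_deriv ?_
      · exact congrFun (congrFun (nFold_eq (hdet x τ hτ).1 (hdet x τ hτ).2 _ _ l) i) j
      · have e := descPoly_defect (n := n) (D := 4)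
          (T := coeffT n lam (h x t) (s x t) (fun k => Φ k x t))
          (T' := fun j => parityMatrix j (dt (m j) x t) (dt (k j) x t))
          (coeffV (q x t) (r x t) (dx q x t) (dx r x t)
            (constV (q x t) (r x t) (dx q x t) (dx r x t))
            (-constV (q x t) (r x t) (dx q x t) (dx r x t)))
          (coeffV (q' x t) (r' x t) (dx q' x t) (dx r' x t)
            (constV (q' x t) (r' x t) (dx q' x t) (dx r' x t))
            (-constV (q' x t) (r' x t) (dx q' x t) (dx r' x t)))
          (fun j hj => coeffT_of_lt hj _ _ _ _) (fun j hj => by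
            simp [dt, z _ _ j hj, parityMatrix_zero]) l
        rw [vanish _ _ _ (T x t hp).1, ← laxV_eq, ← laxV_eq] at e
        beta_reduce
        rw [nFold_eq (hdet x t hp).1 (hdet x t hp).2]
        exact congrArg (fun M : Matrix (Fin 2) (Fin 2) ℂ => M i j)
          (eq_sub_of_add_eq (sub_eq_zero.1 e.symm))
  have hlead : ∀ x t, (x, t) ∈ Ω → m 0 x t * k 0 x t = 1 := fun x t hp => by
    rw [m0, k0]
    exact lead₁_mul_lead₂ (hh0 x t hp) (hdet x t hp).1 (hdet x t hp).2 (hs.2 x t hp)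
  refine ⟨isSolution_of_isDarboux hΩ hqr hQ hR ?_ hD ?_, hD, ?_⟩
  · intro l i j
    have : IsC2On Ω (fun x t => descPoly n (coeffT n lam (h x t) (s x t) (fun k => Φ k x t)) l i j)
        := by
      simp only [descPoly, Matrix.sum_apply, Matrix.smul_apply, smul_eq_mul]
      refine IsC2On.sum _ fun p _ => IsC2On.const_mul _ ?_
      unfold coeffT parityMatrix
      split_ifs <;> fin_cases i <;> fin_cases j <;>
        first | exact hm p | exact hk p | exact isC2On_const 0
    refine this.congr fun x t hp => ?_
    rw [nFold_eq (hdet x t hp).1 (hdet x t hp).2]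
  · intro x t hp
    obtain ⟨l, hl, hd⟩ := exists_descPoly_det_ne_zero (n := n)
      (T := coeffT n lam (h x t) (s x t) (fun k => Φ k x t)) (by
        have := hlead x t hp
        simp only [hmdef, hkdef] at this
        simp [coeffT, parityMatrix, Matrix.det_fin_two, this])
    exact ⟨l, hl, by rwa [nFold_eq (hdet x t hp).1 (hdet x t hp).2]⟩
  · simp only [← k0]
    refine ⟨hH.c2.mul ((hk 0).pow 2), fun x t hp => mul_ne_zero (hH.ne_zero x t hp)
      (pow_ne_zero 2 (right_ne_zero_of_mul_eq_one (hlead x t hp))), fun x t hp => ?_,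
      fun x t hp => ?_⟩
    · rw [constU_factor]
      refine ((hHx x t hp).mul (hasDerivAt_sq ((hk 0).hasDerivAt_x hΩ hp))).congr_deriv ?_
      have e := (X x t hp).2.2
      simp only [← k0] at e
      rw [show dx (k 0) x t = _ from e]
      ring
    · rw [constV_factor]
      refine ((hHt x t hp).mul (hasDerivAt_sq ((hk 0).hasDerivAt_t hΩ hp))).congr_deriv ?_
      have e := (T x t hp).2.2
      simp only [← k0] at e
      rw [show dt (k 0) x t = _ from e]
      ring

end

/-! ### Splitting off a one-fold transformation -/

theorem rowCoeff_zero (n : ℕ) (lam : ℕ → ℂ) (φ : ℕ → Fin 2 → ℂ) : rowCoeff n lam φ 0 = 1 := rfl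

theorem det_Δ₂_one (lam : ℕ → ℂ) (φ : ℕ → Fin 2 → ℂ) : (Δ₂ 1 lam φ).det = φ 0 1 := by
  simp [Δ₂]

theorem det_Δ₁_one (lam : ℕ → ℂ) (φ : ℕ → Fin 2 → ℂ) : (Δ₁ 1 lam φ).det = φ 0 0 := by
  simp [Δ₁]

theorem rowCoeff_one {lam : ℕ → ℂ} {φ : ℕ → Fin 2 → ℂ} (h : φ 0 1 ≠ 0) :
    rowCoeff 1 lam φ 1 = -(lam 0 * φ 0 0) / φ 0 1 := by
  have e := rowEval_rowCoeff (n := 1) (lam := lam) (φ := φ) (by rwa [det_Δ₂_one]) one_pos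
  simp only [rowEval, Finset.sum_range_succ, Finset.sum_range_zero] at e
  simp [rowCoeff] at e ⊢
  rw [eq_div_iff h]
  linear_combination e

theorem nFold_one {l₁ h s l : ℂ} {v : Fin 2 → ℂ} (h0 : v 0 ≠ 0) (h1 : v 1 ≠ 0) :
    nFold 1 (fun _ => l₁) h s (fun _ => v) l = oneFold l₁ h s v l := by
  rw [nFold_eq (by rwa [det_Δ₁_one]) (by rwa [det_Δ₂_one])]
  simp only [descPoly, Finset.sum_range_succ, Finset.sum_range_zero, coeffT, lead₁, lead₂,
    det_Δ₁_one, det_Δ₂_one, rowCoeff_one (φ := fun _ => v) h1,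
    rowCoeff_one (φ := swap fun _ => v) h0, rowCoeff_zero, swap_zero,
    swap_one, oneFold, parityMatrix]
  ext i j
  fin_cases i <;> fin_cases j <;> simp <;> field_simp

section Pointwise

variable {m : ℕ} {lam : ℕ → ℂ} {φ : ℕ → Fin 2 → ℂ} {h s s' : ℂ}

/-- The transform of a further eigenfunction under the `m`-fold transformation. -/
noncomputable def nextVec (m : ℕ) (lam : ℕ → ℂ) (h s : ℂ) (φ : ℕ → Fin 2 → ℂ) : Fin 2 → ℂ :=
  nFold m lam h s φ (lam m) *ᵥ φ m

theorem nextVec_zero (h₁ : (Δ₁ m lam φ).det ≠ 0) (h₂ : (Δ₂ m lam φ).det ≠ 0) :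
    nextVec m lam h s φ 0
      = (if Even m then 1 else h) * s⁻¹ * (-1) ^ m * (Δ₁ (m + 1) lam φ).det := by
  rw [nextVec, nFold_eq h₁ h₂, descPoly_coeffT_mulVec_zero, lead₁, mul_assoc, det_mul_rowEval h₂]
  ring

theorem nextVec_one (h₁ : (Δ₁ m lam φ).det ≠ 0) (h₂ : (Δ₂ m lam φ).det ≠ 0) :
    nextVec m lam h s φ 1
      = (if Even m then 1 else h⁻¹) * s⁻¹ * (-1) ^ m * (Δ₂ (m + 1) lam φ).det := by
  have e := det_mul_rowEval (m := m) (lam := lam) (φ := swap φ) h₁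
  rw [Δ₁_swap, Δ₂_swap] at e
  rw [nextVec, nFold_eq h₁ h₂, descPoly_coeffT_mulVec_one, lead₂, mul_assoc]
  refine (congrArg _ e).trans ?_
  ring

theorem nextVec_ne_zero (hh : h ≠ 0) (hs0 : s ≠ 0) (h₁ : (Δ₁ m lam φ).det ≠ 0)
    (h₂ : (Δ₂ m lam φ).det ≠ 0) (h₁' : (Δ₁ (m + 1) lam φ).det ≠ 0)
    (h₂' : (Δ₂ (m + 1) lam φ).det ≠ 0) :
    nextVec m lam h s φ 0 ≠ 0 ∧ nextVec m lam h s φ 1 ≠ 0 := by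
  rw [nextVec_zero h₁ h₂, nextVec_one h₁ h₂]
  split_ifs <;> simp [*]

/-- The branch of the square root of the product of the two components of `nextVec` that splits off
the last step. -/
theorem nextVec_sq (hh : h ≠ 0) (h₁ : (Δ₁ m lam φ).det ≠ 0) (h₂ : (Δ₂ m lam φ).det ≠ 0)
    (hs' : s' ^ 2 = (Δ₁ (m + 1) lam φ).det * (Δ₂ (m + 1) lam φ).det) :
    ((-1) ^ m * s' / s) ^ 2 = nextVec m lam h s φ 0 * nextVec m lam h s φ 1 := by
  rw [nextVec_zero h₁ h₂, nextVec_one h₁ h₂, div_pow, mul_pow, hs']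
  split_ifs <;> field_simp

/-- The normalization `(g / f) H' = 1` of the new factor `H' = H * lead₂ ^ 2`. -/
theorem nextVec_ratio (hh : h ≠ 0) (h₁ : (Δ₁ m lam φ).det ≠ 0) (h₂ : (Δ₂ m lam φ).det ≠ 0)
    (hs : s ≠ 0) (h₁' : (Δ₁ (m + 1) lam φ).det ≠ 0) (h₂' : (Δ₂ (m + 1) lam φ).det ≠ 0)
    (hs' : s' ^ 2 = (Δ₁ (m + 1) lam φ).det * (Δ₂ (m + 1) lam φ).det) :
    nextVec m lam h s φ 1 / nextVec m lam h s φ 0 * (h ^ 2 * lead₂ (m + 1) lam h s' φ ^ 2) = 1 := by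
  have hs0 : s' ≠ 0 := by
    rintro rfl
    simp [h₁', h₂'] at hs'
  have e1 : ((-1 : ℂ) ^ m) ≠ 0 := by simp
  rw [nextVec_zero h₁ h₂, nextVec_one h₁ h₂, lead₂, mul_pow, mul_pow, inv_pow, hs']
  by_cases hm : Even m
  · rw [if_pos hm, if_pos hm, if_neg (by grind)]
    field_simp
  · rw [if_neg hm, if_neg hm, if_pos (by grind)]
    field_simp

/-- The leading coefficients are multiplicative. The sign `(-1) ^ m` in the root of the one-fold
step comes from `det_mul_rowEval`. -/
theorem lead_mul (hh : h ≠ 0) (hs0 : s ≠ 0) (h₁ : (Δ₁ m lam φ).det ≠ 0)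
    (h₂ : (Δ₂ m lam φ).det ≠ 0) (hs : s ^ 2 = (Δ₁ m lam φ).det * (Δ₂ m lam φ).det)
    (lam' : ℕ → ℂ) :
    lead₁ 1 lam' (h * lead₂ m lam h s φ) ((-1) ^ m * s' / s) (fun _ => nextVec m lam h s φ)
        * lead₁ m lam h s φ = lead₁ (m + 1) lam h s' φ ∧
    lead₂ 1 lam' (h * lead₂ m lam h s φ) ((-1) ^ m * s' / s) (fun _ => nextVec m lam h s φ)
        * lead₂ m lam h s φ = lead₂ (m + 1) lam h s' φ := by
  have e := lead₁_mul_lead₂ hh h₁ h₂ hs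
  have n1 : lead₂ m lam h s φ ≠ 0 := right_ne_zero_of_mul_eq_one e
  have hp : ((-1 : ℂ) ^ m) * (-1) ^ m = 1 := by rw [← mul_pow]; simp
  have hi : ((-1 : ℂ) ^ m * s' / s)⁻¹ = (-1) ^ m * s'⁻¹ * s := by
    rw [inv_div, mul_comm ((-1 : ℂ) ^ m), div_mul_eq_div_div, div_eq_mul_inv,
      inv_eq_of_mul_eq_one_right hp]
    ring
  have cancel : ∀ a o z w : ℂ, a * lead₂ m lam h s φ * ((-1) ^ m * z * s) *
      (o * s⁻¹ * (-1) ^ m * w) * lead₁ m lam h s φ = a * o * z * w := by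
    have hss := mul_inv_cancel₀ hs0
    generalize s⁻¹ = s₁ at hss
    generalize (-1 : ℂ) ^ m = p at hp
    intro a o z w
    linear_combination a * o * z * w * (e * (p * p * (s * s₁)) + hp * (s * s₁) + hss)
  constructor
  · rw [lead₁, if_neg (by decide), det_Δ₂_one, nextVec_one h₁ h₂, hi, lead₁.eq_def (m + 1)]
    have : (if Even (m + 1) then (1 : ℂ) else h) = h * if Even m then 1 else h⁻¹ := by
      by_cases hm : Even m
      · rw [if_pos hm, if_neg (by grind), mul_one]
      · rw [if_neg hm, if_pos (by grind), mul_inv_cancel₀ hh]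
    rw [this]
    generalize (if Even m then (1 : ℂ) else h⁻¹) = o
    exact cancel _ _ _ _
  · rw [lead₂, if_neg (by decide), det_Δ₁_one, nextVec_zero h₁ h₂, hi, lead₂.eq_def (m + 1)]
    have : (if Even (m + 1) then (1 : ℂ) else h⁻¹) = h⁻¹ * if Even m then 1 else h := by
      by_cases hm : Even m
      · rw [if_pos hm, if_neg (by grind), mul_one]
      · rw [if_neg hm, if_pos (by grind), inv_mul_cancel₀ hh]
    rw [this]
    generalize (if Even m then (1 : ℂ) else h) = o
    rw [mul_inv, inv_eq_of_mul_eq_one_left e]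
    refine Eq.trans ?_ (cancel h⁻¹ o _ _)
    ring

/-- The `(m + 1)`-fold transformation is the `m`-fold one followed by a one-fold one: the
difference of the two sides has no leading term and annihilates all the `φ k`, so that it vanishes
by `eq_zero_of_kernel`. -/
theorem coeffT_succ (hh : h ≠ 0) (hs0 : s ≠ 0) (h₁ : (Δ₁ m lam φ).det ≠ 0)
    (h₂ : (Δ₂ m lam φ).det ≠ 0) (hs : s ^ 2 = (Δ₁ m lam φ).det * (Δ₂ m lam φ).det)
    (h₁' : (Δ₁ (m + 1) lam φ).det ≠ 0) (h₂' : (Δ₂ (m + 1) lam φ).det ≠ 0)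
    {S : ℕ → Matrix (Fin 2) (Fin 2) ℂ}
    (hS : S = coeffT 1 (fun _ => lam m) (h * lead₂ m lam h s φ) ((-1) ^ m * s' / s)
      (fun _ => nextVec m lam h s φ)) :
    (∀ j ≤ m + 1, coeffT (m + 1) lam h s' φ j
      = S 0 * coeffT m lam h s φ j + S 1 * delay 1 (coeffT m lam h s φ) j) ∧
    ∀ l, nFold (m + 1) lam h s' φ l = descPoly 1 S l * nFold m lam h s φ l := by
  obtain ⟨hv₀, hv₁⟩ := nextVec_ne_zero hh hs0 h₁ h₂ h₁' h₂'
  obtain ⟨l₁, l₂⟩ := lead_mul (s' := s') hh hs0 h₁ h₂ hs fun _ => lam m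
  set T := coeffT m lam h s φ with hT
  have hprod : ∀ l, descPoly (m + 1) (fun j => S 0 * T j + S 1 * delay 1 T j) l
      = descPoly 1 S l * descPoly m T l := by
    intro l
    have hT0 : ∀ j, m < j → T j = 0 := fun j hj => coeffT_of_lt hj _ _ _ _
    have e0 := descPoly_delay (D := 1) (zero_le_one) hT0 l
    have e1 := descPoly_delay (D := 1) le_rfl hT0 l
    have : delay 0 T = T := by ext1 j; simp [delay]
    rw [this] at e0
    rw [descPoly_add, descPoly_mul_left, descPoly_mul_left, e0, e1,
      descPoly.eq_def 1 S l]
    simp [Finset.sum_range_succ, add_mul]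
  have hker : ∀ l, descPoly (m + 1) (fun j => coeffT (m + 1) lam h s' φ j
      - (S 0 * T j + S 1 * delay 1 T j)) l
      = nFold (m + 1) lam h s' φ l - descPoly 1 S l * nFold m lam h s φ l := by
    intro l
    rw [descPoly_sub, hprod, nFold_eq h₁' h₂', nFold_eq h₁ h₂]
  have main : ∀ j ≤ m + 1, coeffT (m + 1) lam h s' φ j
      - (S 0 * T j + S 1 * delay 1 T j) = 0 := by
    have z : coeffT (m + 1) lam h s' φ 0 - (S 0 * T 0 + S 1 * delay 1 T 0) = 0 := by
      simp only [hS, hT, coeffT, parityMatrix, delay, rowCoeff_zero, mul_one, ← l₁, ← l₂]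
      ext a b
      fin_cases a <;> fin_cases b <;> simp
    have par : ∀ j, HasParity (j + 1) (coeffT (m + 1) lam h s' φ (j + 1)
        - (S 0 * T (j + 1) + S 1 * delay 1 T (j + 1))) := by
      intro j
      have hTp : ∀ j, HasParity j (T j) := fun j => hasParity_parityMatrix _ _ _
      have hSp : ∀ j, HasParity j (S j) := fun j => hS ▸ hasParity_parityMatrix _ _ _
      refine HasParity.sub (hasParity_parityMatrix _ _ _) (HasParity.add ?_ ?_)
      · exact ((hSp 0).mul (hTp (j + 1))).congr (by simp)
      · exact ((hSp 1).mul (hasParity_delay (i := 1) (j := j + 1) hTp)).congr (by grind)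
    intro j hj
    rcases j with _ | j
    · exact z
    refine eq_zero_of_kernel h₁' h₂' par (fun k hk => ?_) j (by omega)
    have e := hker (lam k)
    rw [descPoly, Finset.sum_range_succ', z, smul_zero, add_zero] at e
    simp only [Nat.add_sub_add_right] at e
    simp only [Nat.add_sub_cancel]
    rw [e, Matrix.sub_mulVec, nFold_eq h₁' h₂', descPoly_coeffT_mulVec_eq_zero h₁' h₂' _ _ hk,
      zero_sub, neg_eq_zero, ← Matrix.mulVec_mulVec]
    rcases Nat.lt_succ_iff_lt_or_eq.1 hk with hk | rfl
    · rw [nFold_eq h₁ h₂, descPoly_coeffT_mulVec_eq_zero h₁ h₂ _ _ hk, Matrix.mulVec_zero]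
    · rw [hS]
      exact descPoly_coeffT_mulVec_eq_zero (n := 1) (lam := fun _ => lam k)
        (φ := fun _ => nextVec k lam h s φ) (by rwa [det_Δ₁_one]) (by rwa [det_Δ₂_one]) _ _
        one_pos
  refine ⟨fun j hj => sub_eq_zero.1 (main j hj), fun l => ?_⟩
  rw [← sub_eq_zero, ← hker]
  exact Finset.sum_eq_zero fun j hj => by
    beta_reduce
    rw [main j (by grind), smul_zero]

theorem nFold_succ (hh : h ≠ 0) (hs0 : s ≠ 0) (h₁ : (Δ₁ m lam φ).det ≠ 0)
    (h₂ : (Δ₂ m lam φ).det ≠ 0) (hs : s ^ 2 = (Δ₁ m lam φ).det * (Δ₂ m lam φ).det)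
    (h₁' : (Δ₁ (m + 1) lam φ).det ≠ 0) (h₂' : (Δ₂ (m + 1) lam φ).det ≠ 0) (l : ℂ) :
    nFold (m + 1) lam h s' φ l
      = nFold 1 (fun _ => lam m) (h * lead₂ m lam h s φ) ((-1) ^ m * s' / s)
        (fun _ => nextVec m lam h s φ) l * nFold m lam h s φ l := by
  obtain ⟨hv₀, hv₁⟩ := nextVec_ne_zero hh hs0 h₁ h₂ h₁' h₂'
  rw [(coeffT_succ hh hs0 h₁ h₂ hs h₁' h₂' rfl).2, ← nFold_eq (by rwa [det_Δ₁_one])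
    (by rwa [det_Δ₂_one])]

/-- The potentials after `m + 1` steps arise from those after `m` steps by a one-fold
transformation: compare the subleading coefficients in `coeffT_succ`. -/
theorem newQ_succ (hh : h ≠ 0) (hs0 : s ≠ 0) (h₁ : (Δ₁ m lam φ).det ≠ 0)
    (h₂ : (Δ₂ m lam φ).det ≠ 0) (hs : s ^ 2 = (Δ₁ m lam φ).det * (Δ₂ m lam φ).det)
    (h₁' : (Δ₁ (m + 1) lam φ).det ≠ 0) (h₂' : (Δ₂ (m + 1) lam φ).det ≠ 0) (q r : ℂ) :
    newQ 1 (fun _ => lam m) (h * lead₂ m lam h s φ) ((-1) ^ m * s' / s)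
        (fun _ => nextVec m lam h s φ) (newQ m lam h s φ q) = newQ (m + 1) lam h s' φ q ∧
    newR 1 (fun _ => lam m) (h * lead₂ m lam h s φ) ((-1) ^ m * s' / s)
        (fun _ => nextVec m lam h s φ) (newR m lam h s φ r) = newR (m + 1) lam h s' φ r := by
  obtain ⟨l₁, l₂⟩ := lead_mul (s' := s') hh hs0 h₁ h₂ hs fun _ => lam m
  have e := (coeffT_succ (s' := s') hh hs0 h₁ h₂ hs h₁' h₂' rfl).1 1 (by omega)
  have el := lead₁_mul_lead₂ hh h₁ h₂ hs
  have e0 := congrFun (congrFun e 0) 1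
  have e1 := congrFun (congrFun e 1) 0
  simp [coeffT, parityMatrix, delay, rowCoeff_zero, show ¬ Even 1 by decide] at e0 e1
  rw [← l₁] at e0
  rw [← l₂] at e1
  unfold newQ newR
  rw [← l₁, ← l₂]
  constructor
  · generalize lead₂ 1 _ _ _ _ = K at *
    set c := rowCoeff 1 _ (swap fun _ => nextVec m lam h s φ) 1
    linear_combination (-2 * I * K * lead₂ m lam h s φ) * e1
      - 2 * I * K ^ 2 * c * el
  · generalize lead₁ 1 _ _ _ _ = K at *
    set c := rowCoeff 1 _ (fun _ => nextVec m lam h s φ) 1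
    linear_combination (2 * I * K * lead₁ m lam h s φ) * e0
      + 2 * I * K ^ 2 * c * el

end Pointwise

/-! ### Iteration of one-fold transformations -/

section Iteration

variable {Ω : Set (ℝ × ℝ)} {q r q' r' q₁ r₁ H h s s' : ℝ → ℝ → ℂ} {m n : ℕ} {lam : ℕ → ℂ}
  {Φ : ℕ → ℝ → ℝ → Fin 2 → ℂ} {T T' : ℂ → ℝ → ℝ → Matrix (Fin 2) (Fin 2) ℂ}

theorem IsDarboux.congr (hΩ : IsOpen Ω) (hD : IsDarboux Ω q r q₁ r₁ T)
    (hq : ∀ x t, (x, t) ∈ Ω → q₁ x t = q' x t) (hr : ∀ x t, (x, t) ∈ Ω → r₁ x t = r' x t)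
    (hT : ∀ x t, (x, t) ∈ Ω → ∀ l, T l x t = T' l x t) : IsDarboux Ω q r q' r' T' := by
  intro x t hp l i j
  obtain ⟨dX, dT⟩ := hD x t hp l i j
  have eq : dx q₁ x t = dx q' x t :=
    Filter.EventuallyEq.deriv_eq ((eventually_mem_x hΩ hp).mono fun y hy => hq y t hy)
  have er : dx r₁ x t = dx r' x t :=
    Filter.EventuallyEq.deriv_eq ((eventually_mem_x hΩ hp).mono fun y hy => hr y t hy)
  rw [hq x t hp, hr x t hp, hT x t hp l] at dX
  rw [hq x t hp, hr x t hp, hT x t hp l, eq, er] at dT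
  exact ⟨dX.congr_of_eventuallyEq ((eventually_mem_x hΩ hp).mono fun y hy =>
      (congrArg (fun M : Matrix (Fin 2) (Fin 2) ℂ => M i j) (hT y t hy l)).symm),
    dT.congr_of_eventuallyEq ((eventually_mem_t hΩ hp).mono fun τ hτ =>
      (congrArg (fun M : Matrix (Fin 2) (Fin 2) ℂ => M i j) (hT x τ hτ l)).symm)⟩

/-- A Darboux transformation maps eigenfunctions to eigenfunctions, as
`(T φ)_x = (U' T - T U) φ + T U φ = U' (T φ)`. -/
theorem IsDarboux.isEigenfunction (hD : IsDarboux Ω q r q' r' T) {l : ℂ}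
    {φ : ℝ → ℝ → Fin 2 → ℂ} (hφ : IsEigenfunction Ω q r l φ)
    (hc : ∀ i, IsC2On Ω (fun x t => (T l x t *ᵥ φ x t) i)) :
    IsEigenfunction Ω q' r' l (fun x t => T l x t *ᵥ φ x t) := by
  refine ⟨hc, fun x t hp i => ?_, fun x t hp i => ?_⟩
  · refine (hasDerivAt_mulVec (fun a b => (hD x t hp l a b).1) (hφ.eq_x x t hp) i).congr_deriv ?_
    rw [Matrix.sub_mulVec, Matrix.mulVec_mulVec, Matrix.mulVec_mulVec, sub_add_cancel]
  · refine (hasDerivAt_mulVec (fun a b => (hD x t hp l a b).2) (hφ.eq_t x t hp) i).congr_deriv ?_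
    rw [Matrix.sub_mulVec, Matrix.mulVec_mulVec, Matrix.mulVec_mulVec, sub_add_cancel]

/-- The step from the `m`-fold to the `(m + 1)`-fold transformation is a one-fold Darboux
transformation. -/
theorem isDarboux_step (hΩ : IsOpen Ω) (hH : IsFactor Ω q r H) (hh : IsSqrtOn Ω h H)
    (hΦ : ∀ k < m + 1, IsEigenfunction Ω q r (lam k) (Φ k))
    (hΔ : ∀ x t, (x, t) ∈ Ω → detProd m lam Φ x t ≠ 0) (hs : IsSqrtOn Ω s (detProd m lam Φ))
    (hΔ' : ∀ x t, (x, t) ∈ Ω → detProd (m + 1) lam Φ x t ≠ 0)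
    (hs' : IsSqrtOn Ω s' (detProd (m + 1) lam Φ))
    (hsol : IsSolution Ω (fun x t => newQ m lam (h x t) (s x t) (fun k => Φ k x t) (q x t))
      (fun x t => newR m lam (h x t) (s x t) (fun k => Φ k x t) (r x t)))
    (hD : IsDarboux Ω q r (fun x t => newQ m lam (h x t) (s x t) (fun k => Φ k x t) (q x t))
      (fun x t => newR m lam (h x t) (s x t) (fun k => Φ k x t) (r x t))
      (fun l x t => nFold m lam (h x t) (s x t) (fun k => Φ k x t) l))
    (hF : IsFactor Ω (fun x t => newQ m lam (h x t) (s x t) (fun k => Φ k x t) (q x t))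
      (fun x t => newR m lam (h x t) (s x t) (fun k => Φ k x t) (r x t))
      (fun x t => H x t * lead₂ m lam (h x t) (s x t) (fun k => Φ k x t) ^ 2)) :
    (∀ x t, (x, t) ∈ Ω → nextVec m lam (h x t) (s x t) (fun k => Φ k x t) 0 ≠ 0 ∧
      nextVec m lam (h x t) (s x t) (fun k => Φ k x t) 1 ≠ 0) ∧
    IsSqrtOn Ω (fun x t => h x t * lead₂ m lam (h x t) (s x t) (fun k => Φ k x t))
      (fun x t => H x t * lead₂ m lam (h x t) (s x t) (fun k => Φ k x t) ^ 2) ∧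
    IsSqrtOn Ω (fun x t => (-1) ^ m * s' x t / s x t)
      (fun x t => nextVec m lam (h x t) (s x t) (fun k => Φ k x t) 0 *
        nextVec m lam (h x t) (s x t) (fun k => Φ k x t) 1) ∧
    IsDarboux Ω (fun x t => newQ m lam (h x t) (s x t) (fun k => Φ k x t) (q x t))
      (fun x t => newR m lam (h x t) (s x t) (fun k => Φ k x t) (r x t))
      (fun x t => newQ (m + 1) lam (h x t) (s' x t) (fun k => Φ k x t) (q x t))
      (fun x t => newR (m + 1) lam (h x t) (s' x t) (fun k => Φ k x t) (r x t))
      (fun l x t => oneFold (lam m) (h x t * lead₂ m lam (h x t) (s x t) (fun k => Φ k x t))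
        ((-1) ^ m * s' x t / s x t) (nextVec m lam (h x t) (s x t) (fun k => Φ k x t)) l) := by
  have hΦ2' : ∀ k < m + 1, ∀ i, IsC2On Ω (fun x t => Φ k x t i) := fun k hk => (hΦ k hk).c2
  have hΦ2 : ∀ k < m, ∀ i, IsC2On Ω (fun x t => Φ k x t i) := fun k hk => hΦ2' k (by omega)
  have hd : ∀ x t, (x, t) ∈ Ω → (Δ₁ m lam (fun k => Φ k x t)).det ≠ 0 ∧
      (Δ₂ m lam (fun k => Φ k x t)).det ≠ 0 := fun x t hp =>
    ⟨left_ne_zero_of_mul (hΔ x t hp), right_ne_zero_of_mul (hΔ x t hp)⟩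
  have hd' : ∀ x t, (x, t) ∈ Ω → (Δ₁ (m + 1) lam (fun k => Φ k x t)).det ≠ 0 ∧
      (Δ₂ (m + 1) lam (fun k => Φ k x t)).det ≠ 0 := fun x t hp =>
    ⟨left_ne_zero_of_mul (hΔ' x t hp), right_ne_zero_of_mul (hΔ' x t hp)⟩
  have hh2 := hh.isC2On hΩ hH.c2 hH.ne_zero
  have hh0 : ∀ x t, (x, t) ∈ Ω → h x t ≠ 0 := fun x t hp => hh.ne_zero hH.ne_zero hp
  have hs2 : IsC2On Ω s := hs.isC2On hΩ ((isC2On_det_Δ₁ hΦ2).mul (isC2On_det_Δ₂ hΦ2)) hΔ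
  have hs0 : ∀ x t, (x, t) ∈ Ω → s x t ≠ 0 := fun x t hp => hs.ne_zero hΔ hp
  have hl₂ := isC2On_lead₂ (lam := lam) hΦ2 hh2 hh0 hs2 hs0
  have hv : ∀ x t, (x, t) ∈ Ω → nextVec m lam (h x t) (s x t) (fun k => Φ k x t) 0 ≠ 0 ∧
      nextVec m lam (h x t) (s x t) (fun k => Φ k x t) 1 ≠ 0 := fun x t hp =>
    nextVec_ne_zero (hh0 x t hp) (hs0 x t hp) (hd x t hp).1 (hd x t hp).2 (hd' x t hp).1
      (hd' x t hp).2
  have hvc : ∀ i, IsC2On Ω (fun x t => nextVec m lam (h x t) (s x t) (fun k => Φ k x t) i) := by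
    have hb : IsC2On Ω (fun x t => if Even m then (1 : ℂ) else h x t) := by
      split_ifs
      exacts [isC2On_const 1, hh2]
    have hb' : IsC2On Ω (fun x t => if Even m then (1 : ℂ) else (h x t)⁻¹) := by
      split_ifs
      exacts [isC2On_const 1, hh2.inv hh0]
    intro i
    fin_cases i
    · exact (((hb.mul (hs2.inv hs0)).mul (isC2On_const _)).mul (isC2On_det_Δ₁ hΦ2')).congr
        fun x t hp => nextVec_zero (hd x t hp).1 (hd x t hp).2
    · exact (((hb'.mul (hs2.inv hs0)).mul (isC2On_const _)).mul (isC2On_det_Δ₂ hΦ2')).congr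
        fun x t hp => nextVec_one (hd x t hp).1 (hd x t hp).2
  have hfac : IsSqrtOn Ω (fun x t => h x t * lead₂ m lam (h x t) (s x t) (fun k => Φ k x t))
      (fun x t => H x t * lead₂ m lam (h x t) (s x t) (fun k => Φ k x t) ^ 2) :=
    ⟨ContDiffOn.continuousOn (hh2.mul hl₂), fun x t hp => by rw [mul_pow, hh.2 x t hp]⟩
  have hroot : IsSqrtOn Ω (fun x t => (-1) ^ m * s' x t / s x t)
      (fun x t => nextVec m lam (h x t) (s x t) (fun k => Φ k x t) 0 *
        nextVec m lam (h x t) (s x t) (fun k => Φ k x t) 1) :=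
    ⟨(continuousOn_const.mul hs'.1).div hs.1 fun p hp => hs0 p.1 p.2 hp, fun x t hp =>
      nextVec_sq (hh0 x t hp) (hd x t hp).1 (hd x t hp).2 (hs'.2 x t hp)⟩
  refine ⟨hv, hfac, hroot, ?_⟩
  have hφ : IsEigenfunction Ω _ _ (lam m)
      (fun x t => nextVec m lam (h x t) (s x t) (fun k => Φ k x t)) :=
    hD.isEigenfunction (hΦ m (by omega)) hvc
  have hprod : detProd 1 (fun _ => lam m)
      (fun _ x t => nextVec m lam (h x t) (s x t) (fun k => Φ k x t))
      = fun x t => nextVec m lam (h x t) (s x t) (fun k => Φ k x t) 0 *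
        nextVec m lam (h x t) (s x t) (fun k => Φ k x t) 1 := by
    ext x t
    rw [detProd, det_Δ₁_one, det_Δ₂_one]
  refine (nFold_darboux (n := 1) (lam := fun _ => lam m)
    (Φ := fun _ x t => nextVec m lam (h x t) (s x t) (fun k => Φ k x t)) hΩ hsol hF hfac le_rfl
    (fun _ _ => hφ) (fun x t hp => by
      rw [hprod]; exact mul_ne_zero (hv x t hp).1 (hv x t hp).2) (hprod ▸ hroot)).2.1.congr hΩ
    (fun x t hp => ?_) (fun x t hp => ?_) (fun x t hp l => ?_)
  · exact (newQ_succ (hh0 x t hp) (hs0 x t hp) (hd x t hp).1 (hd x t hp).2 (hs.2 x t hp)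
      (hd' x t hp).1 (hd' x t hp).2 (q x t) (r x t)).1
  · exact (newQ_succ (hh0 x t hp) (hs0 x t hp) (hd x t hp).1 (hd x t hp).2 (hs.2 x t hp)
      (hd' x t hp).1 (hd' x t hp).2 (q x t) (r x t)).2
  · exact nFold_one (hv x t hp).1 (hv x t hp).2

theorem newQ_zero (lam : ℕ → ℂ) (h : ℂ) (φ : ℕ → Fin 2 → ℂ) (q : ℂ) :
    newQ 0 lam h 1 φ q = q := by
  simp [newQ, lead₂, rowCoeff]

theorem newR_zero (lam : ℕ → ℂ) (h : ℂ) (φ : ℕ → Fin 2 → ℂ) (r : ℂ) :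
    newR 0 lam h 1 φ r = r := by
  simp [newR, lead₁, rowCoeff]

theorem lead₂_zero (lam : ℕ → ℂ) (h : ℂ) (φ : ℕ → Fin 2 → ℂ) : lead₂ 0 lam h 1 φ = 1 := by
  simp [lead₂]

theorem nFold_zero (lam : ℕ → ℂ) (h : ℂ) (φ : ℕ → Fin 2 → ℂ) (l : ℂ) :
    nFold 0 lam h 1 φ l = 1 := by
  rw [nFold_eq (by simp) (by simp)]
  ext a b
  fin_cases a <;> fin_cases b <;>
    simp [descPoly, coeffT, parityMatrix, lead₁, lead₂, rowCoeff_zero]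

/-- `nFold_darboux` including the empty transformation, for the branch `1` of the root of the empty
determinants. -/
theorem nFold_darboux_of_zero (hΩ : IsOpen Ω) (hqr : IsSolution Ω q r) (hH : IsFactor Ω q r H)
    (hh : IsSqrtOn Ω h H) (hΦ : ∀ k < n, IsEigenfunction Ω q r (lam k) (Φ k))
    (hΔ : ∀ x t : ℝ, (x, t) ∈ Ω → detProd n lam Φ x t ≠ 0)
    (hs : IsSqrtOn Ω s (detProd n lam Φ)) (h0 : n = 0 → s = fun _ _ => 1) :
    IsSolution Ω (fun x t => newQ n lam (h x t) (s x t) (fun k => Φ k x t) (q x t))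
        (fun x t => newR n lam (h x t) (s x t) (fun k => Φ k x t) (r x t)) ∧
      IsDarboux Ω q r (fun x t => newQ n lam (h x t) (s x t) (fun k => Φ k x t) (q x t))
        (fun x t => newR n lam (h x t) (s x t) (fun k => Φ k x t) (r x t))
        (fun l x t => nFold n lam (h x t) (s x t) (fun k => Φ k x t) l) ∧
      IsFactor Ω (fun x t => newQ n lam (h x t) (s x t) (fun k => Φ k x t) (q x t))
        (fun x t => newR n lam (h x t) (s x t) (fun k => Φ k x t) (r x t))
        (fun x t => H x t * lead₂ n lam (h x t) (s x t) (fun k => Φ k x t) ^ 2) := by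
  rcases Nat.eq_zero_or_pos n with rfl | hn
  · obtain rfl := h0 rfl
    simp only [newQ_zero, newR_zero, lead₂_zero, nFold_zero, one_pow, mul_one]
    refine ⟨hqr, fun x t _ l i j => ?_, hH⟩
    simpa using ⟨hasDerivAt_const x ((1 : Matrix (Fin 2) (Fin 2) ℂ) i j),
      hasDerivAt_const t ((1 : Matrix (Fin 2) (Fin 2) ℂ) i j)⟩
  · exact nFold_darboux hΩ hqr hH hh hn hΦ hΔ hs

/-- The `m`-fold transformations, `m ≤ n`, arise successively from one-fold transformations. -/
theorem isIterated_nFold (hΩ : IsOpen Ω) (hqr : IsSolution Ω q r) (hH : IsFactor Ω q r H)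
    (hh : IsSqrtOn Ω h H) (hΦ : ∀ k < n, IsEigenfunction Ω q r (lam k) (Φ k))
    {σ : ℕ → ℝ → ℝ → ℂ} (hσ0 : σ 0 = fun _ _ => 1)
    (hΔ : ∀ m ≤ n, ∀ x t : ℝ, (x, t) ∈ Ω → detProd m lam Φ x t ≠ 0)
    (hσ : ∀ m ≤ n, IsSqrtOn Ω (σ m) (detProd m lam Φ)) :
    ∀ m ≤ n, IsIterated Ω lam Φ q r H m
      (fun l x t => nFold m lam (h x t) (σ m x t) (fun k => Φ k x t) l)
      (fun x t => newQ m lam (h x t) (σ m x t) (fun k => Φ k x t) (q x t))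
      (fun x t => newR m lam (h x t) (σ m x t) (fun k => Φ k x t) (r x t))
      (fun x t => H x t * lead₂ m lam (h x t) (σ m x t) (fun k => Φ k x t) ^ 2) := by
  have data := fun m (hm : m ≤ n) => nFold_darboux_of_zero (n := m) hΩ hqr hH hh
    (fun k hk => hΦ k (by omega)) (hΔ m hm) (hσ m hm) (by rintro rfl; exact hσ0)
  have hh0 : ∀ x t, (x, t) ∈ Ω → h x t ≠ 0 := fun x t hp => hh.ne_zero hH.ne_zero hp
  intro m
  induction m with
  | zero =>
    intro _
    simp only [hσ0, newQ_zero, newR_zero, lead₂_zero, nFold_zero, one_pow, mul_one]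
    exact IsIterated.zero
  | succ m ih =>
    intro hm
    have hm' : m ≤ n := by omega
    obtain ⟨hsol, hD, hF⟩ := data m hm'
    obtain ⟨hv, hfac, hroot, hstep⟩ := isDarboux_step hΩ hH hh (fun k hk => hΦ k (by omega))
      (hΔ m hm') (hσ m hm') (hΔ _ hm) (hσ _ hm) hsol hD hF
    refine IsIterated.succ (prev := ih hm') (φ_eq := fun x t _ => rfl)
      (f_ne := fun x t hp => (hv x t hp).1) (g_ne := fun x t hp => (hv x t hp).2)
      (h_sqrt := hfac) (s_sqrt := hroot) (step := hstep) (T_eq := fun x t hp l => ?_)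
      (factor := (data (m + 1) hm).2.2) (normalized := fun x t hp => ?_)
    · refine Eq.trans ?_ (congrArg (· * _) (nFold_one (hv x t hp).1 (hv x t hp).2))
      exact nFold_succ (hh0 x t hp) ((hσ m hm').ne_zero (hΔ m hm') hp)
        (left_ne_zero_of_mul (hΔ m hm' x t hp)) (right_ne_zero_of_mul (hΔ m hm' x t hp))
        ((hσ m hm').2 x t hp) (left_ne_zero_of_mul (hΔ _ hm x t hp))
        (right_ne_zero_of_mul (hΔ _ hm x t hp)) l
    · rw [← hh.2 x t hp]
      exact nextVec_ratio (hh0 x t hp) (left_ne_zero_of_mul (hΔ m hm' x t hp))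
        (right_ne_zero_of_mul (hΔ m hm' x t hp)) ((hσ m hm').ne_zero (hΔ m hm') hp)
        (left_ne_zero_of_mul (hΔ _ hm x t hp)) (right_ne_zero_of_mul (hΔ _ hm x t hp))
        ((hσ _ hm).2 x t hp)

end Iteration

end CLL

theorem theorem1
    (Ω : Set (ℝ × ℝ)) (hΩ : IsOpen Ω)
    (q r : ℝ → ℝ → ℂ) (hqr : CLL.IsSolution Ω q r)
    (H h : ℝ → ℝ → ℂ) (hH : CLL.IsFactor Ω q r H) (hh : CLL.IsSqrtOn Ω h H)
    (n : ℕ) (hn : 1 ≤ n)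
    (lam : ℕ → ℂ) (Φ : ℕ → ℝ → ℝ → Fin 2 → ℂ)
    (hΦ : ∀ k < n, CLL.IsEigenfunction Ω q r (lam k) (Φ k))
    (hΔ : ∀ x t : ℝ, (x, t) ∈ Ω → CLL.detProd n lam Φ x t ≠ 0)
    (s : ℝ → ℝ → ℂ) (hs : CLL.IsSqrtOn Ω s (CLL.detProd n lam Φ)) :
    ∃ qn rn : ℝ → ℝ → ℂ,
      CLL.IsSolution Ω qn rn ∧
      CLL.IsDarboux Ω q r qn rn
        (fun l x t => CLL.nFold n lam (h x t) (s x t) (fun k => Φ k x t) l) ∧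
      (∀ k < n, ∀ x t : ℝ, (x, t) ∈ Ω →
        (CLL.nFold n lam (h x t) (s x t) (fun j => Φ j x t) (lam k)).mulVec (Φ k x t) = 0) ∧
      ((∀ m : ℕ, 1 ≤ m → m < n →
          (∀ x t : ℝ, (x, t) ∈ Ω → CLL.detProd m lam Φ x t ≠ 0) ∧
          ∃ σ : ℝ → ℝ → ℂ, CLL.IsSqrtOn Ω σ (CLL.detProd m lam Φ)) →
        ∃ Hn : ℝ → ℝ → ℂ,
          CLL.IsIterated Ω lam Φ q r H n
            (fun l x t => CLL.nFold n lam (h x t) (s x t) (fun k => Φ k x t) l) qn rn Hn) := by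
  obtain ⟨hsol, hD, -⟩ := CLL.nFold_darboux hΩ hqr hH hh hn hΦ hΔ hs
  refine ⟨_, _, hsol, hD, fun k hk x t hp => ?_, fun hm => ?_⟩
  · have h₁ := left_ne_zero_of_mul (hΔ x t hp)
    have h₂ := right_ne_zero_of_mul (hΔ x t hp)
    rw [CLL.nFold_eq h₁ h₂]
    exact CLL.descPoly_coeffT_mulVec_eq_zero h₁ h₂ _ _ hk
  · have hroot : ∀ m, ∃ σ : ℝ → ℝ → ℂ, (m = 0 → σ = fun _ _ => 1) ∧ (m = n → σ = s) ∧
        (m ≤ n → (∀ x t : ℝ, (x, t) ∈ Ω → CLL.detProd m lam Φ x t ≠ 0) ∧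
          CLL.IsSqrtOn Ω σ (CLL.detProd m lam Φ)) := by
      intro m
      rcases Nat.eq_zero_or_pos m with rfl | hm0
      · refine ⟨fun _ _ => 1, fun _ => rfl, fun h => by omega, fun _ => ?_⟩
        simp [CLL.detProd, CLL.IsSqrtOn, continuousOn_const]
      rcases eq_or_ne m n with rfl | hmn
      · exact ⟨s, fun h => by omega, fun _ => rfl, fun _ => ⟨hΔ, hs⟩⟩
      by_cases hlt : m < n
      · obtain ⟨hne, σ, hσ⟩ := hm m hm0 hlt
        exact ⟨σ, fun h => by omega, fun h => absurd h hmn, fun _ => ⟨hne, hσ⟩⟩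
      · exact ⟨s, fun h => by omega, fun h => absurd h hmn, fun h => by omega⟩
    choose σ hσ0 hσn hσ using hroot
    have key := CLL.isIterated_nFold hΩ hqr hH hh hΦ (hσ0 0 rfl) (fun m h => (hσ m h).1)
      (fun m h => (hσ m h).2) n le_rfl
    rw [hσn n rfl] at key
    exact ⟨_, key⟩
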